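/- Let $\mathcal P(\mathbb Z^2)$ be the family of lattice polytopes in $\mathbb R^2$ (convex hulls of finite non-empty subsets of $\mathbb Z^2$), and for a measurable $\Omega\subseteq\mathbb R^2$ let $\mathcal M(\Omega)$ be the space of Lebesgue measurable functions $\Omega\to\mathbb R$ (not identified when equal almost everywhere). A valuation is a map $Z:\mathcal P(\mathbb Z^2)\to\mathcal M(\mathbb R^2)$ with $Z(P\cup Q)+Z(P\cap Q)=Z(P)+Z(Q)$ whenever $P\cup Q$ is convex. It is simple if $Z(P)=0$ whenever $\dim P\le 1$, translatively exponential if $Z(P+z)(x)=e^{\langle z,x\rangle}Z(P)(x)$ for $z\in\mathbb Z^2$, $x\in\mathbb R^2$, and $\mathrm{GL}(2,\mathbb Z)$ covariant if $Z(\Phi P)(x)=Z(P)(\Phi^{T}x)$ for $\Phi\in\mathrm{GL}(2,\mathbb Z)$, $x\in\mathbb R^2$. Let $T$ be the triangle with vertices $(0,0),(1,0),(0,1)$, let $\tau=\frac{\sqrt5+1}{2}$, let $$\widetilde\Omega_2=\{(\tau s,s):1\le s<\tau\}\cup\{(x,y):0\le x\le y\},$$ and read $\frac{e^t-1}{t}$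 as $1$ at $t=0$. For $\varrho:[0,\infty)^2\to\mathbb R$ and $f:\mathbb R^2\to\mathbb R$ consider $$(2x+y)\,\varrho(x,y)=(x+y)\,\varrho(x,x+y)+x\,\varrho(x+y,x)\qquad(x,y\ge 0),\tag{1}$$ $$f(x,y)=\frac{e^x}{y}\cdot\frac{e^{y-x}-1}{y-x}\cdot\varrho(y-x,x)-\frac1y\cdot\frac{e^x-1}{x}\cdot\varrho(x,y-x)\qquad(0\le x\le y,\ y>0).\tag{2}$$ Theorem. There is a bijection between $\mathcal M(\widetilde\Omega_2)$ and the set of simple, translatively exponential and $\mathrm{GL}(2,\mathbb Z)$ covariant valuations $Z:\mathcal P(\mathbb Z^2)\to\mathcal M(\mathbb R^2)$, given as follows. (i) For every $\tilde\varrho\in\mathcal M(\widetilde\Omega_2)$ there is a unique measurable extension $\varrho:[0,\infty)^2\to\mathbb R$ of $\tilde\varrho$ satisfying (1), and the valuation $Z$ assigned to $\tilde\varrho$ is the unique simple, translatively exponential and $\mathrm{GL}(2,\mathbb Z)$ covariant valuation $Z:\mathcal P(\mathbb Z^2)\to\mathcal M(\mathbb R^2)$ such that $Z(T)(0,0)=\tilde\varrho(0,0)$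 and $f=Z(T)$ satisfies (2). (ii) For every simple, translatively exponential and $\mathrm{GL}(2,\mathbb Z)$ covariant valuation $Z:\mathcal P(\mathbb Z^2)\to\mathcal M(\mathbb R^2)$ there is a unique measurable $\varrho:[0,\infty)^2\to\mathbb R$ with $\varrho(0,0)=Z(T)(0,0)$ that satisfies (1) and, with $f=Z(T)$, (2). -/

import Mathlib

namespace ExpVal

open MeasureTheory

/-- The plane `ℝ²`, with Lebesgue measure `volume` and inner product `⬝ᵥ`. -/
abbrev Plane : Type := Fin 2 → ℝ

/-- The inclusion of `ℤ²` in `ℝ²`. -/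
def toPlane (z : Fin 2 → ℤ) : Plane := fun i => (z i : ℝ)

/-- Lattice polytopes in `ℝ²`: convex hulls of finite nonempty sets of lattice points. -/
def IsLatticePolytope (P : Set Plane) : Prop :=
  ∃ S : Finset (Fin 2 → ℤ), S.Nonempty ∧ P = convexHull ℝ (toPlane '' (S : Set (Fin 2 → ℤ)))

/-- The family `𝒫(ℤ²)` of all lattice polytopes (points, segments, polygons). -/
abbrev LatticePolytope : Type := {P : Set Plane // IsLatticePolytope P}

/-- The linear action of `GL(2, ℤ)` on `ℝ²`. -/
def glMap (Φ : Matrix.GeneralLinearGroup (Fin 2) ℤ) : Plane →ₗ[ℝ] Plane :=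
  ((Φ : Matrix (Fin 2) (Fin 2) ℤ).map (fun n : ℤ => (n : ℝ))).mulVecLin

/-- The transpose `Φᵀ` acting on `ℝ²`. -/
def glMapTranspose (Φ : Matrix.GeneralLinearGroup (Fin 2) ℤ) : Plane →ₗ[ℝ] Plane :=
  ((Φ : Matrix (Fin 2) (Fin 2) ℤ).map (fun n : ℤ => (n : ℝ))).transpose.mulVecLin

theorem glMap_toPlane (Φ : Matrix.GeneralLinearGroup (Fin 2) ℤ) (z : Fin 2 → ℤ) :
    glMap Φ (toPlane z) = toPlane ((Φ : Matrix (Fin 2) (Fin 2) ℤ).mulVec z) := by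
  ext i
  simp [glMap, toPlane, Matrix.mulVec, dotProduct]

theorem isLatticePolytope_image (P : LatticePolytope)
    (Φ : Matrix.GeneralLinearGroup (Fin 2) ℤ) : IsLatticePolytope (glMap Φ '' P.1) := by
  classical
  obtain ⟨P, S, hS, rfl⟩ := P
  refine ⟨S.image (fun z => (Φ : Matrix (Fin 2) (Fin 2) ℤ).mulVec z), hS.image _, ?_⟩
  rw [(glMap Φ).image_convexHull, Finset.coe_image, Set.image_image, Set.image_image]
  simp only [glMap_toPlane]

theorem isLatticePolytope_translate (P : LatticePolytope) (z : Fin 2 → ℤ) :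
    IsLatticePolytope ((fun p => p + toPlane z) '' P.1) := by
  classical
  obtain ⟨P, S, hS, rfl⟩ := P
  refine ⟨S.image (fun w => w + z), hS.image _, ?_⟩
  have h := (AffineMap.id ℝ Plane + AffineMap.const ℝ Plane (toPlane z)).image_convexHull
    (toPlane '' (S : Set (Fin 2 → ℤ)))
  have e : (⇑(AffineMap.id ℝ Plane + AffineMap.const ℝ Plane (toPlane z)) : Plane → Plane) =
      fun p => p + toPlane z := rfl
  rw [e] at h
  rw [h, Finset.coe_image, Set.image_image, Set.image_image]
  congr 2
  ext w i
  simp [toPlane]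

/-- The lattice polytope `Φ P`. -/
def LatticePolytope.image (Φ : Matrix.GeneralLinearGroup (Fin 2) ℤ) (P : LatticePolytope) :
    LatticePolytope :=
  ⟨glMap Φ '' P.1, isLatticePolytope_image P Φ⟩

/-- The lattice polytope `P + z`. -/
def LatticePolytope.translate (P : LatticePolytope) (z : Fin 2 → ℤ) : LatticePolytope :=
  ⟨(fun p => p + toPlane z) '' P.1, isLatticePolytope_translate P z⟩

/-- The standard triangle `T = [e₁, e₂, o]`. -/
def stdTriangle : LatticePolytope :=
  ⟨convexHull ℝ {![1, 0], ![0, 1], ![0, 0]}, {![1, 0], ![0, 1], ![0, 0]}, by simp, by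
    have h1 : toPlane ![1, 0] = ![1, 0] := by ext i; fin_cases i <;> simp [toPlane]
    have h2 : toPlane ![0, 1] = ![0, 1] := by ext i; fin_cases i <;> simp [toPlane]
    have h3 : toPlane ![0, 0] = ![0, 0] := by ext i; fin_cases i <;> simp [toPlane]
    simp only [Finset.coe_insert, Finset.coe_singleton, Set.image_insert_eq,
      Set.image_singleton, h1, h2, h3]⟩

/-- The valuation property `Z(P ∪ Q) + Z(P ∩ Q) = Z(P) + Z(Q)` whenever `P ∪ Q` is convex. For
lattice polytopes `P`, `Q` in the plane with `P ∪ Q` convex, `P ∪ Q` and `P ∩ Q` are again lattice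
polytopes; they are the `U` and `I` below. -/
def IsValuation (Z : LatticePolytope → Plane → ℝ) : Prop :=
  ∀ P Q U I : LatticePolytope, Convex ℝ (P.1 ∪ Q.1) → U.1 = P.1 ∪ Q.1 → I.1 = P.1 ∩ Q.1 →
    Z U + Z I = Z P + Z Q

/-- `Z` vanishes on lattice polytopes of dimension at most one. -/
def IsSimple (Z : LatticePolytope → Plane → ℝ) : Prop :=
  ∀ P : LatticePolytope, Module.finrank ℝ (vectorSpan ℝ P.1) ≤ 1 → Z P = 0

/-- `Z(P + z)(x) = e^⟨z, x⟩ Z(P)(x)` for `z ∈ ℤ²`. -/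
def IsTranslativelyExponential (Z : LatticePolytope → Plane → ℝ) : Prop :=
  ∀ (P : LatticePolytope) (z : Fin 2 → ℤ) (x : Plane),
    Z (P.translate z) x = Real.exp (toPlane z ⬝ᵥ x) * Z P x

/-- `Z(Φ P)(x) = Z(P)(Φᵀ x)` for `Φ ∈ GL(2, ℤ)`. -/
def IsGLCovariant (Z : LatticePolytope → Plane → ℝ) : Prop :=
  ∀ (Φ : Matrix.GeneralLinearGroup (Fin 2) ℤ) (P : LatticePolytope) (x : Plane),
    Z (P.image Φ) x = Z P (glMapTranspose Φ x)

/-- Simple, translatively exponential and `GL(2, ℤ)` covariant valuations on `𝒫(ℤ²)` with values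
in the space `ℳ(ℝ²)` of Lebesgue measurable functions (everywhere defined functions, preimages of
Borel sets are Lebesgue measurable; functions are not identified when equal almost everywhere). -/
structure IsSimpleExpValuation (Z : LatticePolytope → Plane → ℝ) : Prop where
  measurable : ∀ P, NullMeasurable (Z P) (volume : Measure Plane)
  valuation : IsValuation Z
  simple : IsSimple Z
  translativelyExponential : IsTranslativelyExponential Z
  glCovariant : IsGLCovariant Z

/-- The set of all simple translatively exponential `GL(2, ℤ)` covariant valuations. -/
abbrev SimpleExpValuation : Type :=
  {Z : LatticePolytope → Plane → ℝ // IsSimpleExpValuation Z}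

/-- Lebesgue measurability of `f : Ω → ℝ` for `Ω ⊆ ℝ²`: the preimage of any Borel set is a Lebesgue
measurable subset of the plane. -/
def IsLebesgueMeasurable {Ω : Set Plane} (f : Ω → ℝ) : Prop :=
  ∀ B : Set ℝ, MeasurableSet B →
    NullMeasurableSet (Subtype.val '' (f ⁻¹' B)) (volume : Measure Plane)

/-- The space `ℳ(Ω)` of real valued Lebesgue measurable functions on `Ω`. -/
abbrev MeasurableFun (Ω : Set Plane) : Type := {f : Ω → ℝ // IsLebesgueMeasurable f}

/-- The quadrant `[0, ∞)²`. -/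
def quadrant : Set Plane := {p | 0 ≤ p 0 ∧ 0 ≤ p 1}

/-- The point `(x, y)` of the quadrant. -/
def quadrantMk (x y : ℝ) (hx : 0 ≤ x) (hy : 0 ≤ y) : quadrant := ⟨![x, y], hx, hy⟩

/-- `Ω̃₂ = {(τ s, s) : 1 ≤ s < τ} ∪ {(x, y) : 0 ≤ x ≤ y}` with `τ` the golden ratio. -/
def omega2 : Set Plane :=
  {p | ∃ s : ℝ, 1 ≤ s ∧ s < Real.goldenRatio ∧ p = ![Real.goldenRatio * s, s]} ∪
    {p | 0 ≤ p 0 ∧ p 0 ≤ p 1}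

theorem omega2_subset_quadrant : omega2 ⊆ quadrant := by
  rintro p (⟨s, h1, -, rfl⟩ | ⟨h0, h1⟩)
  · have hs : (0 : ℝ) ≤ s := by linarith
    exact ⟨mul_nonneg Real.goldenRatio_pos.le hs, hs⟩
  · exact ⟨h0, h0.trans h1⟩

/-- The origin as a point of `Ω̃₂`. -/
def omega2Zero : omega2 := ⟨![0, 0], Or.inr ⟨le_refl _, le_refl _⟩⟩

/-- The analytic function `(e^t - 1) / t`, with value `1` at `t = 0`. -/
noncomputable def phi (t : ℝ) : ℝ := if t = 0 then 1 else (Real.exp t - 1) / t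

/-- `(2x + y) ϱ(x, y) = (x + y) ϱ(x, x + y) + x ϱ(x + y, x)` for all `x, y ≥ 0`. -/
def RhoEquation (ρ : quadrant → ℝ) : Prop :=
  ∀ (x y : ℝ) (hx : 0 ≤ x) (hy : 0 ≤ y),
    (2 * x + y) * ρ (quadrantMk x y hx hy) =
      (x + y) * ρ (quadrantMk x (x + y) hx (add_nonneg hx hy)) +
        x * ρ (quadrantMk (x + y) x (add_nonneg hx hy) hx)

/-- The explicit formula for `f = Z(T)` on `{(x, y) : 0 ≤ x ≤ y, y > 0}` in terms of `ϱ`. -/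
def TriangleFormula (f : Plane → ℝ) (ρ : quadrant → ℝ) : Prop :=
  ∀ (x y : ℝ) (hx : 0 ≤ x) (hxy : x ≤ y), 0 < y →
    f ![x, y] =
      Real.exp x / y * phi (y - x) * ρ (quadrantMk (y - x) x (sub_nonneg.2 hxy) hx) -
        1 / y * phi x * ρ (quadrantMk x (y - x) hx (sub_nonneg.2 hxy))

/-- `ϱ` is a measurable extension of `ϱ̃` to `[0, ∞)²` satisfying the functional equation. -/
structure IsRhoExtension (ρt : omega2 → ℝ) (ρ : quadrant → ℝ) : Prop where
  measurable : IsLebesgueMeasurable ρ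
  restrict : ∀ p : omega2, ρ (Set.inclusion omega2_subset_quadrant p) = ρt p
  equation : RhoEquation ρ

end ExpVal

namespace ExpVal

open MeasureTheory

/-! ### Splitting convex hulls along a line -/

/-! Write `φ(t) = (e^t - 1)/t`. The link between `Z` and `ϱ` is the function `F(p, q) = Z([0,1]²)(p,
q) / (φ(p) φ(q))`. Cutting the square along a diagonal expresses it through `Z(T)`; solving the
resulting 2×2 system gives `y Z(T)(x, y) = e^x φ(y-x) F(y-x, y) - φ(x) F(x, y)`. The symmetries of
the square make `F` symmetric and even, and the symmetry of `T` in its two coordinates gives `(p+q)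
F(p, q) = p F(q, p+q) + q F(p, p+q)`; such an `F` is called a symbol (`isSymbol_symbolOfValuation`).
With `ϱ(x, y) = F(x, x+y)` away from the origin, the formula for `Z(T)` is (2) and the three-term
relation for `0 ≤ p ≤ q` is (1); all other signs and orders of `p, q` follow by symmetry
(`isSymbol_symbolOf`).

Conversely, a symbol produces a valuation. For fixed `x ≠ 0` one seeks odd weights `w(v)` of
primitive vectors whose relation on every lattice basis is prescribed by `-F`. They exist by a
Stern–Brocot descent, the three-term relation being the compatibility condition at each mediant
(`exists_isWeight`), and they are unique up to multiples of `v ↦ ⟨v, x⟩`, because `SL(2, ℤ)` is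
generated by two matrices (`IsWeight.exists_eq_add`). Integrating `e^⟨x, ·⟩` over the primitive
boundary segments of `P`, weighted by `w`, gives a simple valuation (`edgeSum_valuation`). The
indeterminacy of `w` contributes a telescoping sum around the boundary, hence nothing, and this
gives covariance. At `x = 0` a multiple of the area is used instead.

Nothing else can occur, since a simple valuation is determined by its values on unimodular
triangles: polygons are cut along diagonals and triangles at lattice points (`valuation_mem`). The
same statement, for the group of measurable functions, transfers measurability from `T` to every
`P`.

It remains to solve (1). For `0 < y < x` it expresses `ϱ(x, y)` by `ϱ(y, x-y)` and `ϱ(y, x)`, and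
the last point lies in `{x ≤ y}`, where `ϱ` is free. The subtractive Euclidean step `(x, y) ↦ (y,
x-y)` leaves `{0 < y < x}` after finitely many iterations unless `x = τ y`. On that invariant ray
(1) relates the values at `s` and `τ s`, so they are free exactly on the fundamental domain `1 ≤ s <
τ`. The ray is a null set and does not affect measurability (`existsUnique_isRhoExtension`). -/

theorem convexHull_inter_halfspace_subset {E : Type*} [AddCommGroup E] [Module ℝ E]
    {Sp Sm S0 : Set E} (ℓ : E →ₗ[ℝ] ℝ) (c : ℝ) (hp0 : S0 ⊆ Sp)
    (hm : ∀ x ∈ Sm, ℓ x ≤ c)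
    (H : ∀ x ∈ convexHull ℝ (Sp ∪ Sm), ℓ x = c → x ∈ convexHull ℝ S0)
    {x : E} (hx : x ∈ convexHull ℝ (Sp ∪ Sm)) (hxc : c ≤ ℓ x) : x ∈ convexHull ℝ Sp := by
  rcases Sp.eq_empty_or_nonempty with rfl | hSp
  · have h0 : S0 = ∅ := Set.subset_empty_iff.1 hp0
    have h1 : ℓ x ≤ c := by
      rw [Set.empty_union] at hx
      exact convexHull_min (t := {w | ℓ w ≤ c}) hm (convex_halfSpace_le ℓ.isLinear c) hx
    have := H x hx (le_antisymm h1 hxc)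
    rwa [h0] at this
  rcases Sm.eq_empty_or_nonempty with rfl | hSm
  · simpa using hx
  have hx' := hx
  rw [convexHull_union hSp hSm, mem_convexJoin] at hx'
  obtain ⟨u, hu, v, hv, hxuv⟩ := hx'
  have hv' : ℓ v ≤ c := convexHull_min (t := {w | ℓ w ≤ c}) hm (convex_halfSpace_le ℓ.isLinear c) hv
  have hvS : v ∈ convexHull ℝ (Sp ∪ Sm) := convexHull_mono Set.subset_union_right hv
  obtain ⟨m, hm1, hm2⟩ : ∃ m ∈ segment ℝ x v, ℓ m = c := by
    rcases eq_or_lt_of_le (hv'.trans hxc) with h | h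
    · exact ⟨v, right_mem_segment _ _ _, by linarith⟩
    · have hd : 0 < ℓ x - ℓ v := by linarith
      refine ⟨((c - ℓ v) / (ℓ x - ℓ v)) • x + ((ℓ x - c) / (ℓ x - ℓ v)) • v,
        ⟨_, _, div_nonneg (by linarith) hd.le, div_nonneg (by linarith) hd.le, ?_, rfl⟩, ?_⟩
      · field_simp
        ring
      · simp only [map_add, map_smul, smul_eq_mul]
        field_simp
        ring
  -- On its way from `x` to `v` the segment crosses the cutting line at `m`, which lies in the hull
  -- of `S0`, hence of `Sp`. As `x` is between `u` and `m`, it is there too.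
  have hmS : m ∈ convexHull ℝ (Sp ∪ Sm) := (convex_convexHull ℝ _).segment_subset hx hvS hm1
  have hm3 : m ∈ convexHull ℝ Sp := convexHull_mono hp0 (H m hmS hm2)
  have hxm : x ∈ segment ℝ u m := by
    rw [mem_segment_iff_wbtw] at *
    exact hxuv.trans_right_left hm1
  exact (convex_convexHull ℝ _).segment_subset hu hm3 hxm

theorem convexHull_union_eq_of_halfspaces {E : Type*} [AddCommGroup E] [Module ℝ E]
    {Sp Sm S0 : Set E} (ℓ : E →ₗ[ℝ] ℝ) (c : ℝ) (hp0 : S0 ⊆ Sp) (hm0 : S0 ⊆ Sm)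
    (hp : ∀ x ∈ Sp, c ≤ ℓ x) (hm : ∀ x ∈ Sm, ℓ x ≤ c)
    (H : ∀ x ∈ convexHull ℝ (Sp ∪ Sm), ℓ x = c → x ∈ convexHull ℝ S0) :
    convexHull ℝ (Sp ∪ Sm) = convexHull ℝ Sp ∪ convexHull ℝ Sm := by
  apply Set.Subset.antisymm
  · intro x hx
    rcases le_total c (ℓ x) with h | h
    · exact Or.inl (convexHull_inter_halfspace_subset ℓ c hp0 hm H hx h)
    · refine Or.inr (convexHull_inter_halfspace_subset (Sm := Sp) (-ℓ) (-c) hm0 ?_ ?_ ?_ ?_)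
      · intro y hy
        simpa using hp y hy
      · intro y hy hy'
        rw [Set.union_comm] at hy
        exact H y hy (by simpa using hy')
      · rwa [Set.union_comm]
      · simpa using h
  · exact Set.union_subset (convexHull_mono Set.subset_union_left)
      (convexHull_mono Set.subset_union_right)

theorem convexHull_inter_eq_of_halfspaces {E : Type*} [AddCommGroup E] [Module ℝ E]
    {Sp Sm S0 : Set E} (ℓ : E →ₗ[ℝ] ℝ) (c : ℝ) (hp0 : S0 ⊆ Sp) (hm0 : S0 ⊆ Sm)
    (hp : ∀ x ∈ Sp, c ≤ ℓ x) (hm : ∀ x ∈ Sm, ℓ x ≤ c)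
    (H : ∀ x ∈ convexHull ℝ (Sp ∪ Sm), ℓ x = c → x ∈ convexHull ℝ S0) :
    convexHull ℝ S0 = convexHull ℝ Sp ∩ convexHull ℝ Sm := by
  apply Set.Subset.antisymm
  · exact Set.subset_inter (convexHull_mono hp0) (convexHull_mono hm0)
  · rintro x ⟨h1, h2⟩
    refine H x (convexHull_mono Set.subset_union_left h1) (le_antisymm ?_ ?_)
    · exact convexHull_min (t := {w | ℓ w ≤ c}) hm (convex_halfSpace_le ℓ.isLinear c) h2
    · exact convexHull_min (t := {w | c ≤ ℓ w}) hp (convex_halfSpace_ge ℓ.isLinear c) h1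

/-- The linear functional `p ↦ det (u, p)`. -/
def crossWith (u : Plane) : Plane →ₗ[ℝ] ℝ where
  toFun p := u 0 * p 1 - u 1 * p 0
  map_add' p q := by simp; ring
  map_smul' r p := by simp; ring

theorem crossWith_apply (u p : Plane) : crossWith u p = u 0 * p 1 - u 1 * p 0 := rfl

theorem mem_span_of_crossWith_eq_zero {u p : Plane} (hu : u ≠ 0) (h : crossWith u p = 0) :
    p ∈ Submodule.span ℝ {u} := by
  rw [Submodule.mem_span_singleton]
  rw [crossWith_apply] at h
  by_cases h0 : u 0 = 0
  · have h1 : u 1 ≠ 0 := by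
      intro h1
      apply hu
      ext i
      fin_cases i <;> simp [h0, h1]
    have h2 : p 0 = 0 := by
      rw [h0] at h
      simpa [h1] using h
    refine ⟨p 1 / u 1, ?_⟩
    ext i
    fin_cases i <;> simp [h0, h1, h2]
  · refine ⟨p 0 / u 0, ?_⟩
    ext i
    fin_cases i
    · simp [h0]
    · simp
      field_simp
      linarith

theorem finrank_vectorSpan_le_one_of_crossWith {s : Set Plane} {u : Plane} {c : ℝ} (hu : u ≠ 0)
    (h : ∀ p ∈ s, crossWith u p = c) : Module.finrank ℝ (vectorSpan ℝ s) ≤ 1 := by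
  have : vectorSpan ℝ s ≤ Submodule.span ℝ {u} := by
    rw [vectorSpan_def, Submodule.span_le]
    rintro _ ⟨p, hp, q, hq, rfl⟩
    apply mem_span_of_crossWith_eq_zero hu
    simp [h p hp, h q hq]
  calc _ ≤ Module.finrank ℝ (Submodule.span ℝ {u}) := Submodule.finrank_mono this
    _ = 1 := finrank_span_singleton hu

/-! ### Lattice polytopes spanned by finite sets of lattice points -/

/-- The convex hull of a finite set of lattice points (a point if the set is empty). -/
noncomputable def hull (S : Finset (Fin 2 → ℤ)) : LatticePolytope :=
  if h : S.Nonempty then ⟨convexHull ℝ (toPlane '' (S : Set (Fin 2 → ℤ))), S, h, rfl⟩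
  else ⟨_, {0}, by simp, rfl⟩

theorem hull_coe {S : Finset (Fin 2 → ℤ)} (h : S.Nonempty) :
    (hull S).1 = convexHull ℝ (toPlane '' (S : Set (Fin 2 → ℤ))) := by
  simp [hull, h]

theorem exists_eq_hull (P : LatticePolytope) : ∃ S : Finset (Fin 2 → ℤ), S.Nonempty ∧ P = hull S := by
  obtain ⟨P, S, hS, rfl⟩ := P
  exact ⟨S, hS, Subtype.ext (hull_coe hS).symm⟩

theorem hull_image (Φ : Matrix.GeneralLinearGroup (Fin 2) ℤ) {S : Finset (Fin 2 → ℤ)}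
    (hS : S.Nonempty) : (hull S).image Φ =
      hull (S.image fun z => (Φ : Matrix (Fin 2) (Fin 2) ℤ).mulVec z) := by
  apply Subtype.ext
  rw [hull_coe (hS.image _), LatticePolytope.image]
  simp only
  rw [hull_coe hS, (glMap Φ).image_convexHull, Finset.coe_image, Set.image_image, Set.image_image]
  simp only [glMap_toPlane]

theorem toPlane_add (a b : Fin 2 → ℤ) : toPlane (a + b) = toPlane a + toPlane b := by
  ext i
  simp [toPlane]

theorem toPlane_sub (a b : Fin 2 → ℤ) : toPlane (a - b) = toPlane a - toPlane b := by
  ext i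
  simp [toPlane]

theorem toPlane_neg (a : Fin 2 → ℤ) : toPlane (-a) = -toPlane a := by
  ext i
  simp [toPlane]

theorem toPlane_injective : Function.Injective toPlane := by
  intro a b h
  ext i
  have := congrFun h i
  simpa [toPlane] using this

theorem hull_translate {S : Finset (Fin 2 → ℤ)} (hS : S.Nonempty) (z : Fin 2 → ℤ) :
    (hull S).translate z = hull (S.image fun w => w + z) := by
  apply Subtype.ext
  rw [hull_coe (hS.image _), LatticePolytope.translate]
  simp only
  have h := (AffineMap.id ℝ Plane + AffineMap.const ℝ Plane (toPlane z)).image_convexHull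
    (toPlane '' (S : Set (Fin 2 → ℤ)))
  have e : (⇑(AffineMap.id ℝ Plane + AffineMap.const ℝ Plane (toPlane z)) : Plane → Plane) =
      fun p => p + toPlane z := rfl
  rw [e] at h
  rw [hull_coe hS, h, Finset.coe_image, Set.image_image, Set.image_image]
  simp only [toPlane_add]

/-- The (possibly degenerate) lattice triangle with vertices `a`, `b`, `c`. -/
noncomputable def tri (a b c : Fin 2 → ℤ) : LatticePolytope := hull {a, b, c}

theorem tri_coe (a b c : Fin 2 → ℤ) :
    (tri a b c).1 = convexHull ℝ {toPlane a, toPlane b, toPlane c} := by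
  rw [tri, hull_coe (by simp)]
  simp [Set.image_insert_eq]

theorem tri_swap (a b c : Fin 2 → ℤ) : tri a b c = tri a c b := by
  rw [tri, tri, Finset.pair_comm]

theorem tri_rotate (a b c : Fin 2 → ℤ) : tri a b c = tri b c a := by
  rw [tri, tri]
  congr 1
  ext
  simp
  tauto

theorem tri_swap_left (a b c : Fin 2 → ℤ) : tri a b c = tri b a c := by
  rw [tri, tri, Finset.insert_comm]

theorem stdTriangle_eq : stdTriangle = tri ![1, 0] ![0, 1] ![0, 0] := by
  apply Subtype.ext
  have h1 : toPlane ![1, 0] = ![1, 0] := by ext i; fin_cases i <;> simp [toPlane]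
  have h2 : toPlane ![0, 1] = ![0, 1] := by ext i; fin_cases i <;> simp [toPlane]
  have h3 : toPlane ![0, 0] = ![0, 0] := by ext i; fin_cases i <;> simp [toPlane]
  rw [tri_coe, stdTriangle, h1, h2, h3]

/-- The determinant of two lattice vectors. -/
def cross (u v : Fin 2 → ℤ) : ℤ := u 0 * v 1 - u 1 * v 0

theorem crossWith_toPlane (u v : Fin 2 → ℤ) : crossWith (toPlane u) (toPlane v) = cross u v := by
  simp [crossWith_apply, toPlane, cross]

theorem toPlane_ne_zero {u : Fin 2 → ℤ} (h : u ≠ 0) : toPlane u ≠ 0 := by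
  intro h'
  apply h
  apply toPlane_injective
  rw [h']
  ext i
  simp [toPlane]

/-! ### Additivity of simple valuations -/

section Additivity

variable {Z : LatticePolytope → Plane → ℝ}

theorem simple_hull_eq_zero (hs : IsSimple Z) {S : Finset (Fin 2 → ℤ)} (hS : S.Nonempty)
    {u : Fin 2 → ℤ} {c : ℤ} (hu : u ≠ 0) (h : ∀ p ∈ S, cross u p = c) : Z (hull S) = 0 := by
  apply hs
  apply finrank_vectorSpan_le_one_of_crossWith (toPlane_ne_zero hu) (c := (c : ℝ))
  rw [hull_coe hS]
  intro p hp
  have h1 : p ∈ {w | crossWith (toPlane u) w = (c : ℝ)} := by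
    refine convexHull_min ?_ (convex_hyperplane (crossWith (toPlane u)).isLinear _) hp
    rintro _ ⟨z, hz, rfl⟩
    change crossWith (toPlane u) (toPlane z) = c
    rw [crossWith_toPlane]
    exact_mod_cast h z hz
  exact h1

theorem simple_tri_eq_zero (hs : IsSimple Z) {a b c : Fin 2 → ℤ} (h : cross (b - a) (c - a) = 0) :
    Z (tri a b c) = 0 := by
  by_cases hab : b - a = 0
  · by_cases hac : c - a = 0
    · have h1 : b = a := sub_eq_zero.1 hab
      have h2 : c = a := sub_eq_zero.1 hac
      subst h1 h2
      exact simple_hull_eq_zero hs (by simp) (u := ![1, 0]) (c := cross ![1, 0] c)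
        (by intro h; simpa using congrFun h 0) (by simp)
    · have h1 : b = a := sub_eq_zero.1 hab
      subst h1
      refine simple_hull_eq_zero hs (by simp) hac (c := cross (c - b) b) ?_
      simp [cross]
      ring
  · refine simple_hull_eq_zero hs (by simp) hab (c := cross (b - a) a) ?_
    simp [cross] at h ⊢
    constructor
    · ring
    · linarith

/-- The hypothesis `H` says that the cutting line meets the hull only in the hull of the lattice
points `S0`. So the common part of the two halves is a lattice polytope contained in a line, where
`Z` vanishes. -/
theorem valuation_hull_split (hv : IsValuation Z) (hs : IsSimple Z) {Sp Sm S0 : Finset (Fin 2 → ℤ)}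
    {u : Fin 2 → ℤ} {c : ℤ} (hu : u ≠ 0) (h0 : S0.Nonempty) (hp0 : S0 ⊆ Sp) (hm0 : S0 ⊆ Sm)
    (hp : ∀ x ∈ Sp, c ≤ cross u x) (hm : ∀ x ∈ Sm, cross u x ≤ c)
    (H : ∀ x ∈ convexHull ℝ (toPlane '' ((Sp ∪ Sm : Finset _) : Set (Fin 2 → ℤ))),
      crossWith (toPlane u) x = c → x ∈ convexHull ℝ (toPlane '' (S0 : Set (Fin 2 → ℤ)))) :
    Z (hull (Sp ∪ Sm)) = Z (hull Sp) + Z (hull Sm) := by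
  have hSp : Sp.Nonempty := h0.mono hp0
  have hSm : Sm.Nonempty := h0.mono hm0
  have a1 : toPlane '' (S0 : Set (Fin 2 → ℤ)) ⊆ toPlane '' (Sp : Set (Fin 2 → ℤ)) :=
    Set.image_mono (by exact_mod_cast hp0)
  have a2 : toPlane '' (S0 : Set (Fin 2 → ℤ)) ⊆ toPlane '' (Sm : Set (Fin 2 → ℤ)) :=
    Set.image_mono (by exact_mod_cast hm0)
  have a3 : ∀ x ∈ toPlane '' (Sp : Set (Fin 2 → ℤ)), (c : ℝ) ≤ crossWith (toPlane u) x := by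
    rintro _ ⟨z, hz, rfl⟩
    rw [crossWith_toPlane]
    exact_mod_cast hp z hz
  have a4 : ∀ x ∈ toPlane '' (Sm : Set (Fin 2 → ℤ)), crossWith (toPlane u) x ≤ (c : ℝ) := by
    rintro _ ⟨z, hz, rfl⟩
    rw [crossWith_toPlane]
    exact_mod_cast hm z hz
  rw [Finset.coe_union, Set.image_union] at H
  have e1 := convexHull_union_eq_of_halfspaces _ _ a1 a2 a3 a4 H
  have e2 := convexHull_inter_eq_of_halfspaces _ _ a1 a2 a3 a4 H
  have hZ0 : Z (hull S0) = 0 := by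
    refine simple_hull_eq_zero hs h0 hu (c := c) fun p hp' => ?_
    exact le_antisymm (hm p (hm0 hp')) (hp p (hp0 hp'))
  have := hv (hull Sp) (hull Sm) (hull (Sp ∪ Sm)) (hull S0)
    (by rw [hull_coe hSp, hull_coe hSm, ← e1]; exact convex_convexHull ℝ _)
    (by rw [hull_coe hSp, hull_coe hSm, ← e1, hull_coe (hSp.mono Finset.subset_union_left),
          Finset.coe_union, Set.image_union])
    (by rw [hull_coe hSp, hull_coe hSm, ← e2, hull_coe h0])
  rw [hZ0, add_zero] at this
  exact this

/-- Because the diagonals `ad` and `bc` cross at `m`, the line through `b` and `c` meets the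
quadrilateral in no more than the segment `bc`. -/
theorem valuation_quad (hv : IsValuation Z) (hs : IsSimple Z) {a b c d : Fin 2 → ℤ}
    (hm : ∃ m : Plane, m ∈ segment ℝ (toPlane a) (toPlane d) ∧
      m ∈ segment ℝ (toPlane b) (toPlane c))
    (ha : 0 < cross (c - b) (a - b)) (hd : cross (c - b) (d - b) < 0) :
    Z (hull {a, d, b, c}) = Z (tri a b c) + Z (tri d b c) := by
  have e : ({a, d, b, c} : Finset (Fin 2 → ℤ)) = {a, b, c} ∪ {d, b, c} := by
    ext
    simp
    tauto
  have hu : c - b ≠ 0 := by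
    intro h
    rw [h] at ha
    simp [cross] at ha
  have key : ∀ p q : Fin 2 → ℤ, cross (c - b) (p - q) = cross (c - b) p - cross (c - b) q := by
    intro p q
    simp [cross]
    ring
  have hcb : cross (c - b) c = cross (c - b) b := by
    simp [cross]
    ring
  rw [key] at ha hd
  rw [e]
  apply valuation_hull_split hv hs (S0 := {b, c}) hu (c := cross (c - b) b) (by simp)
    (by intro; simp; tauto) (by intro; simp; tauto)
  · intro x hx
    simp only [Finset.mem_insert, Finset.mem_singleton] at hx
    rcases hx with rfl | rfl | rfl <;> linarith
  · intro x hx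
    simp only [Finset.mem_insert, Finset.mem_singleton] at hx
    rcases hx with rfl | rfl | rfl <;> linarith
  · rw [← e]
    intro x hx hxc
    simp only [Finset.coe_insert, Finset.coe_singleton, Set.image_insert_eq,
      Set.image_singleton] at hx ⊢
    rw [← convexJoin_segments, mem_convexJoin] at hx
    rw [convexHull_pair]
    obtain ⟨m, hm1, hm2⟩ := hm
    obtain ⟨p, hp, w, hw, hx⟩ := hx
    set ℓ := crossWith (toPlane (c - b)) with hℓ
    have hlc : ℓ (toPlane c) = ℓ (toPlane b) := by
      rw [hℓ, crossWith_toPlane, crossWith_toPlane, hcb]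
    have hseg : ∀ y ∈ segment ℝ (toPlane b) (toPlane c), ℓ y = ℓ (toPlane b) := by
      rintro y ⟨r, s, -, -, hrs, rfl⟩
      simp only [map_add, map_smul, smul_eq_mul, hlc]
      rw [← add_mul, hrs, one_mul]
    have hla : 0 < ℓ (toPlane a) - ℓ (toPlane b) := by
      rw [hℓ, crossWith_toPlane, crossWith_toPlane]
      exact_mod_cast ha
    have hld : ℓ (toPlane d) - ℓ (toPlane b) < 0 := by
      rw [hℓ, crossWith_toPlane, crossWith_toPlane]
      exact_mod_cast hd
    have hxc' : ℓ x = ℓ (toPlane b) := by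
      rw [hxc, hℓ, crossWith_toPlane]
    have hlw := hseg w hw
    obtain ⟨r, s, hr, hs', hrs, rfl⟩ := hx
    simp only [map_add, map_smul, smul_eq_mul] at hxc'
    rw [hlw] at hxc'
    have h1 : r * (ℓ p - ℓ (toPlane b)) = 0 := by
      have : s = 1 - r := by linarith
      subst this
      linarith
    rcases mul_eq_zero.1 h1 with h1 | h1
    · have h2 : s = 1 := by linarith
      subst h1 h2
      simpa using hw
    -- Here `p` lies both on `ad` and on the line `bc`; these meet only once since `a` and `d` are
    -- strictly on opposite sides.
    · have hpm : p = m := by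
        have hlm := hseg m hm2
        obtain ⟨r1, s1, hr1, hs1, hrs1, rfl⟩ := hp
        obtain ⟨r2, s2, hr2, hs2, hrs2, rfl⟩ := hm1
        simp only [map_add, map_smul, smul_eq_mul] at h1 hlm
        have t1 : s1 = 1 - r1 := by linarith
        have t2 : s2 = 1 - r2 := by linarith
        subst t1 t2
        have : (r1 - r2) * (ℓ (toPlane a) - ℓ (toPlane d)) = 0 := by linarith
        rcases mul_eq_zero.1 this with h | h
        · rw [sub_eq_zero.1 h]
        · linarith
      rw [hpm]
      exact (convex_segment (𝕜 := ℝ) _ _).segment_subset hm2 hw ⟨r, s, hr, hs', hrs, rfl⟩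

theorem valuation_quad_of_mul_neg (hv : IsValuation Z) (hs : IsSimple Z) {a b c d : Fin 2 → ℤ}
    (hm : ∃ m : Plane, m ∈ segment ℝ (toPlane a) (toPlane d) ∧
      m ∈ segment ℝ (toPlane b) (toPlane c))
    (h : cross (c - b) (a - b) * cross (c - b) (d - b) < 0) :
    Z (hull {a, d, b, c}) = Z (tri a b c) + Z (tri d b c) := by
  rcases mul_neg_iff.1 h with ⟨h1, h2⟩ | ⟨h1, h2⟩
  · exact valuation_quad hv hs hm h1 h2
  · rw [Finset.insert_comm a d, valuation_quad hv hs _ h2 h1,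
      add_comm]
    obtain ⟨m, h3, h4⟩ := hm
    exact ⟨m, by rwa [segment_symm], h4⟩

/-- Splitting a triangle by a lattice point on a side. -/
theorem valuation_tri_side (hv : IsValuation Z) (hs : IsSimple Z) {a b c p : Fin 2 → ℤ}
    (hp : toPlane p ∈ segment ℝ (toPlane b) (toPlane c))
    (h : cross (p - a) (b - a) * cross (p - a) (c - a) < 0) :
    Z (tri a b c) = Z (tri b a p) + Z (tri c a p) := by
  -- The triangle is the degenerate quadrilateral with diagonals `bc` and `ap`, whose corner `p`
  -- lies on `bc`.
  rw [← valuation_quad_of_mul_neg hv hs ⟨toPlane p, hp, right_mem_segment _ _ _⟩ h]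
  congr 1
  apply Subtype.ext
  rw [tri_coe, hull_coe (by simp)]
  simp only [Finset.coe_insert, Finset.coe_singleton, Set.image_insert_eq,
      Set.image_singleton]
  apply Set.Subset.antisymm
  · apply convexHull_mono
    intro x
    simp
    tauto
  · apply convexHull_min _ (convex_convexHull ℝ _)
    have hsub : ({toPlane a, toPlane b, toPlane c} : Set Plane) ⊆
        convexHull ℝ {toPlane a, toPlane b, toPlane c} := subset_convexHull ℝ _
    have hbb : toPlane b ∈ convexHull ℝ {toPlane a, toPlane b, toPlane c} := hsub (by simp)
    have hcc : toPlane c ∈ convexHull ℝ {toPlane a, toPlane b, toPlane c} := hsub (by simp)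
    rintro x (rfl | rfl | rfl | rfl)
    · exact hbb
    · exact hcc
    · exact hsub (by simp)
    · exact (convex_convexHull ℝ _).segment_subset hbb hcc hp

end Additivity

end ExpVal

namespace ExpVal

open MeasureTheory

/-! ### Simple valuations are determined by the standard triangle -/

/-- The lattice spanned by `u, v` has index at least two, so some lattice point is not in it. It is
reduced modulo `u, v` into the half-open parallelogram and, if beyond the diagonal from `u` to `v`,
reflected to `u + v - z'`. The inequalities say that the result lies in the closed triangle `0, u,
v` and is not a vertex, in coordinates `D w = cross w v • u + cross u w • v`. -/
theorem exists_point_of_two_le_cross {u v : Fin 2 → ℤ} (h : 2 ≤ cross u v) :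
    ∃ w : Fin 2 → ℤ, 0 ≤ cross w v ∧ 0 ≤ cross u w ∧ cross w v < cross u v ∧
      cross u w < cross u v ∧ cross w v + cross u w ≤ cross u v ∧
      0 < cross w v + cross u w := by
  set D := cross u v with hD
  have hD0 : 0 < D := by linarith
  obtain ⟨z, hz⟩ : ∃ z : Fin 2 → ℤ, ¬ (D ∣ cross z v ∧ D ∣ cross u z) := by
    by_contra! hall
    obtain ⟨h1, h2⟩ := hall ![1, 0]
    obtain ⟨h3, h4⟩ := hall ![0, 1]
    simp only [cross, Matrix.cons_val_zero, Matrix.cons_val_one, mul_one, mul_zero, one_mul,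
      zero_mul, sub_zero, zero_sub, dvd_neg] at h1 h2 h3 h4
    have h5 : D * D ∣ D := by
      conv_rhs => rw [hD]
      exact dvd_sub (mul_dvd_mul h4 h1) (mul_dvd_mul h2 h3)
    have := Int.le_of_dvd hD0 h5
    nlinarith
  set z' : Fin 2 → ℤ := z - (cross z v / D) • u - (cross u z / D) • v with hz'
  have e1 : cross z' v = cross z v % D := by
    rw [Int.emod_def, hz', hD]
    simp [cross]
    ring
  have e2 : cross u z' = cross u z % D := by
    rw [Int.emod_def, hz', hD]
    simp [cross]
    ring
  have b1 := Int.emod_nonneg (cross z v) hD0.ne'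
  have b2 := Int.emod_nonneg (cross u z) hD0.ne'
  have b3 := Int.emod_lt_of_pos (cross z v) hD0
  have b4 := Int.emod_lt_of_pos (cross u z) hD0
  have b5 : 0 < cross z v % D + cross u z % D := by
    by_contra hle
    apply hz
    constructor
    · exact Int.dvd_of_emod_eq_zero (by linarith)
    · exact Int.dvd_of_emod_eq_zero (by linarith)
  rw [← e1] at b1 b3 b5
  rw [← e2] at b2 b4 b5
  rcases le_or_gt (cross z' v + cross u z') D with hle | hgt
  · exact ⟨z', b1, b2, b3, b4, hle, b5⟩
  · refine ⟨u + v - z', ?_⟩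
    have f1 : cross (u + v - z') v = D - cross z' v := by
      rw [hD]; simp [cross]; ring
    have f2 : cross u (u + v - z') = D - cross u z' := by
      rw [hD]; simp [cross]; ring
    rw [f1, f2]
    refine ⟨?_, ?_, ?_, ?_, ?_, ?_⟩ <;> linarith

theorem toPlane_mem_segment {b c p : Fin 2 → ℤ} {B C D : ℤ} (hB : 0 ≤ B) (hC : 0 ≤ C) (hD : 0 < D)
    (h : B + C = D) (hp : D • p = B • b + C • c) :
    toPlane p ∈ segment ℝ (toPlane b) (toPlane c) := by
  have hD' : (0 : ℝ) < D := by exact_mod_cast hD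
  have hB' : (0 : ℝ) ≤ B := by exact_mod_cast hB
  have hC' : (0 : ℝ) ≤ C := by exact_mod_cast hC
  have h' : (B : ℝ) + C = D := by exact_mod_cast h
  refine ⟨(B : ℝ) / D, (C : ℝ) / D, by positivity, by positivity, ?_, ?_⟩
  · field_simp
    exact h'
  · ext i
    have := congrFun hp i
    simp only [Pi.smul_apply, Pi.add_apply, smul_eq_mul] at this
    have h2 : (D : ℝ) * p i = B * b i + C * c i := by exact_mod_cast this
    simp only [toPlane, Pi.smul_apply, Pi.add_apply, smul_eq_mul]
    field_simp
    linarith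

section Generation

variable {Z : LatticePolytope → Plane → ℝ}

/-- Splitting a triangle by an interior lattice point. -/
theorem valuation_tri_interior (hv : IsValuation Z) (hs : IsSimple Z) {a u v w : Fin 2 → ℤ}
    (hB : 0 < cross w v) (hC : 0 < cross u w) (hA : cross w v + cross u w < cross u v) :
    Z (tri a (a + u) (a + v)) = Z (tri (a + u) a (a + w)) + Z (tri (a + v) a (a + w)) +
      Z (tri (a + w) (a + u) (a + v)) := by
  set D := cross u v with hD
  set B := cross w v with hBd
  set C := cross u w with hCd
  have hw : D • w = B • u + C • v := by
    rw [hD, hBd, hCd]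
    ext i
    fin_cases i <;> simp [cross] <;> ring
  have hD0 : 0 < D := by linarith
  have hBC : 0 < B + C := by linarith
  have hwR : ∀ i, (D : ℝ) * w i = B * u i + C * v i := by
    intro i
    have := congrFun hw i
    simp only [Pi.smul_apply, Pi.add_apply, smul_eq_mul] at this
    exact_mod_cast this
  have hD' : (0 : ℝ) < D := by exact_mod_cast hD0
  have hB' : (0 : ℝ) < B := by exact_mod_cast hB
  have hC' : (0 : ℝ) < C := by exact_mod_cast hC
  have hA' : (B : ℝ) + C < D := by exact_mod_cast hA
  have hBC' : (1 : ℝ) ≤ B + C := by exact_mod_cast hBC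
  have hBC0 : (0 : ℝ) < B + C := by linarith
  -- A subdivision into three triangles is not a single cut, so the auxiliary point `d` is taken on
  -- the ray from `a` through `a + w`, beyond the opposite side; the factor `D + 1` suffices because
  -- `B + C ≥ 1`. The quadrilaterals on `a, d` and on `a + w, d` are each cut along both diagonals,
  -- and the pieces at `d` cancel.
  set d := a + (D + 1) • w with hd
  have mseg : (toPlane a + ((D : ℝ) / (B + C)) • toPlane w) ∈
      segment ℝ (toPlane (a + u)) (toPlane (a + v)) := by
    refine ⟨B / (B + C), C / (B + C), by positivity, by positivity, by field_simp, ?_⟩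
    ext i
    have := hwR i
    simp only [toPlane, Pi.smul_apply, Pi.add_apply, smul_eq_mul, Int.cast_add]
    field_simp
    linear_combination (-1 : ℝ) * this
  have mad : (toPlane a + ((D : ℝ) / (B + C)) • toPlane w) ∈
      segment ℝ (toPlane a) (toPlane d) := by
    refine ⟨1 - D / ((B + C) * (D + 1)), D / ((B + C) * (D + 1)), ?_, by positivity, by ring, ?_⟩
    · rw [sub_nonneg, div_le_one (by positivity)]
      nlinarith
    · ext i
      simp only [hd, toPlane, Pi.smul_apply, Pi.add_apply, smul_eq_mul, Int.cast_add, Int.cast_mul,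
        Int.cast_one]
      field_simp
      ring
  have mpd : (toPlane a + ((D : ℝ) / (B + C)) • toPlane w) ∈
      segment ℝ (toPlane (a + w)) (toPlane d) := by
    refine ⟨1 - (D / (B + C) - 1) / D, (D / (B + C) - 1) / D, ?_, ?_, by ring, ?_⟩
    · rw [sub_nonneg, div_le_one hD', sub_le_iff_le_add, div_le_iff₀ hBC0]
      nlinarith
    · apply div_nonneg _ hD'.le
      rw [sub_nonneg, le_div_iff₀ hBC0]
      linarith
    · ext i
      simp only [hd, toPlane, Pi.smul_apply, Pi.add_apply, smul_eq_mul, Int.cast_add, Int.cast_mul,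
        Int.cast_one]
      field_simp
      ring
  have pad : toPlane (a + w) ∈ segment ℝ (toPlane a) (toPlane d) := by
    apply toPlane_mem_segment (B := D) (C := 1) (D := D + 1) (by linarith) (by norm_num)
      (by linarith) rfl
    rw [hd]
    ext i
    simp
    ring
  have c1 : cross (a + v - (a + u)) (a - (a + u)) = D := by
    rw [hD]; simp [cross]; ring
  have c2 : cross (a + v - (a + u)) (d - (a + u)) = D - (D + 1) * (B + C) := by
    have : cross (a + v - (a + u)) (d - (a + u)) = cross u v - (D + 1) * (cross w v + cross u w) := by
      rw [hd]; simp [cross]; ring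
    rw [this]
  have c3 : cross (a + v - (a + u)) (a + w - (a + u)) = D - (B + C) := by
    rw [hD, hBd, hCd]; simp [cross]; ring
  have c4 : cross (d - a) (a + u - a) = - ((D + 1) * C) := by
    have : cross (d - a) (a + u - a) = - ((D + 1) * cross u w) := by
      rw [hd]; simp [cross]; ring
    rw [this]
  have c5 : cross (d - a) (a + v - a) = (D + 1) * B := by
    have : cross (d - a) (a + v - a) = (D + 1) * cross w v := by
      rw [hd]; simp [cross]; ring
    rw [this]
  have c6 : cross (d - (a + w)) (a + u - (a + w)) = - (D * C) := by
    have : cross (d - (a + w)) (a + u - (a + w)) = - (D * cross u w) := by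
      rw [hd]; simp [cross]; ring
    rw [this]
  have c7 : cross (d - (a + w)) (a + v - (a + w)) = D * B := by
    have : cross (d - (a + w)) (a + v - (a + w)) = D * cross w v := by
      rw [hd]; simp [cross]; ring
    rw [this]
  have c8 : cross (a + w - (a + u)) (a - (a + u)) = C := by
    rw [hCd]; simp [cross]; ring
  have c9 : cross (a + w - (a + u)) (d - (a + u)) = - (D * C) := by
    have : cross (a + w - (a + u)) (d - (a + u)) = - (D * cross u w) := by
      rw [hd]; simp [cross]; ring
    rw [this]
  have c10 : cross (a + w - (a + v)) (a - (a + v)) = - B := by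
    rw [hBd]; simp [cross]; ring
  have c11 : cross (a + w - (a + v)) (d - (a + v)) = D * B := by
    have : cross (a + w - (a + v)) (d - (a + v)) = D * cross w v := by
      rw [hd]; simp [cross]; ring
    rw [this]
  have pDB : 0 < D * B := mul_pos hD0 hB
  have pDC : 0 < D * C := mul_pos hD0 hC
  have q1 := valuation_quad_of_mul_neg hv hs ⟨_, mad, mseg⟩ (by
    rw [c1, c2]
    exact mul_neg_of_pos_of_neg hD0 (by nlinarith))
  have q2 := valuation_quad_of_mul_neg hv hs ⟨_, mseg, mad⟩ (by
    rw [c4, c5]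
    exact mul_neg_of_neg_of_pos (by nlinarith) (by nlinarith))
  have q3 := valuation_quad_of_mul_neg hv hs ⟨_, mpd, mseg⟩ (by
    rw [c3, c2]
    exact mul_neg_of_pos_of_neg (by linarith) (by nlinarith))
  have q4 := valuation_quad_of_mul_neg hv hs ⟨_, mseg, mpd⟩ (by
    rw [c6, c7]
    exact mul_neg_of_neg_of_pos (by linarith) pDB)
  have s1 := valuation_tri_side hv hs (a := a + u) pad (by
    rw [c8, c9]
    exact mul_neg_of_pos_of_neg hC (by linarith))
  have s2 := valuation_tri_side hv hs (a := a + v) pad (by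
    rw [c10, c11]
    exact mul_neg_of_neg_of_pos (by linarith) pDB)
  have e1 : ({a + u, a + v, a, d} : Finset (Fin 2 → ℤ)) = {a, d, a + u, a + v} := by
    ext; simp; tauto
  have e2 : ({a + u, a + v, a + w, d} : Finset (Fin 2 → ℤ)) = {a + w, d, a + u, a + v} := by
    ext; simp; tauto
  rw [e1, q1, s1, s2] at q2
  rw [e2, q3] at q4
  rw [tri_rotate d (a + u) (a + w), tri_rotate d (a + v) (a + w)] at q2
  rw [tri_swap_left (a + u) a, tri_swap_left (a + v) a]
  linear_combination q2 - q4

/-- The triangle `tri a (a + u) (a + v)` with `det (u, v) = ± 1` is an affine image of the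
standard triangle. -/
theorem tri_unimodular {a u v : Fin 2 → ℤ} (h : IsUnit (cross u v)) :
    ∃ Φ : Matrix.GeneralLinearGroup (Fin 2) ℤ,
      tri a (a + u) (a + v) = (stdTriangle.image Φ).translate a := by
  have hdet : (!![u 0, v 0; u 1, v 1] : Matrix (Fin 2) (Fin 2) ℤ).det = cross u v := by
    rw [Matrix.det_fin_two_of, cross]
    ring
  refine ⟨Matrix.GeneralLinearGroup.mk'' !![u 0, v 0; u 1, v 1] (by rwa [hdet]), ?_⟩
  rw [stdTriangle_eq, tri_rotate a, tri, tri, hull_image _ (by simp), hull_translate (by simp)]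
  congr 1
  have h1 : (!![u 0, v 0; u 1, v 1] : Matrix (Fin 2) (Fin 2) ℤ).mulVec ![1, 0] = u := by
    ext i; fin_cases i <;> simp
  have h2 : (!![u 0, v 0; u 1, v 1] : Matrix (Fin 2) (Fin 2) ℤ).mulVec ![0, 1] = v := by
    ext i; fin_cases i <;> simp
  have h3 : (!![u 0, v 0; u 1, v 1] : Matrix (Fin 2) (Fin 2) ℤ).mulVec ![0, 0] = 0 := by
    ext i; fin_cases i <;> simp
  have h4 : ((Matrix.GeneralLinearGroup.mk'' !![u 0, v 0; u 1, v 1] (by rwa [hdet]) :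
    Matrix.GeneralLinearGroup (Fin 2) ℤ) : Matrix (Fin 2) (Fin 2) ℤ) =
      !![u 0, v 0; u 1, v 1] := rfl
  simp only [h4, Finset.image_insert, Finset.image_singleton, h1, h2, h3, add_comm, add_zero]

variable (M : AddSubgroup (Plane → ℝ))

/-- Values on triangles lie in any group of functions that contains the values on unimodular
triangles. -/
theorem valuation_tri_mem (hv : IsValuation Z) (hs : IsSimple Z)
    (hM : ∀ Φ z, Z ((stdTriangle.image Φ).translate z) ∈ M) (n : ℕ) :
    ∀ a u v : Fin 2 → ℤ, (cross u v).natAbs = n → Z (tri a (a + u) (a + v)) ∈ M := by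
  induction n using Nat.strong_induction_on with
  | _ n ih =>
    intro a u v hn
    wlog hpos : 0 ≤ cross u v generalizing u v with H
    · rw [tri_swap]
      have h1 : cross v u = - cross u v := by simp [cross]; ring
      exact H v u (by rw [h1, Int.natAbs_neg, hn]) (by rw [h1]; linarith)
    have ih' : ∀ a b c : Fin 2 → ℤ, |cross (b - a) (c - a)| < cross u v → Z (tri a b c) ∈ M := by
      intro a b c hlt
      have := ih _ (by rw [← hn]; zify; rwa [abs_of_nonneg hpos]) a (b - a) (c - a) rfl
      simpa using this
    rcases lt_or_ge (cross u v) 2 with hlt | hge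
    · rcases (by omega : cross u v = 0 ∨ cross u v = 1) with h0 | h1
      · rw [simple_tri_eq_zero hs (by simpa using h0)]
        exact M.zero_mem
      · obtain ⟨Φ, hΦ⟩ := tri_unimodular (a := a) (by rw [h1]; exact isUnit_one)
        rw [hΦ]
        exact hM Φ a
    · obtain ⟨w, hB, hC, hBD, hCD, hsum, hlt⟩ := exists_point_of_two_le_cross hge
      -- The three triangles spanned by `a + w` and the sides have determinants `cross w v`, `cross
      -- u w` and `D` minus their sum, all smaller than `D`. If one of them is zero, `a + w` is on a
      -- side and two triangles suffice.
      set D := cross u v with hD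
      have hD0 : 0 < D := by linarith
      have hw : D • w = cross w v • u + cross u w • v := by
        rw [hD]
        ext i
        fin_cases i <;> simp [cross] <;> ring
      have n1 : |cross (a - (a + u)) (a + w - (a + u))| < D := by
        have : cross (a - (a + u)) (a + w - (a + u)) = - cross u w := by simp [cross]; ring
        rw [this, abs_neg, abs_of_nonneg hC]
        exact hCD
      have n2 : |cross (a - (a + v)) (a + w - (a + v))| < D := by
        have : cross (a - (a + v)) (a + w - (a + v)) = cross w v := by simp [cross]; ring
        rw [this, abs_of_nonneg hB]
        exact hBD
      have n3 : |cross (a + u - (a + w)) (a + v - (a + w))| < D := by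
        have : cross (a + u - (a + w)) (a + v - (a + w)) = D - (cross w v + cross u w) := by
          rw [hD]; simp [cross]; ring
        rw [this, abs_of_nonneg (by linarith)]
        linarith
      have m1 := ih' _ _ _ n1
      have m2 := ih' _ _ _ n2
      have m3 := ih' _ _ _ n3
      rcases hB.eq_or_lt with hB0 | hB0
      · have seg : toPlane (a + w) ∈ segment ℝ (toPlane a) (toPlane (a + v)) := by
          apply toPlane_mem_segment (B := D - cross u w) (C := cross u w) (D := D) (by linarith)
            hC hD0 (by ring)
          rw [smul_add, hw, ← hB0]
          ext i
          simp
          ring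
        have := valuation_tri_side hv hs (a := a + u) seg (by
          have h1 : cross (a + w - (a + u)) (a - (a + u)) = cross u w := by simp [cross]; ring
          have h2 : cross (a + w - (a + u)) (a + v - (a + u)) = cross w v + cross u w - D := by
            rw [hD]; simp [cross]; ring
          rw [h1, h2, ← hB0]
          exact mul_neg_of_pos_of_neg (by linarith) (by linarith))
        rw [tri_swap_left a, this, tri_swap_left a]
        refine M.add_mem m1 (ih' _ _ _ ?_)
        have h1 : cross (a + u - (a + v)) (a + w - (a + v)) = -(D - (cross w v + cross u w)) := by
          rw [hD]; simp [cross]; ring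
        rw [h1, abs_neg, abs_of_nonneg (by linarith)]
        linarith
      rcases hC.eq_or_lt with hC0 | hC0
      · have seg : toPlane (a + w) ∈ segment ℝ (toPlane a) (toPlane (a + u)) := by
          apply toPlane_mem_segment (B := D - cross w v) (C := cross w v) (D := D) (by linarith)
            hB hD0 (by ring)
          rw [smul_add, hw, ← hC0]
          ext i
          simp
          ring
        have := valuation_tri_side hv hs (a := a + v) seg (by
          have h1 : cross (a + w - (a + v)) (a - (a + v)) = - cross w v := by simp [cross]; ring
          have h2 : cross (a + w - (a + v)) (a + u - (a + v)) =
              D - (cross w v + cross u w) := by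
            rw [hD]; simp [cross]; ring
          rw [h1, h2, ← hC0]
          exact mul_neg_of_neg_of_pos (by linarith) (by linarith))
        rw [tri_swap, tri_swap_left a, this, tri_swap_left a, tri_swap_left (a + u)]
        refine M.add_mem m2 (ih' _ _ _ ?_)
        have h1 : cross (a + u - (a + v)) (a + w - (a + v)) = -(D - (cross w v + cross u w)) := by
          rw [hD]; simp [cross]; ring
        rw [h1, abs_neg, abs_of_nonneg (by linarith)]
        linarith
      rcases hsum.eq_or_lt with hsum | hsum
      · have seg : toPlane (a + w) ∈ segment ℝ (toPlane (a + u)) (toPlane (a + v)) := by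
          apply toPlane_mem_segment hB hC hD0 hsum
          rw [smul_add, hw, ← hsum]
          ext i
          simp
          ring
        have := valuation_tri_side hv hs (a := a) seg (by
          have h1 : cross (a + w - a) (a + u - a) = - cross u w := by simp [cross]; ring
          have h2 : cross (a + w - a) (a + v - a) = cross w v := by simp [cross]
          rw [h1, h2]
          exact mul_neg_of_neg_of_pos (by linarith) hB0)
        rw [this]
        exact M.add_mem m1 m2
      · rw [valuation_tri_interior hv hs hB0 hC0 hsum]
        exact M.add_mem (M.add_mem m1 m2) m3

/-- Write `m = k b + l m'` with `m'` in the hull of `s` and substitute into `b = r a + t m`. As `t k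
< 1`, the equation can be solved for `b`, which would put `b` in the hull of `s`. -/
theorem not_mem_openSegment_of_notMem_convexHull {E : Type*} [AddCommGroup E] [Module ℝ E]
    {s : Set E} {a b m : E} (hb : b ∉ convexHull ℝ s) (ha : a ∈ s)
    (hm : m ∈ convexHull ℝ (insert b s)) : b ∉ openSegment ℝ a m := by
  rintro ⟨r, t, hr, ht, hrt, hbe⟩
  rw [convexHull_insert ⟨a, ha⟩, mem_convexJoin] at hm
  obtain ⟨b', rfl, m', hm', k, l, hk, hl, hkl, rfl⟩ := hm
  apply hb
  have h1 : 0 < 1 - t * k := by nlinarith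
  have h2 : b' = (r / (1 - t * k)) • a + (t * l / (1 - t * k)) • m' := by
    have h3 : (1 - t * k) • b' = r • a + (t * l) • m' := by
      rw [sub_smul, one_smul, sub_eq_iff_eq_add]
      conv_lhs => rw [← hbe]
      rw [smul_add, smul_smul, smul_smul]
      abel
    have h4 : b' = (1 - t * k)⁻¹ • ((1 - t * k) • b') := by
      rw [smul_smul, inv_mul_cancel₀ h1.ne', one_smul]
    rw [h4, h3, smul_add, smul_smul, smul_smul]
    congr 2 <;> field_simp
  rw [h2]
  refine (convex_convexHull ℝ s) (subset_convexHull ℝ s ha) hm' (by positivity) (by positivity) ?_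
  field_simp
  have : l = 1 - k := by linarith
  subst this
  linarith

/-- Three lattice points none of which is in the segment spanned by the others are not
collinear. -/
theorem cross_ne_zero_of_notMem_segment {a b c : Fin 2 → ℤ}
    (ha : toPlane a ∉ segment ℝ (toPlane b) (toPlane c))
    (hb : toPlane b ∉ segment ℝ (toPlane c) (toPlane a))
    (hc : toPlane c ∉ segment ℝ (toPlane a) (toPlane b)) : cross (b - a) (c - a) ≠ 0 := by
  intro h
  have hab : toPlane b - toPlane a ≠ 0 := by
    intro h'
    apply hb
    rw [sub_eq_zero.1 h']
    exact right_mem_segment _ _ _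
  have hcol : Collinear ℝ {toPlane a, toPlane b, toPlane c} := by
    rw [collinear_iff_of_mem (p₀ := toPlane a) (by simp)]
    refine ⟨toPlane b - toPlane a, ?_⟩
    have h1 := mem_span_of_crossWith_eq_zero (p := toPlane (c - a)) hab (by
      rw [← toPlane_sub, crossWith_toPlane, h, Int.cast_zero])
    rw [Submodule.mem_span_singleton, toPlane_sub] at h1
    obtain ⟨r, hr⟩ := h1
    rintro p (rfl | rfl | rfl)
    · exact ⟨0, by simp⟩
    · exact ⟨1, by simp⟩
    · exact ⟨r, by rw [hr]; simp⟩
  rcases hcol.wbtw_or_wbtw_or_wbtw with h | h | h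
  · rw [← mem_segment_iff_wbtw, segment_symm] at h
    exact hb h
  · rw [← mem_segment_iff_wbtw, segment_symm] at h
    exact hc h
  · rw [← mem_segment_iff_wbtw, segment_symm] at h
    exact ha h

/-- Values of simple valuations lie in any group of functions that contains the values on
unimodular triangles. -/
theorem valuation_mem (hv : IsValuation Z) (hs : IsSimple Z)
    (hM : ∀ Φ z, Z ((stdTriangle.image Φ).translate z) ∈ M) (P : LatticePolytope) : Z P ∈ M := by
  obtain ⟨S, hS, rfl⟩ := exists_eq_hull P
  induction hn : S.card using Nat.strong_induction_on generalizing S with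
  | _ n ih =>
    have htri : ∀ a b c, Z (tri a b c) ∈ M := by
      intro a b c
      simpa using valuation_tri_mem M hv hs hM _ a (b - a) (c - a) rfl
    have ih' : ∀ S' : Finset (Fin 2 → ℤ), S'.Nonempty → S'.card < S.card → Z (hull S') ∈ M :=
      fun S' h h' => ih _ (hn ▸ h') S' h rfl
    -- Points in the hull of the others are discarded first. Afterwards the set is in convex
    -- position and no three of its points are collinear.
    by_cases hind : ∃ s ∈ S, toPlane s ∈ convexHull ℝ (toPlane '' (S.erase s : Set (Fin 2 → ℤ)))
    · obtain ⟨s, hsS, hs'⟩ := hind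
      have hne : (S.erase s).Nonempty := by
        by_contra h
        rw [Finset.not_nonempty_iff_eq_empty] at h
        rw [h] at hs'
        simp at hs'
      have : hull S = hull (S.erase s) := by
        apply Subtype.ext
        rw [hull_coe hS, hull_coe hne]
        apply Set.Subset.antisymm
        · apply convexHull_min _ (convex_convexHull ℝ _)
          rintro _ ⟨z, hz, rfl⟩
          by_cases h : z = s
          · rwa [h]
          · exact subset_convexHull ℝ _ ⟨z, Finset.mem_coe.2 (Finset.mem_erase.2 ⟨h, hz⟩), rfl⟩
        · exact convexHull_mono (Set.image_mono (by simp))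
      rw [this]
      exact ih' _ hne (Finset.card_erase_lt_of_mem hsS)
    · push Not at hind
      have hseg : ∀ a ∈ S, ∀ b ∈ S, ∀ c ∈ S, a ≠ b → a ≠ c →
          toPlane a ∉ segment ℝ (toPlane b) (toPlane c) := by
        intro a ha b hb c hc hab hac h
        apply hind a ha
        exact (convex_convexHull ℝ _).segment_subset
          (subset_convexHull ℝ _ (Set.mem_image_of_mem toPlane (Finset.mem_coe.2 (Finset.mem_erase.2 ⟨hab.symm, hb⟩))))
          (subset_convexHull ℝ _ (Set.mem_image_of_mem toPlane (Finset.mem_coe.2 (Finset.mem_erase.2 ⟨hac.symm, hc⟩)))) h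
      have hcr : ∀ a ∈ S, ∀ b ∈ S, ∀ c ∈ S, a ≠ b → a ≠ c → b ≠ c → cross (b - a) (c - a) ≠ 0 := by
        intro a ha b hb c hc hab hac hbc
        exact cross_ne_zero_of_notMem_segment (hseg a ha b hb c hc hab hac)
          (hseg b hb c hc a ha hbc hab.symm) (hseg c hc a ha b hb hac.symm hbc.symm)
      rcases le_or_gt S.card 3 with h3 | h4
      · have h1 := hS.card_pos
        rcases (by omega : S.card = 1 ∨ S.card = 2 ∨ S.card = 3) with h | h | h
        · obtain ⟨a, rfl⟩ := Finset.card_eq_one.1 h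
          simpa [tri] using htri a a a
        · obtain ⟨a, b, -, rfl⟩ := Finset.card_eq_two.1 h
          simpa [tri] using htri a a b
        · obtain ⟨a, b, c, -, -, -, rfl⟩ := Finset.card_eq_three.1 h
          exact htri a b c
      · obtain ⟨a, ha⟩ := hS
        have hca : (S.erase a).card = S.card - 1 := Finset.card_erase_of_mem ha
        obtain ⟨b, c, d, hb, hc, hd, hbc, hbd, hcd⟩ := (Finset.two_lt_card_iff (s := S.erase a)).1 (by omega)
        rw [Finset.mem_erase] at hb hc hd
        -- One of the lines from `a` to three further points has the other two strictly on opposite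
        -- sides: otherwise the antisymmetric determinants at `a` would have contradictory signs.
        -- This line carries a diagonal, and both halves have fewer points.
        obtain ⟨b, hb, p, hp, q, hq, hab, hpos, hneg⟩ : ∃ b ∈ S, ∃ p ∈ S, ∃ q ∈ S, a ≠ b ∧
            0 < cross (b - a) (p - a) ∧ cross (b - a) (q - a) < 0 := by
          have e1 : cross (c - a) (b - a) = - cross (b - a) (c - a) := by simp [cross]; ring
          have e2 : cross (d - a) (b - a) = - cross (b - a) (d - a) := by simp [cross]; ring
          have e3 : cross (d - a) (c - a) = - cross (c - a) (d - a) := by simp [cross]; ring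
          have f1 := hcr a ha b hb.2 c hc.2 hb.1.symm hc.1.symm hbc
          have f2 := hcr a ha b hb.2 d hd.2 hb.1.symm hd.1.symm hbd
          have f3 := hcr a ha c hc.2 d hd.2 hc.1.symm hd.1.symm hcd
          by_contra! hno
          have g1 := hno b hb.2 c hc.2 d hd.2 hb.1.symm
          have g2 := hno b hb.2 d hd.2 c hc.2 hb.1.symm
          have g3 := hno c hc.2 b hb.2 d hd.2 hc.1.symm
          have g4 := hno c hc.2 d hd.2 b hb.2 hc.1.symm
          have g5 := hno d hd.2 b hb.2 c hc.2 hd.1.symm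
          have g6 := hno d hd.2 c hc.2 b hb.2 hd.1.symm
          rw [e1] at g3 g4
          rw [e2, e3] at g5 g6
          omega
        have hu : b - a ≠ 0 := fun h => hab (sub_eq_zero.1 h).symm
        have key : ∀ z, cross (b - a) (z - a) = cross (b - a) z - cross (b - a) a := by
          intro z
          simp [cross]
          ring
        have hba : cross (b - a) b = cross (b - a) a := by simp [cross]; ring
        rw [key] at hpos hneg
        set k := cross (b - a) a with hk
        set Sp := S.filter (fun z => k ≤ cross (b - a) z) with hSp
        set Sm := S.filter (fun z => cross (b - a) z ≤ k) with hSm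
        have hU : Sp ∪ Sm = S := by
          rw [hSp, hSm, ← Finset.filter_or]
          exact Finset.filter_true_of_mem fun z _ => le_total _ _
        have haSp : a ∈ Sp := Finset.mem_filter.2 ⟨ha, le_rfl⟩
        have haSm : a ∈ Sm := Finset.mem_filter.2 ⟨ha, le_rfl⟩
        have hcp : Sp.card < S.card := by
          apply Finset.card_lt_card
          rw [Finset.filter_ssubset]
          exact ⟨q, hq, by linarith⟩
        have hcm : Sm.card < S.card := by
          apply Finset.card_lt_card
          rw [Finset.filter_ssubset]
          exact ⟨p, hp, by linarith⟩
        have hsplit := valuation_hull_split hv hs (Sp := Sp) (Sm := Sm) (S0 := {a, b}) hu (c := k)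
          (by simp)
          (by
            intro z hz
            simp only [Finset.mem_insert, Finset.mem_singleton] at hz
            rcases hz with rfl | rfl
            · exact haSp
            · exact Finset.mem_filter.2 ⟨hb, hba.ge⟩)
          (by
            intro z hz
            simp only [Finset.mem_insert, Finset.mem_singleton] at hz
            rcases hz with rfl | rfl
            · exact haSm
            · exact Finset.mem_filter.2 ⟨hb, hba.le⟩)
          (fun z hz => (Finset.mem_filter.1 hz).2) (fun z hz => (Finset.mem_filter.1 hz).2)
          (by
            rw [hU]
            intro x hx hxk
            rw [Finset.coe_insert, Finset.coe_singleton, Set.image_insert_eq, Set.image_singleton,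
              convexHull_pair]
            have hins : ∀ s ∈ S, x ∈ convexHull ℝ
                (insert (toPlane s) (toPlane '' (S.erase s : Set (Fin 2 → ℤ)))) := by
              intro s hs
              rwa [← Set.image_insert_eq, ← Finset.coe_insert, Finset.insert_erase hs]
            have hxa : crossWith (toPlane (b - a)) (x - toPlane a) = 0 := by
              rw [map_sub, hxk, crossWith_toPlane, sub_self]
            have := mem_span_of_crossWith_eq_zero (toPlane_ne_zero hu) hxa
            rw [Submodule.mem_span_singleton, toPlane_sub] at this
            obtain ⟨t, ht⟩ := this
            have hx' : x = (1 - t) • toPlane a + t • toPlane b := by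
              rw [sub_eq_iff_eq_add.1 ht.symm]
              module
            -- A point `x` of the hull on the line `ab` but beyond `a` would put `a` strictly
            -- between `b` and `x`, although `a` is extreme; beyond `b` likewise.
            rcases lt_or_ge t 0 with ht0 | ht0
            · exfalso
              refine not_mem_openSegment_of_notMem_convexHull (hind a ha)
                ⟨b, Finset.mem_coe.2 (Finset.mem_erase.2 ⟨hab.symm, hb⟩), rfl⟩ (hins a ha) ?_
              refine ⟨-t / (1 - t), 1 / (1 - t), div_pos (by linarith) (by linarith),
                div_pos (by linarith) (by linarith), ?_, ?_⟩
              · have : (1 - t) ≠ 0 := by linarith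
                field_simp
                ring
              · have : (1 - t) ≠ 0 := by linarith
                rw [hx', smul_add, smul_smul, smul_smul, one_div, inv_mul_cancel₀ this]
                match_scalars <;> field_simp <;> ring
            rcases le_or_gt t 1 with ht1 | ht1
            · exact ⟨1 - t, t, by linarith, ht0, by ring, hx'.symm⟩
            · exfalso
              refine not_mem_openSegment_of_notMem_convexHull (hind b hb)
                ⟨a, Finset.mem_coe.2 (Finset.mem_erase.2 ⟨hab, ha⟩), rfl⟩ (hins b hb) ?_
              have ht2 : t ≠ 0 := by linarith
              refine ⟨(t - 1) / t, 1 / t, div_pos (by linarith) (by linarith),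
                div_pos (by linarith) (by linarith), ?_, ?_⟩
              · field_simp
                ring
              · rw [hx']
                match_scalars <;> field_simp <;> ring)
        rw [hU] at hsplit
        rw [hsplit]
        exact M.add_mem (ih' _ ⟨a, haSp⟩ hcp) (ih' _ ⟨a, haSm⟩ hcm)

end Generation

/-- The difference of the two valuations is simple and vanishes on all unimodular triangles, so
`valuation_mem` applies with the trivial group. -/
theorem valuation_eq_of_stdTriangle_eq {Z Z' : LatticePolytope → Plane → ℝ}
    (hv : IsValuation Z) (hs : IsSimple Z) (ht : IsTranslativelyExponential Z)
    (hg : IsGLCovariant Z) (hv' : IsValuation Z') (hs' : IsSimple Z')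
    (ht' : IsTranslativelyExponential Z') (hg' : IsGLCovariant Z')
    (h : Z stdTriangle = Z' stdTriangle) : Z = Z' := by
  have key := valuation_mem (Z := fun P => Z P - Z' P) ⊥
    (by
      intro P Q U I hc hU hI
      have h1 := hv P Q U I hc hU hI
      have h2 := hv' P Q U I hc hU hI
      linear_combination h1 - h2)
    (by
      intro P hP
      simp only [hs P hP, hs' P hP, sub_self])
    (by
      intro Φ z
      rw [AddSubgroup.mem_bot]
      ext x
      simp only [Pi.sub_apply, ht _ z x, ht' _ z x, hg Φ _ x, hg' Φ _ x, h]
      simp)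
  funext P
  have := key P
  rwa [AddSubgroup.mem_bot, sub_eq_zero] at this

end ExpVal

namespace ExpVal

open MeasureTheory

/-! ### Sums over the boundary edges of lattice polytopes -/

/-- Primitive lattice vectors, as members of a basis of the lattice. -/
def IsPrimitive (v : Fin 2 → ℤ) : Prop := ∃ v', IsUnit (cross v v')

/-- The primitive segment from `u` to `u + v` lies on the boundary of `P`, with `P` on its left. -/
def IsBoundaryEdge (P : Set Plane) (e : (Fin 2 → ℤ) × (Fin 2 → ℤ)) : Prop :=
  IsPrimitive e.2 ∧ toPlane e.1 + (1 / 2 : ℝ) • toPlane e.2 ∈ P ∧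
    ∀ p ∈ P, 0 ≤ crossWith (toPlane e.2) (p - toPlane e.1)

/-- The sum of `c` over all boundary edges of `P`. -/
noncomputable def edgeSum (c : (Fin 2 → ℤ) × (Fin 2 → ℤ) → ℝ) (P : LatticePolytope) : ℝ :=
  ∑ᶠ e ∈ {e | IsBoundaryEdge P.1 e}, c e

theorem IsPrimitive.ne_zero {v : Fin 2 → ℤ} (h : IsPrimitive v) : v ≠ 0 := by
  rintro rfl
  obtain ⟨v', h⟩ := h
  simp [cross] at h

theorem IsPrimitive.neg {v : Fin 2 → ℤ} (h : IsPrimitive v) : IsPrimitive (-v) := by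
  obtain ⟨v', h⟩ := h
  refine ⟨-v', ?_⟩
  have : cross (-v) (-v') = cross v v' := by simp [cross]
  rwa [this]

/-- A lattice vector parallel to a primitive one is an integral multiple. -/
theorem IsPrimitive.exists_eq_smul {v z : Fin 2 → ℤ} (h : IsPrimitive v) (hz : cross v z = 0) :
    ∃ k : ℤ, z = k • v := by
  obtain ⟨v', h⟩ := h
  rcases Int.isUnit_iff.1 h with h | h
  · refine ⟨cross z v', ?_⟩
    ext i
    simp only [cross, Pi.smul_apply, smul_eq_mul] at *
    fin_cases i
    · simp only [Fin.zero_eta]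
      linear_combination (-z 0) * h + (v' 0) * hz
    · simp only [Fin.mk_one]
      linear_combination (-z 1) * h + (v' 1) * hz
  · refine ⟨-cross z v', ?_⟩
    ext i
    simp only [cross, Pi.smul_apply, smul_eq_mul] at *
    fin_cases i
    · simp only [Fin.zero_eta]
      linear_combination (z 0) * h + (-v' 0) * hz
    · simp only [Fin.mk_one]
      linear_combination (z 1) * h + (-v' 1) * hz

theorem crossWith_self_add (v : Plane) (u : Plane) (t : ℝ) :
    crossWith v (u + t • v - u) = 0 := by
  simp only [crossWith_apply, Pi.add_apply, Pi.sub_apply, Pi.smul_apply, smul_eq_mul]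
  ring

theorem isCompact_latticePolytope (P : LatticePolytope) : IsCompact P.1 := by
  obtain ⟨P, S, hS, rfl⟩ := P
  exact (S.finite_toSet.image _).isCompact_convexHull (𝕜 := ℝ)

theorem convex_latticePolytope (P : LatticePolytope) : Convex ℝ P.1 := by
  obtain ⟨P, S, hS, rfl⟩ := P
  exact convex_convexHull ℝ _

/-- The midpoint is a convex combination of lattice points of `P`. Those with nonzero coefficient
lie on the supporting line, so they are `u + k v` with integral `k`, as `v` is primitive. The
average of the `k` is `1/2`; hence some `k ≤ 0` and some `k ≥ 1` occur, and convexity fills the edge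
between. -/
theorem IsBoundaryEdge.endpoints_mem {P : LatticePolytope} {e : (Fin 2 → ℤ) × (Fin 2 → ℤ)}
    (h : IsBoundaryEdge P.1 e) : toPlane e.1 ∈ P.1 ∧ toPlane (e.1 + e.2) ∈ P.1 := by
  obtain ⟨u, v⟩ := e
  obtain ⟨hprim, hm, hcr⟩ := h
  obtain ⟨S, hS, rfl⟩ := exists_eq_hull P
  have hconv := convex_latticePolytope (hull S)
  have hSP : ∀ s ∈ S, toPlane s ∈ (hull S).1 := by
    intro s hs
    rw [hull_coe hS]
    exact subset_convexHull ℝ _ (Set.mem_image_of_mem toPlane (Finset.mem_coe.2 hs))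
  simp only at hm hcr hprim ⊢
  have hm' := hm
  rw [hull_coe hS, ← Finset.coe_image, Finset.mem_convexHull'] at hm'
  obtain ⟨w, hw0, hw1, hwm⟩ := hm'
  rw [Finset.sum_image toPlane_injective.injOn] at hw1 hwm
  have hw0' : ∀ s ∈ S, 0 ≤ w (toPlane s) := fun s hs => hw0 _ (Finset.mem_image_of_mem _ hs)
  have hline : ∀ s ∈ S, w (toPlane s) ≠ 0 → ∃ k : ℤ, s = u + k • v := by
    have h1 : ∑ s ∈ S, w (toPlane s) * crossWith (toPlane v) (toPlane s - toPlane u) = 0 := by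
      have h2 : crossWith (toPlane v) (∑ s ∈ S, w (toPlane s) • toPlane s - toPlane u) = 0 := by
        rw [hwm]
        exact crossWith_self_add _ _ _
      rw [map_sub, map_sum] at h2
      simp only [map_smul, smul_eq_mul, map_sub, mul_sub, Finset.sum_sub_distrib] at h2 ⊢
      rw [← Finset.sum_mul, hw1, one_mul]
      exact h2
    intro s hs hws
    have h3 := (Finset.sum_eq_zero_iff_of_nonneg fun s hs =>
      mul_nonneg (hw0' s hs) (hcr _ (hSP s hs))).1 h1 s hs
    have h4 := (mul_eq_zero.1 h3).resolve_left hws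
    rw [← toPlane_sub, crossWith_toPlane] at h4
    obtain ⟨k, hk⟩ := hprim.exists_eq_smul (by exact_mod_cast h4)
    exact ⟨k, by rw [← hk]; abel⟩
  choose! k hk using hline
  have hsum : ∑ s ∈ S, w (toPlane s) * (k s : ℝ) = 1 / 2 := by
    have h1 : (∑ s ∈ S, w (toPlane s) * (k s : ℝ)) • toPlane v = (1 / 2 : ℝ) • toPlane v := by
      have h2 : ∑ s ∈ S, w (toPlane s) • toPlane s =
          ∑ s ∈ S, (w (toPlane s) • toPlane u + (w (toPlane s) * (k s : ℝ)) • toPlane v) := by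
        apply Finset.sum_congr rfl
        intro s hs
        by_cases h0 : w (toPlane s) = 0
        · simp [h0]
        · have h5 : toPlane s = toPlane u + (k s : ℝ) • toPlane v := by
            conv_lhs => rw [hk s hs h0]
            ext i
            simp [toPlane]
          conv_lhs => rw [congrArg (w (toPlane s) • ·) h5]
          rw [smul_add, smul_smul]
      rw [hwm, Finset.sum_add_distrib, ← Finset.sum_smul, ← Finset.sum_smul, hw1, one_smul] at h2
      exact (add_left_cancel h2).symm
    exact smul_left_injective ℝ (toPlane_ne_zero hprim.ne_zero) h1
  have hmem : ∀ s ∈ S, w (toPlane s) ≠ 0 → toPlane u + (k s : ℝ) • toPlane v ∈ (hull S).1 := by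
    intro s hs h0
    have h5 : toPlane s = toPlane u + (k s : ℝ) • toPlane v := by
      conv_lhs => rw [hk s hs h0]
      ext i
      simp [toPlane]
    rw [← h5]
    exact hSP s hs
  have hseg : ∀ a b : ℝ, a ≤ 0 → 1 ≤ b → toPlane u + a • toPlane v ∈ (hull S).1 →
      toPlane u + b • toPlane v ∈ (hull S).1 → ∀ t : ℝ, 0 ≤ t → t ≤ 1 →
        toPlane u + t • toPlane v ∈ (hull S).1 := by
    intro a b ha hb h1 h2 t ht0 ht1
    have hab : (0 : ℝ) < b - a := by linarith
    have := hconv h1 h2 (a := (b - t) / (b - a)) (b := (t - a) / (b - a))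
      (div_nonneg (by linarith) hab.le) (div_nonneg (by linarith) hab.le) (by field_simp; ring)
    convert this using 1
    match_scalars
    · field_simp
      ring
    · field_simp
      ring
  obtain ⟨s, hs, hws, hks⟩ : ∃ s ∈ S, w (toPlane s) ≠ 0 ∧ k s ≤ 0 := by
    by_contra! hno
    have : ∑ s ∈ S, w (toPlane s) ≤ ∑ s ∈ S, w (toPlane s) * (k s : ℝ) := by
      apply Finset.sum_le_sum
      intro s hs
      by_cases h0 : w (toPlane s) = 0
      · simp [h0]
      · have h1 : (1 : ℝ) ≤ k s := by exact_mod_cast hno s hs h0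
        nlinarith [hw0' s hs]
    linarith
  obtain ⟨s', hs', hws', hks'⟩ : ∃ s ∈ S, w (toPlane s) ≠ 0 ∧ 1 ≤ k s := by
    by_contra! hno
    have : ∑ s ∈ S, w (toPlane s) * (k s : ℝ) ≤ 0 := by
      apply Finset.sum_nonpos
      intro s hs
      by_cases h0 : w (toPlane s) = 0
      · simp [h0]
      · have h1 : (k s : ℝ) ≤ 0 := by exact_mod_cast Int.lt_add_one_iff.1 (hno s hs h0)
        nlinarith [hw0' s hs]
    linarith
  have key := hseg _ _ (by exact_mod_cast hks) (by exact_mod_cast hks') (hmem s hs hws)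
    (hmem s' hs' hws')
  constructor
  · simpa using key 0 le_rfl zero_le_one
  · simpa [toPlane_add] using key 1 zero_le_one le_rfl

theorem finite_latticePoints (P : LatticePolytope) : {z : Fin 2 → ℤ | toPlane z ∈ P.1}.Finite := by
  obtain ⟨R, hR⟩ := (isCompact_latticePolytope P).isBounded.subset_closedBall 0
  apply (Set.finite_Icc (fun _ : Fin 2 => -⌈R⌉) (fun _ => ⌈R⌉)).subset
  intro z hz
  have h1 : ∀ i, |(z i : ℝ)| ≤ R := by
    intro i
    have h2 : ‖toPlane z‖ ≤ R := by simpa using hR hz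
    exact (norm_le_pi_norm (toPlane z) i).trans h2
  constructor
  · intro i
    have := neg_le_of_abs_le ((h1 i).trans (Int.le_ceil R))
    exact_mod_cast this
  · intro i
    have := le_of_abs_le ((h1 i).trans (Int.le_ceil R))
    exact_mod_cast this

theorem finite_boundaryEdges (P : LatticePolytope) : {e | IsBoundaryEdge P.1 e}.Finite := by
  have hinj : Function.Injective
      (fun e : (Fin 2 → ℤ) × (Fin 2 → ℤ) => (e.1, e.1 + e.2)) := by
    rintro ⟨a, b⟩ ⟨c, d⟩ h
    simp only [Prod.mk.injEq] at h ⊢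
    obtain ⟨rfl, h⟩ := h
    exact ⟨rfl, add_left_cancel h⟩
  refine Set.Finite.of_finite_image (((finite_latticePoints P).prod (finite_latticePoints P)).subset
    ?_) hinj.injOn
  rintro _ ⟨e, he, rfl⟩
  exact IsBoundaryEdge.endpoints_mem he

/-- If `P ∪ Q` is convex and `P` has points on the right of an edge, then this edge is a boundary
edge of `P ∩ Q` if and only if it is one of `Q`. -/
theorem isBoundaryEdge_inter_iff {P Q : Set Plane} (hP : IsClosed P) (hQ : IsClosed Q)
    (hPQ : Convex ℝ (P ∪ Q)) {e : (Fin 2 → ℤ) × (Fin 2 → ℤ)}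
    {p : Plane} (hp : p ∈ P) (hpe : crossWith (toPlane e.2) (p - toPlane e.1) < 0) :
    IsBoundaryEdge (P ∩ Q) e ↔ IsBoundaryEdge Q e := by
  obtain ⟨u, v⟩ := e
  simp only at hpe
  set m := toPlane u + (1 / 2 : ℝ) • toPlane v with hm
  have hm0 : crossWith (toPlane v) (m - toPlane u) = 0 := crossWith_self_add _ _ _
  constructor
  · rintro ⟨h1, h2, h3⟩
    refine ⟨h1, h2.2, ?_⟩
    intro q hq
    by_contra! hqe
    simp only at hqe
    have hseg : segment ℝ p q ⊆ P ∪ Q := hPQ.segment_subset (Or.inl hp) (Or.inr hq)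
    -- The segment is connected and covered by the closed sets `P` and `Q`, so it contains a point
    -- of `P ∩ Q`, which is strictly on the wrong side of the edge.
    have hc : IsPreconnected (segment ℝ p q) := (convex_segment p q).isPreconnected
    obtain ⟨y, hy, hyPQ⟩ := isPreconnected_closed_iff.1 hc P Q hP hQ hseg
      ⟨p, left_mem_segment _ _ _, hp⟩ ⟨q, right_mem_segment _ _ _, hq⟩
    have h4 := h3 y hyPQ
    obtain ⟨r, s, hr, hs, hrs, rfl⟩ := hy
    simp only [map_sub, map_add, map_smul, smul_eq_mul] at h4 hpe hqe
    have : s = 1 - r := by linarith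
    subst this
    rcases hr.eq_or_lt with rfl | hr
    · linarith
    · nlinarith
  · rintro ⟨h1, h2, h3⟩
    refine ⟨h1, ⟨?_, h2⟩, fun y hy => h3 y hy.2⟩
    simp only at h2 h3
    change m ∈ P
    -- Points moving from `p` to the midpoint `m` stay strictly to the right of the edge, hence
    -- outside `Q` and inside `P`. Since `P` is closed, `m ∈ P`.
    have htend : Filter.Tendsto (fun t : ℝ => t • p + (1 - t) • m) (nhdsWithin 0 (Set.Ioi 0))
        (nhds m) := by
      have hcont : Continuous (fun t : ℝ => t • p + (1 - t) • m) := by fun_prop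
      have := (hcont.tendsto 0).mono_left (nhdsWithin_le_nhds (s := Set.Ioi (0 : ℝ)))
      simpa using this
    apply hP.mem_of_tendsto htend
    have h4 : Set.Ioc (0 : ℝ) 1 ∈ nhdsWithin (0 : ℝ) (Set.Ioi 0) := Ioc_mem_nhdsGT one_pos
    filter_upwards [h4] with t ht
    have h5 : t • p + (1 - t) • m ∈ P ∪ Q :=
      hPQ (Or.inl hp) (Or.inr h2) ht.1.le (by linarith [ht.2]) (by ring)
    refine h5.resolve_right fun h6 => ?_
    have h7 := h3 _ h6
    simp only [map_sub, map_add, map_smul, smul_eq_mul] at h7 hpe hm0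
    nlinarith [ht.1]

/-- For each fixed edge, being a boundary edge is itself a valuation. If `P` has points to the
right, the edge belongs to neither `P` nor the union, and `P ∩ Q` and `Q` agree on it; the same
holds with `P` and `Q` exchanged. Otherwise only the membership of the midpoint matters. -/
theorem edgeSum_valuation (c : (Fin 2 → ℤ) × (Fin 2 → ℤ) → ℝ) (P Q U I : LatticePolytope)
    (hc : Convex ℝ (P.1 ∪ Q.1)) (hU : U.1 = P.1 ∪ Q.1) (hI : I.1 = P.1 ∩ Q.1) :
    edgeSum c U + edgeSum c I = edgeSum c P + edgeSum c Q := by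
  have key : ∀ e, (IsBoundaryEdge U.1 e ∨ IsBoundaryEdge I.1 e ↔
      IsBoundaryEdge P.1 e ∨ IsBoundaryEdge Q.1 e) ∧
      (IsBoundaryEdge U.1 e ∧ IsBoundaryEdge I.1 e ↔
      IsBoundaryEdge P.1 e ∧ IsBoundaryEdge Q.1 e) := by
    intro e
    have hPc := (isCompact_latticePolytope P).isClosed
    have hQc := (isCompact_latticePolytope Q).isClosed
    rw [hU, hI]
    by_cases h1 : ∃ p ∈ P.1, crossWith (toPlane e.2) (p - toPlane e.1) < 0
    · obtain ⟨p, hp, hpe⟩ := h1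
      rw [isBoundaryEdge_inter_iff hPc hQc hc hp hpe]
      have n1 : ¬ IsBoundaryEdge P.1 e := fun h => absurd (h.2.2 p hp) (not_le.2 hpe)
      have n2 : ¬ IsBoundaryEdge (P.1 ∪ Q.1) e :=
        fun h => absurd (h.2.2 p (Or.inl hp)) (not_le.2 hpe)
      tauto
    by_cases h2 : ∃ p ∈ Q.1, crossWith (toPlane e.2) (p - toPlane e.1) < 0
    · obtain ⟨p, hp, hpe⟩ := h2
      rw [Set.inter_comm, isBoundaryEdge_inter_iff hQc hPc (by rwa [Set.union_comm]) hp hpe]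
      have n1 : ¬ IsBoundaryEdge Q.1 e := fun h => absurd (h.2.2 p hp) (not_le.2 hpe)
      have n2 : ¬ IsBoundaryEdge (P.1 ∪ Q.1) e :=
        fun h => absurd (h.2.2 p (Or.inr hp)) (not_le.2 hpe)
      tauto
    push Not at h1 h2
    simp only [IsBoundaryEdge, Set.mem_union, Set.mem_inter_iff]
    have a1 : ∀ p, p ∈ P.1 ∨ p ∈ Q.1 → 0 ≤ crossWith (toPlane e.2) (p - toPlane e.1) :=
      fun p hp => hp.elim (h1 p) (h2 p)
    have a2 : ∀ p, p ∈ P.1 ∧ p ∈ Q.1 → 0 ≤ crossWith (toPlane e.2) (p - toPlane e.1) :=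
      fun p hp => h1 p hp.1
    tauto
  rw [edgeSum, edgeSum, edgeSum, edgeSum,
    ← finsum_mem_union_inter (finite_boundaryEdges U) (finite_boundaryEdges I),
    ← finsum_mem_union_inter (finite_boundaryEdges P) (finite_boundaryEdges Q)]
  have k1 : {e | IsBoundaryEdge U.1 e} ∪ {e | IsBoundaryEdge I.1 e} =
      {e | IsBoundaryEdge P.1 e} ∪ {e | IsBoundaryEdge Q.1 e} := Set.ext fun e => (key e).1
  have k2 : {e | IsBoundaryEdge U.1 e} ∩ {e | IsBoundaryEdge I.1 e} =
      {e | IsBoundaryEdge P.1 e} ∩ {e | IsBoundaryEdge Q.1 e} := Set.ext fun e => (key e).2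
  rw [k1, k2]

theorem edgeSum_eq_of_equiv {c c' : (Fin 2 → ℤ) × (Fin 2 → ℤ) → ℝ} {P P' : LatticePolytope}
    (σ : (Fin 2 → ℤ) × (Fin 2 → ℤ) ≃ (Fin 2 → ℤ) × (Fin 2 → ℤ))
    (h : ∀ e, IsBoundaryEdge P'.1 (σ e) ↔ IsBoundaryEdge P.1 e) (hc : ∀ e, c e = c' (σ e)) :
    edgeSum c P = edgeSum c' P' :=
  finsum_mem_eq_of_bijOn σ (σ.bijOn h) fun e _ => hc e

/-- Reversal of edges. -/
def reverseEdge : (Fin 2 → ℤ) × (Fin 2 → ℤ) ≃ (Fin 2 → ℤ) × (Fin 2 → ℤ) where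
  toFun e := (e.1 + e.2, -e.2)
  invFun e := (e.1 + e.2, -e.2)
  left_inv e := by simp
  right_inv e := by simp

theorem edgeSum_neg (c : (Fin 2 → ℤ) × (Fin 2 → ℤ) → ℝ) (P : LatticePolytope) :
    edgeSum (fun e => -c e) P = -edgeSum c P := by
  rw [edgeSum, edgeSum, ← finsum_mem_neg_distrib]
  exact finite_boundaryEdges P

theorem edgeSum_mul (r : ℝ) (c : (Fin 2 → ℤ) × (Fin 2 → ℤ) → ℝ) (P : LatticePolytope) :
    edgeSum (fun e => r * c e) P = r * edgeSum c P := by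
  rw [edgeSum, edgeSum, mul_finsum_mem]

theorem edgeSum_add (c c' : (Fin 2 → ℤ) × (Fin 2 → ℤ) → ℝ) (P : LatticePolytope) :
    edgeSum (fun e => c e + c' e) P = edgeSum c P + edgeSum c' P := by
  rw [edgeSum, edgeSum, edgeSum, finsum_mem_add_distrib (finite_boundaryEdges P)]

/-- A polytope contained in a line lies on both sides of each of its edges. So the reversed edges
are boundary edges too, and odd coefficients cancel. -/
theorem edgeSum_simple {c : (Fin 2 → ℤ) × (Fin 2 → ℤ) → ℝ}
    (hc : ∀ e, c (reverseEdge e) = -c e) {P : LatticePolytope}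
    (hP : Module.finrank ℝ (vectorSpan ℝ P.1) ≤ 1) : edgeSum c P = 0 := by
  have hcol : Collinear ℝ P.1 := collinear_iff_finrank_le_one.2 hP
  have himp : ∀ e, IsBoundaryEdge P.1 e → IsBoundaryEdge P.1 (reverseEdge e) := by
    rintro ⟨u, v⟩ he
    obtain ⟨h1, h2⟩ := he.endpoints_mem
    refine ⟨he.1.neg, ?_, ?_⟩
    · have := he.2.1
      simp only [reverseEdge, Equiv.coe_fn_mk, toPlane_add, toPlane_neg] at this ⊢
      convert this using 1
      module
    · intro p hp
      obtain ⟨w, hw⟩ := (collinear_iff_of_mem h1).1 hcol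
      obtain ⟨r, hr⟩ := hw p hp
      obtain ⟨s, hs⟩ := hw _ h2
      simp only [toPlane_add, vadd_eq_add] at hr hs h1 h2
      have hs' : toPlane v = s • w := by
        rw [add_comm] at hs
        exact add_right_cancel hs
      apply le_of_eq
      simp only [reverseEdge, Equiv.coe_fn_mk, toPlane_add, toPlane_neg]
      rw [hr, hs']
      simp [crossWith_apply]
      ring
  have h1 : edgeSum (fun e => -c e) P = edgeSum c P := by
    apply edgeSum_eq_of_equiv reverseEdge
    · intro e
      refine ⟨fun h => ?_, himp e⟩
      have := himp _ h
      rwa [show reverseEdge (reverseEdge e) = e from reverseEdge.left_inv e] at this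
    · intro e
      rw [hc]
  rw [edgeSum_neg] at h1
  linarith

theorem edgeSum_translate (c : (Fin 2 → ℤ) × (Fin 2 → ℤ) → ℝ) (P : LatticePolytope)
    (z : Fin 2 → ℤ) : edgeSum c (P.translate z) = edgeSum (fun e => c (e.1 + z, e.2)) P := by
  symm
  apply edgeSum_eq_of_equiv ((Equiv.addRight z).prodCongr (Equiv.refl _))
  · rintro ⟨u, v⟩
    simp only [IsBoundaryEdge, LatticePolytope.translate, Equiv.prodCongr_apply, Prod.map_apply,
      Equiv.coe_addRight, Equiv.refl_apply, toPlane_add]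
    refine and_congr Iff.rfl (and_congr ?_ ?_)
    · rw [add_right_comm, Set.mem_image]
      constructor
      · rintro ⟨p, hp, h⟩
        rwa [← add_right_cancel h]
      · exact fun h => ⟨_, h, rfl⟩
    · rw [Set.forall_mem_image]
      simp
  · rintro ⟨u, v⟩
    rfl

end ExpVal

namespace ExpVal

open MeasureTheory

/-! ### The action of `GL(2, ℤ)` on lattice vectors and boundary edges -/

theorem glMap_apply_zero (Φ : Matrix.GeneralLinearGroup (Fin 2) ℤ) (p : Plane) :
    glMap Φ p 0 = (Φ 0 0 : ℝ) * p 0 + (Φ 0 1 : ℝ) * p 1 := by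
  simp [glMap, Matrix.mulVec, dotProduct, Fin.sum_univ_two]

theorem glMap_apply_one (Φ : Matrix.GeneralLinearGroup (Fin 2) ℤ) (p : Plane) :
    glMap Φ p 1 = (Φ 1 0 : ℝ) * p 0 + (Φ 1 1 : ℝ) * p 1 := by
  simp [glMap, Matrix.mulVec, dotProduct, Fin.sum_univ_two]

theorem glMapTranspose_apply_zero (Φ : Matrix.GeneralLinearGroup (Fin 2) ℤ) (p : Plane) :
    glMapTranspose Φ p 0 = (Φ 0 0 : ℝ) * p 0 + (Φ 1 0 : ℝ) * p 1 := by
  simp [glMapTranspose, Matrix.vecMul, dotProduct, Fin.sum_univ_two]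
  ring

theorem glMapTranspose_apply_one (Φ : Matrix.GeneralLinearGroup (Fin 2) ℤ) (p : Plane) :
    glMapTranspose Φ p 1 = (Φ 0 1 : ℝ) * p 0 + (Φ 1 1 : ℝ) * p 1 := by
  simp [glMapTranspose, Matrix.vecMul, dotProduct, Fin.sum_univ_two]
  ring

theorem dotProduct_plane (p q : Plane) : p ⬝ᵥ q = p 0 * q 0 + p 1 * q 1 := by
  simp [dotProduct, Fin.sum_univ_two]

theorem glMap_inv_glMap (Φ : Matrix.GeneralLinearGroup (Fin 2) ℤ) (p : Plane) :
    glMap Φ⁻¹ (glMap Φ p) = p := by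
  have h : ((Φ⁻¹ : Matrix.GeneralLinearGroup (Fin 2) ℤ) : Matrix (Fin 2) (Fin 2) ℤ) *
      (Φ : Matrix (Fin 2) (Fin 2) ℤ) = 1 := Units.inv_mul Φ
  have h' := congrArg (fun A : Matrix (Fin 2) (Fin 2) ℤ => A.map (Int.castRingHom ℝ)) h
  simp only [Matrix.map_mul] at h'
  simp only [glMap, Matrix.mulVecLin_apply, Matrix.mulVec_mulVec]
  have e : (1 : Matrix (Fin 2) (Fin 2) ℤ).map (Int.castRingHom ℝ) = 1 := by simp
  rw [e] at h'
  erw [h']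
  exact Matrix.one_mulVec p

/-- The action of `GL(2, ℤ)` on lattice vectors. -/
def latticeEquiv (Φ : Matrix.GeneralLinearGroup (Fin 2) ℤ) : (Fin 2 → ℤ) ≃ (Fin 2 → ℤ) where
  toFun z := (Φ : Matrix (Fin 2) (Fin 2) ℤ).mulVec z
  invFun z := ((Φ⁻¹ : Matrix.GeneralLinearGroup (Fin 2) ℤ) : Matrix (Fin 2) (Fin 2) ℤ).mulVec z
  left_inv z := by
    simp only [Matrix.mulVec_mulVec]
    rw [Units.inv_mul, Matrix.one_mulVec]
  right_inv z := by
    simp only [Matrix.mulVec_mulVec]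
    rw [Units.mul_inv, Matrix.one_mulVec]

theorem toPlane_latticeEquiv (Φ : Matrix.GeneralLinearGroup (Fin 2) ℤ) (z : Fin 2 → ℤ) :
    toPlane (latticeEquiv Φ z) = glMap Φ (toPlane z) := (glMap_toPlane Φ z).symm

theorem latticeEquiv_add (Φ : Matrix.GeneralLinearGroup (Fin 2) ℤ) (z w : Fin 2 → ℤ) :
    latticeEquiv Φ (z + w) = latticeEquiv Φ z + latticeEquiv Φ w :=
  Matrix.mulVec_add (Φ : Matrix (Fin 2) (Fin 2) ℤ) z w

theorem latticeEquiv_neg (Φ : Matrix.GeneralLinearGroup (Fin 2) ℤ) (z : Fin 2 → ℤ) :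
    latticeEquiv Φ (-z) = -latticeEquiv Φ z :=
  Matrix.mulVec_neg z (Φ : Matrix (Fin 2) (Fin 2) ℤ)

/-- The determinant of an element of `GL(2, ℤ)`. -/
def detZ (Φ : Matrix.GeneralLinearGroup (Fin 2) ℤ) : ℤ := Φ 0 0 * Φ 1 1 - Φ 0 1 * Φ 1 0

theorem detZ_eq (Φ : Matrix.GeneralLinearGroup (Fin 2) ℤ) : detZ Φ = 1 ∨ detZ Φ = -1 := by
  have h : IsUnit (Φ : Matrix (Fin 2) (Fin 2) ℤ).det :=
    (Matrix.isUnit_iff_isUnit_det _).1 Φ.isUnit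
  rw [Matrix.det_fin_two] at h
  exact Int.isUnit_iff.1 h

theorem crossWith_glMap (Φ : Matrix.GeneralLinearGroup (Fin 2) ℤ) (p q : Plane) :
    crossWith (glMap Φ p) (glMap Φ q) = detZ Φ * crossWith p q := by
  simp only [crossWith_apply, glMap_apply_zero, glMap_apply_one, detZ]
  push_cast
  ring

theorem cross_latticeEquiv (Φ : Matrix.GeneralLinearGroup (Fin 2) ℤ) (p q : Fin 2 → ℤ) :
    cross (latticeEquiv Φ p) (latticeEquiv Φ q) = detZ Φ * cross p q := by
  have := crossWith_glMap Φ (toPlane p) (toPlane q)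
  rw [← toPlane_latticeEquiv, ← toPlane_latticeEquiv, crossWith_toPlane, crossWith_toPlane] at this
  exact_mod_cast this

theorem isPrimitive_latticeEquiv (Φ : Matrix.GeneralLinearGroup (Fin 2) ℤ) (v : Fin 2 → ℤ) :
    IsPrimitive (latticeEquiv Φ v) ↔ IsPrimitive v := by
  have hd : IsUnit (detZ Φ) := Int.isUnit_iff.2 (detZ_eq Φ)
  constructor
  · rintro ⟨v', h⟩
    refine ⟨(latticeEquiv Φ).symm v', ?_⟩
    rw [← (latticeEquiv Φ).apply_symm_apply v', cross_latticeEquiv] at h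
    exact isUnit_of_mul_isUnit_right h
  · rintro ⟨v', h⟩
    refine ⟨latticeEquiv Φ v', ?_⟩
    rw [cross_latticeEquiv]
    exact hd.mul h

theorem isBoundaryEdge_image_of_det_one {Φ : Matrix.GeneralLinearGroup (Fin 2) ℤ}
    (hΦ : detZ Φ = 1) (P : Set Plane) (e : (Fin 2 → ℤ) × (Fin 2 → ℤ)) :
    IsBoundaryEdge (glMap Φ '' P) (latticeEquiv Φ e.1, latticeEquiv Φ e.2) ↔
      IsBoundaryEdge P e := by
  refine and_congr (isPrimitive_latticeEquiv Φ _) (and_congr ?_ ?_)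
  · rw [toPlane_latticeEquiv, toPlane_latticeEquiv, ← map_smul, ← map_add]
    exact Function.Injective.mem_set_image (Function.LeftInverse.injective (glMap_inv_glMap Φ))
  · rw [Set.forall_mem_image]
    simp only [toPlane_latticeEquiv, ← map_sub (glMap Φ), crossWith_glMap, hΦ, Int.cast_one,
      one_mul]

/-- A map of determinant `-1` exchanges left and right, so the image edge has to be reversed to keep
the polytope on its left. -/
theorem isBoundaryEdge_image_of_det_neg_one {Φ : Matrix.GeneralLinearGroup (Fin 2) ℤ}
    (hΦ : detZ Φ = -1) (P : Set Plane) (e : (Fin 2 → ℤ) × (Fin 2 → ℤ)) :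
    IsBoundaryEdge (glMap Φ '' P) (reverseEdge (latticeEquiv Φ e.1, latticeEquiv Φ e.2)) ↔
      IsBoundaryEdge P e := by
  refine and_congr ?_ (and_congr ?_ ?_)
  · rw [← isPrimitive_latticeEquiv Φ e.2]
    exact ⟨fun h => by simpa [reverseEdge] using h.neg, fun h => h.neg⟩
  · have : toPlane (reverseEdge (latticeEquiv Φ e.1, latticeEquiv Φ e.2)).1 +
        (1 / 2 : ℝ) • toPlane (reverseEdge (latticeEquiv Φ e.1, latticeEquiv Φ e.2)).2 =
        glMap Φ (toPlane e.1 + (1 / 2 : ℝ) • toPlane e.2) := by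
      simp only [reverseEdge, Equiv.coe_fn_mk, toPlane_add, toPlane_neg, toPlane_latticeEquiv,
        map_add, map_smul]
      module
    rw [this]
    exact Function.Injective.mem_set_image (Function.LeftInverse.injective (glMap_inv_glMap Φ))
  · rw [Set.forall_mem_image]
    have : ∀ p, crossWith (toPlane (reverseEdge (latticeEquiv Φ e.1, latticeEquiv Φ e.2)).2)
        (glMap Φ p - toPlane (reverseEdge (latticeEquiv Φ e.1, latticeEquiv Φ e.2)).1) =
        crossWith (toPlane e.2) (p - toPlane e.1) := by
      intro p
      simp only [reverseEdge, Equiv.coe_fn_mk, ← latticeEquiv_add, ← latticeEquiv_neg,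
        toPlane_latticeEquiv, ← map_sub (glMap Φ), crossWith_glMap, hΦ]
      simp [crossWith_apply, toPlane]
      ring
    simp only [this]

theorem edgeSum_image {c : (Fin 2 → ℤ) × (Fin 2 → ℤ) → ℝ}
    (hc : ∀ e, c (reverseEdge e) = -c e) (P : LatticePolytope)
    (Φ : Matrix.GeneralLinearGroup (Fin 2) ℤ) :
    edgeSum c (P.image Φ) =
      edgeSum (fun e => detZ Φ * c (latticeEquiv Φ e.1, latticeEquiv Φ e.2)) P := by
  symm
  rcases detZ_eq Φ with h | h
  · apply edgeSum_eq_of_equiv ((latticeEquiv Φ).prodCongr (latticeEquiv Φ))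
    · exact isBoundaryEdge_image_of_det_one h P.1
    · intro e
      rw [h, Int.cast_one, one_mul]
      rfl
  · apply edgeSum_eq_of_equiv (((latticeEquiv Φ).prodCongr (latticeEquiv Φ)).trans reverseEdge)
    · exact isBoundaryEdge_image_of_det_neg_one h P.1
    · intro e
      rw [h]
      simp only [Equiv.trans_apply, hc]
      push_cast
      rw [neg_one_mul]
      rfl

/-! ### The boundary edges of the standard triangle -/

theorem mem_stdTriangle {p : Plane} : p ∈ stdTriangle.1 ↔ 0 ≤ p 0 ∧ 0 ≤ p 1 ∧ p 0 + p 1 ≤ 1 := by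
  constructor
  · intro hp
    have hconv : Convex ℝ {p : Plane | 0 ≤ p 0 ∧ 0 ≤ p 1 ∧ p 0 + p 1 ≤ 1} := by
      rintro p ⟨h1, h2, h3⟩ q ⟨h4, h5, h6⟩ a b ha hb hab
      refine ⟨?_, ?_, ?_⟩ <;> simp only [Pi.add_apply, Pi.smul_apply, smul_eq_mul]
      · positivity
      · positivity
      · nlinarith
    refine convexHull_min ?_ hconv hp
    rintro q (rfl | rfl | rfl)
    · show 0 ≤ (1 : ℝ) ∧ 0 ≤ (0 : ℝ) ∧ (1 : ℝ) + 0 ≤ 1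
      norm_num
    · show 0 ≤ (0 : ℝ) ∧ 0 ≤ (1 : ℝ) ∧ (0 : ℝ) + 1 ≤ 1
      norm_num
    · show 0 ≤ (0 : ℝ) ∧ 0 ≤ (0 : ℝ) ∧ (0 : ℝ) + 0 ≤ 1
      norm_num
  · rintro ⟨h1, h2, h3⟩
    rw [stdTriangle]
    simp only
    rw [convexHull_insert (by simp), convexHull_pair, mem_convexJoin]
    refine ⟨_, rfl, ?_⟩
    rcases eq_or_lt_of_le (show p 0 ≤ 1 by linarith) with h | h
    · refine ⟨_, left_mem_segment _ _ _, 1, 0, by norm_num, by norm_num, by norm_num, ?_⟩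
      ext i
      fin_cases i
      · simp [h]
      · simp
        linarith
    · have h' : 1 - p 0 ≠ 0 := by linarith
      refine ⟨_, ⟨p 1 / (1 - p 0), 1 - p 1 / (1 - p 0), div_nonneg h2 (by linarith), ?_, by ring,
        rfl⟩, p 0, 1 - p 0, h1, by linarith, by ring, ?_⟩
      · rw [sub_nonneg, div_le_one (by linarith)]
        linarith
      · ext i
        fin_cases i
        · simp
        · simp
          field_simp

theorem eq_one_or_neg_one_of_isPrimitive {v : Fin 2 → ℤ} (h : IsPrimitive v) {d : ℤ}
    (h0 : d ∣ v 0) (h1 : d ∣ v 1) : d = 1 ∨ d = -1 := by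
  obtain ⟨v', h⟩ := h
  rw [← Int.isUnit_iff]
  exact isUnit_of_dvd_unit (dvd_sub (h0.mul_right _) (h1.mul_right _)) h

theorem isPrimitive_of_cross_eq_one {v v' : Fin 2 → ℤ} (h : cross v v' = 1) : IsPrimitive v :=
  ⟨v', by rw [h]; exact isUnit_one⟩

theorem isBoundaryEdge_stdTriangle (e : (Fin 2 → ℤ) × (Fin 2 → ℤ)) :
    IsBoundaryEdge stdTriangle.1 e ↔
      e = (![0, 0], ![1, 0]) ∨ e = (![1, 0], ![-1, 1]) ∨ e = (![0, 1], ![0, -1]) := by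
  obtain ⟨u, v⟩ := e
  constructor
  · rintro ⟨hprim, hm, hcr⟩
    rw [mem_stdTriangle] at hm
    have c1 := hcr ![0, 0] (mem_stdTriangle.2 (by simp))
    have c2 := hcr ![1, 0] (mem_stdTriangle.2 (by simp))
    have c3 := hcr ![0, 1] (mem_stdTriangle.2 (by simp))
    simp only [toPlane, crossWith_apply, Pi.sub_apply, Pi.add_apply, Pi.smul_apply, smul_eq_mul,
      Matrix.cons_val_zero, Matrix.cons_val_one] at hm c1 c2 c3 hprim
    obtain ⟨m1, m2, m3⟩ := hm
    have m1' : 0 ≤ 2 * u 0 + v 0 := by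
      have : (0 : ℝ) ≤ 2 * u 0 + v 0 := by linarith
      exact_mod_cast this
    have m2' : 0 ≤ 2 * u 1 + v 1 := by
      have : (0 : ℝ) ≤ 2 * u 1 + v 1 := by linarith
      exact_mod_cast this
    have m3' : 2 * u 0 + v 0 + (2 * u 1 + v 1) ≤ 2 := by
      have : (2 : ℝ) * u 0 + v 0 + (2 * u 1 + v 1) ≤ 2 := by linarith
      exact_mod_cast this
    have c1' : 0 ≤ v 0 * (0 - u 1) - v 1 * (0 - u 0) := by exact_mod_cast c1
    have c2' : 0 ≤ v 0 * (0 - u 1) - v 1 * (1 - u 0) := by exact_mod_cast c2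
    have c3' : 0 ≤ v 0 * (1 - u 1) - v 1 * (0 - u 0) := by exact_mod_cast c3
    have hd : ∀ d : ℤ, d ∣ v 0 → d ∣ v 1 → d = 1 ∨ d = -1 :=
      fun d => eq_one_or_neg_one_of_isPrimitive hprim
    have hodd : ¬ (2 ∣ v 0 ∧ 2 ∣ v 1) := by
      rintro ⟨h1, h2⟩
      rcases hd 2 h1 h2 with h | h <;> omega
    -- `(X, Y)` is twice the midpoint: a lattice point of `2T` with the parity of the primitive
    -- vector `v`, so not both coordinates are even. Only the midpoints of the three sides remain.
    obtain ⟨X, hX⟩ : ∃ X, X = 2 * u 0 + v 0 := ⟨_, rfl⟩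
    obtain ⟨Y, hY⟩ : ∃ Y, Y = 2 * u 1 + v 1 := ⟨_, rfl⟩
    rcases (by omega : X = 1 ∧ Y = 0 ∨ X = 1 ∧ Y = 1 ∨ X = 0 ∧ Y = 1) with
      ⟨hx, hy⟩ | ⟨hx, hy⟩ | ⟨hx, hy⟩
    · left
      have e0 : v 0 = 1 - 2 * u 0 := by omega
      have e1 : v 1 = -2 * u 1 := by omega
      rw [e0, e1] at c1' c2' c3'
      have hu1 : u 1 = 0 := by nlinarith
      have hv1 : v 1 = 0 := by omega
      have hv0 := hd (v 0) dvd_rfl (by simp [hv1])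
      have hu0 : u 0 = 0 := by
        rw [hu1] at c3'
        omega
      refine Prod.ext ?_ ?_ <;> ext i <;> fin_cases i <;> simp <;> omega
    · right; left
      have e0 : v 0 = 1 - 2 * u 0 := by omega
      have e1 : v 1 = 1 -2 * u 1 := by omega
      rw [e0, e1] at c1' c2' c3'
      have hu1 : u 0 + u 1 = 1 := by nlinarith
      have hv1 : v 1 = - v 0 := by omega
      have hv0 := hd (v 0) dvd_rfl (by simp [hv1])
      have hu0 : u 0 = 1 := by
        have : u 1 = 1 - u 0 := by omega
        rw [this] at c1'
        have : 0 ≤ u 0 - (1 - u 0) := by linarith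
        omega
      refine Prod.ext ?_ ?_ <;> ext i <;> fin_cases i <;> simp <;> omega
    · right; right
      have e0 : v 0 = - 2 * u 0 := by omega
      have e1 : v 1 = 1 -2 * u 1 := by omega
      rw [e0, e1] at c1' c2' c3'
      have hu0 : u 0 = 0 := by nlinarith
      have hv0 : v 0 = 0 := by omega
      have hv1 := hd (v 1) (by simp [hv0]) dvd_rfl
      have hu1 : u 1 = 1 := by
        rw [hu0] at c2'
        omega
      refine Prod.ext ?_ ?_ <;> ext i <;> fin_cases i <;> simp <;> omega
  · rintro (h | h | h) <;> rw [Prod.mk.injEq] at h <;> obtain ⟨rfl, rfl⟩ := h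
    · refine ⟨isPrimitive_of_cross_eq_one (v' := ![0, 1]) (by simp [cross]), ?_, ?_⟩
      · rw [mem_stdTriangle]
        simp [toPlane]
        norm_num
      · intro p hp
        rw [mem_stdTriangle] at hp
        simp [toPlane, crossWith_apply]
        linarith
    · refine ⟨isPrimitive_of_cross_eq_one (v' := ![0, -1]) (by simp [cross]), ?_, ?_⟩
      · rw [mem_stdTriangle]
        simp [toPlane]
        norm_num
      · intro p hp
        rw [mem_stdTriangle] at hp
        simp [toPlane, crossWith_apply]
        linarith
    · refine ⟨isPrimitive_of_cross_eq_one (v' := ![1, 0]) (by simp [cross]), ?_, ?_⟩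
      · rw [mem_stdTriangle]
        simp [toPlane]
        norm_num
      · intro p hp
        rw [mem_stdTriangle] at hp
        simp [toPlane, crossWith_apply]
        linarith

theorem edgeSum_stdTriangle (c : (Fin 2 → ℤ) × (Fin 2 → ℤ) → ℝ) :
    edgeSum c stdTriangle =
      c (![0, 0], ![1, 0]) + c (![1, 0], ![-1, 1]) + c (![0, 1], ![0, -1]) := by
  have : {e | IsBoundaryEdge stdTriangle.1 e} = (({(![0, 0], ![1, 0]), (![1, 0], ![-1, 1]),
      (![0, 1], ![0, -1])} : Finset ((Fin 2 → ℤ) × (Fin 2 → ℤ))) :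
        Set ((Fin 2 → ℤ) × (Fin 2 → ℤ))) := by
    ext e
    rw [show (e ∈ {e | IsBoundaryEdge stdTriangle.1 e}) = IsBoundaryEdge stdTriangle.1 e from rfl,
      isBoundaryEdge_stdTriangle]
    simp
  rw [edgeSum, this, finsum_mem_coe_finset, Finset.sum_insert (by decide),
    Finset.sum_insert (by decide), Finset.sum_singleton]
  ring

end ExpVal

namespace ExpVal

open MeasureTheory

/-! ### Edge weights -/

/-- Functions attached to the bases of the lattice: symmetric, even in each variable, and
additive along triples `v`, `v'`, `v + v'`. -/
structure IsSymbol (F : ℝ → ℝ → ℝ) : Prop where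
  symm : ∀ p q, F p q = F q p
  even : ∀ p q, F (-p) q = F p q
  add : ∀ p q, (p + q) * F p q = p * F q (p + q) + q * F p (p + q)

theorem IsSymbol.even_right {F : ℝ → ℝ → ℝ} (hF : IsSymbol F) (p q : ℝ) : F p (-q) = F p q := by
  rw [hF.symm, hF.even, hF.symm]

theorem IsSymbol.neg {F : ℝ → ℝ → ℝ} (hF : IsSymbol F) : IsSymbol fun p q => -F p q where
  symm p q := by rw [hF.symm]
  even p q := by rw [hF.even]
  add p q := by linarith [hF.add p q]

/-- The weight of `v + v'` given the weights `α` of `v` and `β` of `v'`. -/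
noncomputable def mediantWeight (F : ℝ → ℝ → ℝ) (p q α β : ℝ) : ℝ :=
  if p = 0 then (β * (p + q) + F (p + q) q) / q else (α * (p + q) - F p (p + q)) / p

/-- Two equations are imposed on the one unknown weight of the mediant. Adding `q` times the first
and `p` times the second gives `p + q` times the relation for `α, β`, by `IsSymbol.add`. So they are
consistent, and either may be solved, whichever has a nonzero divisor. -/
theorem mediantWeight_spec {F : ℝ → ℝ → ℝ} (hF : IsSymbol F) {p q α β : ℝ}
    (hpq : p ≠ 0 ∨ q ≠ 0) (h : α * q - β * p = F p q) :
    α * (p + q) - mediantWeight F p q α β * p = F p (p + q) ∧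
      mediantWeight F p q α β * q - β * (p + q) = F (p + q) q := by
  rw [mediantWeight]
  split_ifs with hp
  · subst hp
    have hq : q ≠ 0 := hpq.resolve_left (by simp)
    simp only [zero_add, mul_zero, sub_zero] at *
    refine ⟨h, ?_⟩
    field_simp
    ring
  · constructor
    · field_simp
      ring
    · have h1 := hF.add p q
      rw [hF.symm (p + q) q]
      field_simp
      linear_combination (p + q) * h + h1

/-- Weights of `a v + b v'` by the Euclidean algorithm, given the weights `α` of `v` and `β`
of `v'`. -/
noncomputable def euclidWeight (F : ℝ → ℝ → ℝ) (a b : ℕ) (p q α β : ℝ) : ℝ :=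
  if _hb : b = 0 then α
  else if _ha : a = 0 then β
  -- Uses `a v + b v' = (a - b) v + b (v + v')`; the last case is its mirror image.
  else if b ≤ a then euclidWeight F (a - b) b p (p + q) α (mediantWeight F p q α β)
  else euclidWeight F a (b - a) (p + q) q (mediantWeight F p q α β) β
termination_by a + b
decreasing_by all_goals omega

theorem euclidWeight_zero_right (F : ℝ → ℝ → ℝ) (a : ℕ) (p q α β : ℝ) :
    euclidWeight F a 0 p q α β = α := by
  rw [euclidWeight]
  simp

theorem euclidWeight_zero_left (F : ℝ → ℝ → ℝ) {b : ℕ} (hb : b ≠ 0) (p q α β : ℝ) :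
    euclidWeight F 0 b p q α β = β := by
  rw [euclidWeight]
  simp [hb]

theorem euclidWeight_of_ge (F : ℝ → ℝ → ℝ) {a b : ℕ} (ha : a ≠ 0) (h : b ≤ a) (p q α β : ℝ) :
    euclidWeight F a b p q α β =
      euclidWeight F (a - b) b p (p + q) α (mediantWeight F p q α β) := by
  by_cases hb : b = 0
  · subst hb
    rw [euclidWeight_zero_right, euclidWeight_zero_right]
  · conv_lhs => rw [euclidWeight]
    simp [hb, ha, h]

/-- On the tie `a = b` the definition takes the other branch, but both return the weight of the
mediant. Having both rules at ties lets two neighbouring vectors descend together. -/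
theorem euclidWeight_of_le (F : ℝ → ℝ → ℝ) {a b : ℕ} (hb : b ≠ 0) (h : a ≤ b) (p q α β : ℝ) :
    euclidWeight F a b p q α β =
      euclidWeight F a (b - a) (p + q) q (mediantWeight F p q α β) β := by
  by_cases ha : a = 0
  · subst ha
    rw [euclidWeight_zero_left F hb, Nat.sub_zero, euclidWeight_zero_left F hb]
  · rcases h.eq_or_lt with rfl | h
    · rw [euclidWeight_of_ge F ha le_rfl, Nat.sub_self, euclidWeight_zero_left F ha,
        euclidWeight_zero_right]
    · conv_lhs => rw [euclidWeight]
      simp [hb, ha, not_le.2 h]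

/-- Two vectors of determinant one in the quadrant, unless they are the starting basis, lie in the
same closed half of the cone cut by the mediant. They descend simultaneously until they are the
current basis, where the relation is the given one. -/
theorem euclidWeight_spec {F : ℝ → ℝ → ℝ} (hF : IsSymbol F) (n : ℕ) :
    ∀ (a b c d : ℕ) (p q α β : ℝ), a + b + c + d = n → a * d = b * c + 1 → (p ≠ 0 ∨ q ≠ 0) →
      α * q - β * p = F p q →
      euclidWeight F a b p q α β * (c * p + d * q) - euclidWeight F c d p q α β * (a * p + b * q) =
        F (a * p + b * q) (c * p + d * q) := by
  induction n using Nat.strong_induction_on with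
  | _ n ih =>
    intro a b c d p q α β hn hdet hpq h
    obtain ⟨s1, s2⟩ := mediantWeight_spec hF hpq h
    have ha : a ≠ 0 := by rintro rfl; omega
    have hd : d ≠ 0 := by rintro rfl; omega
    by_cases hid : b = 0 ∧ c = 0
    · obtain ⟨rfl, rfl⟩ := hid
      have h1 : a = 1 ∧ d = 1 := by
        rw [zero_mul, zero_add] at hdet
        exact ⟨Nat.eq_one_of_mul_eq_one_right hdet, Nat.eq_one_of_mul_eq_one_left hdet⟩
      obtain ⟨rfl, rfl⟩ := h1
      rw [euclidWeight_zero_right, euclidWeight_zero_left F one_ne_zero]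
      simpa using h
    -- Strictly separated vectors would give `a d ≥ (b + 1)(c + 1)`, which with `a d = b c + 1`
    -- forces `b = c = 0`; the opposite order contradicts the sign of the determinant.
    have hcase : (b ≤ a ∧ d ≤ c) ∨ (a ≤ b ∧ c ≤ d) := by
      by_contra hno
      rcases (by omega : (b + 1 ≤ a ∧ c + 1 ≤ d) ∨ (a + 1 ≤ b ∧ d + 1 ≤ c)) with ⟨h1, h2⟩ | ⟨h1, h2⟩
      · have := Nat.mul_le_mul h1 h2
        have : (b + 1) * (c + 1) = b * c + b + c + 1 := by ring
        omega
      · have := Nat.mul_le_mul h1 h2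
        nlinarith
    rcases hcase with ⟨h1, h2⟩ | ⟨h1, h2⟩
    · have hc : c ≠ 0 := by omega
      rw [euclidWeight_of_ge F ha h1, euclidWeight_of_ge F hc h2]
      have hdet' : (a - b) * d = b * (c - d) + 1 := by
        zify [h1, h2] at hdet ⊢
        linear_combination hdet
      have hp' : p ≠ 0 ∨ p + q ≠ 0 := by
        by_contra! hno
        have : q = 0 := by linarith
        tauto
      have := ih (a - b + b + (c - d) + d) (by omega) (a - b) b (c - d) d p (p + q) α
        (mediantWeight F p q α β) rfl hdet' hp' s1
      push_cast [Nat.cast_sub h1, Nat.cast_sub h2] at this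
      have e1 : ((a : ℝ) - b) * p + b * (p + q) = a * p + b * q := by ring
      have e2 : ((c : ℝ) - d) * p + d * (p + q) = c * p + d * q := by ring
      rwa [e1, e2] at this
    · have hb : b ≠ 0 := by omega
      rw [euclidWeight_of_le F hb h1, euclidWeight_of_le F hd h2]
      have hdet' : a * (d - c) = (b - a) * c + 1 := by
        zify [h1, h2] at hdet ⊢
        linear_combination hdet
      have hp' : p + q ≠ 0 ∨ q ≠ 0 := by
        by_contra! hno
        have : p = 0 := by linarith
        tauto
      have := ih (a + (b - a) + c + (d - c)) (by omega) a (b - a) c (d - c) (p + q) q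
        (mediantWeight F p q α β) β rfl hdet' hp' s2
      push_cast [Nat.cast_sub h1, Nat.cast_sub h2] at this
      have e1 : (a : ℝ) * (p + q) + (b - a) * q = a * p + b * q := by ring
      have e2 : (c : ℝ) * (p + q) + (d - c) * q = c * p + d * q := by ring
      rwa [e1, e2] at this

/-- `w` is an edge weight for the symbol `F` at the point `x`. -/
structure IsWeight (F : ℝ → ℝ → ℝ) (x : Plane) (w : (Fin 2 → ℤ) → ℝ) : Prop where
  odd : ∀ v, w (-v) = -w v
  basis : ∀ v v', IsUnit (cross v v') →
    w v * (toPlane v' ⬝ᵥ x) - w v' * (toPlane v ⬝ᵥ x) =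
      cross v v' * F (toPlane v ⬝ᵥ x) (toPlane v' ⬝ᵥ x)

/-- The relation between the weights of two basis vectors. -/
def WeightRel (F : ℝ → ℝ → ℝ) (x : Plane) (w : (Fin 2 → ℤ) → ℝ) (v v' : Fin 2 → ℤ) : Prop :=
  w v * (toPlane v' ⬝ᵥ x) - w v' * (toPlane v ⬝ᵥ x) =
      cross v v' * F (toPlane v ⬝ᵥ x) (toPlane v' ⬝ᵥ x)

theorem WeightRel.swap {F : ℝ → ℝ → ℝ} (hF : IsSymbol F) {x : Plane} {w : (Fin 2 → ℤ) → ℝ}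
    {v v' : Fin 2 → ℤ} (h : WeightRel F x w v v') : WeightRel F x w v' v := by
  have e : cross v' v = -cross v v' := by simp [cross]; ring
  rw [WeightRel] at *
  rw [e, hF.symm]
  push_cast
  linarith

theorem WeightRel.of_neg_left {F : ℝ → ℝ → ℝ} (hF : IsSymbol F) {x : Plane}
    {w : (Fin 2 → ℤ) → ℝ} {v v' : Fin 2 → ℤ} (hw : w (-v) = -w v)
    (h : WeightRel F x w (-v) v') : WeightRel F x w v v' := by
  have e : cross (-v) v' = -cross v v' := by simp [cross]; ring
  rw [WeightRel] at *
  rw [e, hw, toPlane_neg, neg_dotProduct, hF.even] at h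
  push_cast at h
  linarith

/-- Weights of the unit vectors are chosen to satisfy their one linear relation, solvable as `x ≠
0`, and are propagated by descent in the first and in the fourth quadrant, then extended oddly. Up
to signs of its vectors, which evenness of `F` permits, each basis lies in one closed quadrant. -/
theorem exists_isWeight {F : ℝ → ℝ → ℝ} (hF : IsSymbol F) {x : Plane} (hx : x ≠ 0) :
    ∃ w, IsWeight F x w := by
  have hx' : x 0 ≠ 0 ∨ x 1 ≠ 0 := by
    by_contra! h
    apply hx
    ext i
    fin_cases i
    · exact h.1
    · exact h.2
  obtain ⟨α, β, hαβ⟩ : ∃ α β, α * x 1 - β * x 0 = F (x 0) (x 1) := by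
    rcases hx' with h | h
    · exact ⟨0, -F (x 0) (x 1) / x 0, by field_simp; ring⟩
    · exact ⟨F (x 0) (x 1) / x 1, 0, by field_simp; ring⟩
  set W : (Fin 2 → ℤ) → ℝ :=
    fun v => euclidWeight F (v 0).natAbs (v 1).natAbs (x 0) (x 1) α β with hW
  -- In the fourth quadrant the descent starts from `e₁` and `-e₂`. This reverses orientation, hence
  -- the symbol `-F`, and the weight of `-e₂` is `-β`.
  set W' : (Fin 2 → ℤ) → ℝ :=
    fun v => euclidWeight (fun p q => -F p q) (v 0).natAbs (v 1).natAbs (x 0) (-x 1) α (-β) with hW'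
  have Wneg : ∀ v, W (-v) = W v := fun v => by simp [hW]
  have W'neg : ∀ v, W' (-v) = W' v := fun v => by simp [hW']
  have hbd0 : ∀ v : Fin 2 → ℤ, v 1 = 0 → W v = W' v := by
    intro v h
    simp [hW, hW', h, euclidWeight_zero_right]
  have hbd1 : ∀ v : Fin 2 → ℤ, v 0 = 0 → v 1 ≠ 0 → W v = -W' v := by
    intro v h h'
    have : (v 1).natAbs ≠ 0 := by omega
    simp [hW, hW', h, euclidWeight_zero_left _ this]
  set w : (Fin 2 → ℤ) → ℝ := fun v =>
    if v = 0 then 0 else if 0 ≤ v 1 then (if 0 ≤ v 0 then W v else -W' v)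
      else (if v 0 ≤ 0 then -W v else W' v) with hw
  have hne : ∀ {v : Fin 2 → ℤ}, v ≠ 0 → v 0 ≠ 0 ∨ v 1 ≠ 0 := by
    intro v hv
    by_contra! h
    apply hv
    ext i
    fin_cases i
    · exact h.1
    · exact h.2
  have q1 : ∀ v, v ≠ 0 → 0 ≤ v 0 → 0 ≤ v 1 → w v = W v := by
    intro v hv h0 h1
    simp [hw, hv, h0, h1]
  have q4 : ∀ v, v ≠ 0 → 0 ≤ v 0 → v 1 ≤ 0 → w v = W' v := by
    intro v hv h0 h1
    rcases h1.eq_or_lt with h | h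
    · rw [q1 v hv h0 h.ge, hbd0 v h]
    · rcases h0.eq_or_lt with h' | h'
      · simp only [hw, hv, if_false, not_le.2 h, h'.symm.le, if_true, hbd1 v h'.symm h.ne, neg_neg]
      · simp only [hw, hv, if_false, not_le.2 h, not_le.2 h']
  have hodd : ∀ v, w (-v) = -w v := by
    intro v
    by_cases hv : v = 0
    · simp [hw, hv]
    have hv' : -v ≠ 0 := neg_ne_zero.2 hv
    rcases lt_trichotomy (v 1) 0 with h | h | h
    · simp only [hw, hv, hv', if_false, Pi.neg_apply, Wneg, W'neg, not_le.2 h,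
        show (0 : ℤ) ≤ -v 1 by omega, if_true, neg_nonneg]
      split_ifs <;> simp
    · simp only [hw, hv, hv', if_false, Pi.neg_apply, Wneg, W'neg, h, neg_zero, le_refl, if_true,
        hbd0 v h, neg_nonneg]
      have := (hne hv).resolve_right (by simp [h])
      split_ifs <;> first | omega | simp
    · simp only [hw, hv, hv', if_false, Pi.neg_apply, Wneg, W'neg, h.le,
        show ¬ (0 : ℤ) ≤ -v 1 by omega, if_true]
      have : (-v 0 ≤ 0) = (0 ≤ v 0) := by simp
      simp only [this]
      split_ifs <;> simp
  have hcast : ∀ a : ℤ, 0 ≤ a → ((a.natAbs : ℕ) : ℝ) = a := by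
    intro a ha
    rw [Nat.cast_natAbs, abs_of_nonneg ha]
  have hcast' : ∀ a : ℤ, a ≤ 0 → ((a.natAbs : ℕ) : ℝ) = -a := by
    intro a ha
    rw [Nat.cast_natAbs, abs_of_nonpos ha]
    simp
  have ne_of_unit : ∀ v v', IsUnit (cross v v') → v ≠ 0 ∧ v' ≠ 0 := by
    intro v v' h
    constructor
    · rintro rfl
      simp [cross] at h
    · rintro rfl
      simp [cross] at h
  have hdot : ∀ v : Fin 2 → ℤ, toPlane v ⬝ᵥ x = v 0 * x 0 + v 1 * x 1 := by
    intro v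
    rw [dotProduct_plane]
    rfl
  have r1 : ∀ v v', 0 ≤ v 0 → 0 ≤ v 1 → 0 ≤ v' 0 → 0 ≤ v' 1 → cross v v' = 1 →
      WeightRel F x w v v' := by
    intro v v' h1 h2 h3 h4 hc
    obtain ⟨n1, n2⟩ := ne_of_unit v v' (by rw [hc]; exact isUnit_one)
    have := euclidWeight_spec hF _ (v 0).natAbs (v 1).natAbs (v' 0).natAbs (v' 1).natAbs
      (x 0) (x 1) α β rfl (by
        zify
        rw [abs_of_nonneg h1, abs_of_nonneg h2, abs_of_nonneg h3, abs_of_nonneg h4]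
        rw [cross] at hc
        linarith) hx' hαβ
    rw [hcast _ h1, hcast _ h2, hcast _ h3, hcast _ h4] at this
    rw [WeightRel, q1 v n1 h1 h2, q1 v' n2 h3 h4, hc, hdot, hdot, Int.cast_one, one_mul]
    exact this
  have r4 : ∀ v v', 0 ≤ v 0 → v 1 ≤ 0 → 0 ≤ v' 0 → v' 1 ≤ 0 → cross v v' = -1 →
      WeightRel F x w v v' := by
    intro v v' h1 h2 h3 h4 hc
    obtain ⟨n1, n2⟩ := ne_of_unit v v' (by rw [hc]; exact isUnit_one.neg)
    have := euclidWeight_spec hF.neg _ (v 0).natAbs (v 1).natAbs (v' 0).natAbs (v' 1).natAbs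
      (x 0) (-x 1) α (-β) rfl (by
        zify
        rw [abs_of_nonneg h1, abs_of_nonpos h2, abs_of_nonneg h3, abs_of_nonpos h4]
        rw [cross] at hc
        linarith) (by simpa using hx') (by rw [hF.even_right]; linarith)
    rw [hcast _ h1, hcast' _ h2, hcast _ h3, hcast' _ h4, neg_mul_neg, neg_mul_neg] at this
    rw [WeightRel, q4 v n1 h1 h2, q4 v' n2 h3 h4, hc, hdot, hdot]
    push_cast
    rw [neg_one_mul]
    exact this
  have r14 : ∀ v v', 0 ≤ v 0 → 0 ≤ v' 0 → IsUnit (cross v v') →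
      (0 ≤ v 1 ∧ 0 ≤ v' 1 ∨ v 1 ≤ 0 ∧ v' 1 ≤ 0) → WeightRel F x w v v' := by
    intro v v' h1 h3 hc h
    have e : cross v' v = -cross v v' := by simp [cross]; ring
    rcases Int.isUnit_iff.1 hc with hc | hc <;> rcases h with ⟨h2, h4⟩ | ⟨h2, h4⟩
    · exact r1 v v' h1 h2 h3 h4 hc
    · exact (r4 v' v h3 h4 h1 h2 (by rw [e, hc])).swap hF
    · exact (r1 v' v h3 h4 h1 h2 (by rw [e, hc, neg_neg])).swap hF
    · exact r4 v v' h1 h2 h3 h4 hc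
  have rmix : ∀ v v', 0 ≤ v 0 → 0 ≤ v' 0 → IsUnit (cross v v') → 0 < v 1 → v' 1 < 0 →
      WeightRel F x w v v' := by
    intro v v' h1 h3 hc h2 h4
    have e1 : cross (-v) v' = -cross v v' := by simp [cross]; ring
    have e2 : cross (-v') v = cross v v' := by simp [cross]; ring
    by_cases h0 : v 0 = 0
    · refine WeightRel.of_neg_left hF (hodd v) (r14 _ _ (by simp [h0]) h3 ?_ (Or.inr ?_))
      · rw [e1]
        exact hc.neg
      · simp only [Pi.neg_apply]
        omega
    by_cases h0' : v' 0 = 0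
    · refine (WeightRel.of_neg_left hF (hodd v') (r14 _ _ (by simp [h0']) h1 ?_ (Or.inl ?_))).swap hF
      · rw [e2]
        exact hc
      · simp only [Pi.neg_apply]
        omega
    -- Off the axes, vectors in different quadrants have determinant of absolute value at least two.
    exfalso
    have p1 : 1 ≤ v 0 := by omega
    have p2 : 1 ≤ v' 0 := by omega
    rcases Int.isUnit_iff.1 hc with hc | hc <;> rw [cross] at hc <;> nlinarith
  have rpos : ∀ v v', 0 ≤ v 0 → 0 ≤ v' 0 → IsUnit (cross v v') → WeightRel F x w v v' := by
    intro v v' h1 h3 hc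
    have e : cross v' v = -cross v v' := by simp [cross]; ring
    rcases (by omega : (0 ≤ v 1 ∧ 0 ≤ v' 1 ∨ v 1 ≤ 0 ∧ v' 1 ≤ 0) ∨ (0 < v 1 ∧ v' 1 < 0) ∨
      (0 < v' 1 ∧ v 1 < 0)) with h | h | h
    · exact r14 v v' h1 h3 hc h
    · exact rmix v v' h1 h3 hc h.1 h.2
    · exact (rmix v' v h3 h1 (by rw [e]; exact hc.neg) h.1 h.2).swap hF
  have rleft : ∀ v v', 0 ≤ v' 0 → IsUnit (cross v v') → WeightRel F x w v v' := by
    intro v v' h3 hc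
    have e1 : cross (-v) v' = -cross v v' := by simp [cross]; ring
    rcases le_total 0 (v 0) with h | h
    · exact rpos v v' h h3 hc
    · exact WeightRel.of_neg_left hF (hodd v) (rpos _ _ (by simpa using h) h3
        (by rw [e1]; exact hc.neg))
  refine ⟨w, hodd, fun v v' hc => ?_⟩
  have e : cross (-v') v = cross v v' := by simp [cross]; ring
  rcases le_total 0 (v' 0) with h | h
  · exact rleft v v' h hc
  · have e3 : cross v (-v') = -cross v v' := by simp [cross]; ring
    exact (WeightRel.of_neg_left hF (hodd v') ((rleft v (-v') (by simpa using h)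
      (by rw [e3]; exact hc.neg)).swap hF)).swap hF

/-! ### Uniqueness of weights up to linear forms -/

/-- The rows of a matrix in `SL(2, ℤ)`. -/
def slRow (M : Matrix.SpecialLinearGroup (Fin 2) ℤ) (i : Fin 2) : Fin 2 → ℤ :=
  fun j => (M : Matrix (Fin 2) (Fin 2) ℤ) i j

theorem cross_slRow (M : Matrix.SpecialLinearGroup (Fin 2) ℤ) :
    cross (slRow M 0) (slRow M 1) = 1 := by
  have := M.2
  rw [Matrix.det_fin_two] at this
  exact this

theorem slRow_S_mul (M : Matrix.SpecialLinearGroup (Fin 2) ℤ) :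
    slRow (ModularGroup.S * M) 0 = -slRow M 1 ∧ slRow (ModularGroup.S * M) 1 = slRow M 0 := by
  constructor <;>
  · ext j
    simp only [slRow, Matrix.SpecialLinearGroup.coe_mul, ModularGroup.coe_S, Matrix.mul_apply,
      Fin.sum_univ_two]
    simp [slRow]

theorem slRow_T_mul (M : Matrix.SpecialLinearGroup (Fin 2) ℤ) :
    slRow (ModularGroup.T * M) 0 = slRow M 0 + slRow M 1 ∧
      slRow (ModularGroup.T * M) 1 = slRow M 1 := by
  constructor <;>
  · ext j
    simp only [slRow, Matrix.SpecialLinearGroup.coe_mul, ModularGroup.coe_T, Matrix.mul_apply,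
      Fin.sum_univ_two]
    simp [slRow]

/-- Two weights for the same symbol differ by a multiple of the linear form `v ↦ ⟨v, x⟩`. -/
theorem IsWeight.exists_eq_add {F : ℝ → ℝ → ℝ} {x : Plane} (hx : x ≠ 0)
    {w w' : (Fin 2 → ℤ) → ℝ} (hw : IsWeight F x w) (hw' : IsWeight F x w') :
    ∃ l : ℝ, ∀ v, IsPrimitive v → w v = w' v + l * (toPlane v ⬝ᵥ x) := by
  have hx' : x 0 ≠ 0 ∨ x 1 ≠ 0 := by
    by_contra! h
    apply hx
    ext i
    fin_cases i
    · exact h.1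
    · exact h.2
  have hdot : ∀ v : Fin 2 → ℤ, toPlane v ⬝ᵥ x = v 0 * x 0 + v 1 * x 1 := by
    intro v
    rw [dotProduct_plane]
    rfl
  have hD : ∀ v v', cross v v' = 1 →
      (w v - w' v) * (toPlane v' ⬝ᵥ x) = (w v' - w' v') * (toPlane v ⬝ᵥ x) := by
    intro v v' h
    have h1 := hw.basis v v' (by rw [h]; exact isUnit_one)
    have h2 := hw'.basis v v' (by rw [h]; exact isUnit_one)
    linarith
  obtain ⟨l, hl0, hl1⟩ : ∃ l : ℝ, w ![1, 0] - w' ![1, 0] = l * x 0 ∧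
      w ![0, 1] - w' ![0, 1] = l * x 1 := by
    have h := hD ![1, 0] ![0, 1] (by simp [cross])
    rw [hdot, hdot] at h
    simp at h
    rcases hx' with h0 | h0
    · exact ⟨(w ![1, 0] - w' ![1, 0]) / x 0, by field_simp, by field_simp; linarith⟩
    · exact ⟨(w ![0, 1] - w' ![0, 1]) / x 1, by field_simp; linarith, by field_simp⟩
  -- With `l` fitted on the two unit vectors, `G` satisfies the homogeneous basis relation and
  -- vanishes on the standard basis; the vanishing is carried to all primitive vectors.
  set G : (Fin 2 → ℤ) → ℝ := fun v => w v - w' v - l * (toPlane v ⬝ᵥ x) with hG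
  have hGodd : ∀ v, G (-v) = -G v := by
    intro v
    simp only [hG, hw.odd, hw'.odd, toPlane_neg, neg_dotProduct]
    ring
  have hGrel : ∀ v v', cross v v' = 1 → G v * (toPlane v' ⬝ᵥ x) = G v' * (toPlane v ⬝ᵥ x) := by
    intro v v' h
    have := hD v v' h
    simp only [hG]
    linarith
  have hspan : ∀ v v', cross v v' = 1 → toPlane v ⬝ᵥ x ≠ 0 ∨ toPlane v' ⬝ᵥ x ≠ 0 := by
    intro v v' h
    by_contra! hno
    obtain ⟨h1, h2⟩ := hno
    rw [hdot] at h1 h2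
    have hc : (v 0 : ℝ) * v' 1 - v 1 * v' 0 = 1 := by
      rw [cross] at h
      exact_mod_cast h
    have e0 : x 0 = 0 := by linear_combination (-x 0) * hc + v' 1 * h1 - v 1 * h2
    have e1 : x 1 = 0 := by linear_combination (-x 1) * hc - v' 0 * h1 + v 0 * h2
    rcases hx' with h | h <;> contradiction
  -- If `u` forms a basis with each of `v` and `v'`, then `G u` is annihilated by both `⟨v, x⟩` and
  -- `⟨v', x⟩`, and these are not both zero.
  have hstep : ∀ v v' u, cross v v' = 1 → G v = 0 → G v' = 0 →
      (cross u v = 1 ∨ cross v u = 1) → (cross u v' = 1 ∨ cross v' u = 1) → G u = 0 := by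
    intro v v' u hc h1 h2 h3 h4
    have k1 : G u * (toPlane v ⬝ᵥ x) = 0 := by
      rcases h3 with h | h
      · rw [hGrel _ _ h, h1, zero_mul]
      · rw [← hGrel _ _ h, h1, zero_mul]
    have k2 : G u * (toPlane v' ⬝ᵥ x) = 0 := by
      rcases h4 with h | h
      · rw [hGrel _ _ h, h2, zero_mul]
      · rw [← hGrel _ _ h, h2, zero_mul]
    rcases hspan v v' hc with h | h
    · exact (mul_eq_zero.1 k1).resolve_right h
    · exact (mul_eq_zero.1 k2).resolve_right h
  have hSL : ∀ M : Matrix.SpecialLinearGroup (Fin 2) ℤ, G (slRow M 0) = 0 ∧ G (slRow M 1) = 0 := by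
    intro M
    have hM : M ∈ Subgroup.closure {ModularGroup.S, ModularGroup.T} := by
      rw [SpecialLinearGroup.SL2Z_generators]
      trivial
    induction hM using Subgroup.closure_induction_left with
    | one =>
      have e0 : slRow 1 0 = ![1, 0] := by
        ext i; fin_cases i <;> simp [slRow]
      have e1 : slRow 1 1 = ![0, 1] := by
        ext i; fin_cases i <;> simp [slRow]
      rw [e0, e1]
      simp only [hG, hdot, Matrix.cons_val_zero, Matrix.cons_val_one, hl0, hl1]
      simp
    | mul_left A hA M hM ih =>
      rcases hA with rfl | rfl
      · rw [(slRow_S_mul M).1, (slRow_S_mul M).2, hGodd, ih.1, ih.2]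
        simp
      · rw [(slRow_T_mul M).1, (slRow_T_mul M).2]
        have hc := cross_slRow M
        refine ⟨hstep _ _ _ hc ih.1 ih.2 (Or.inr ?_) (Or.inl ?_), ih.2⟩
        · simp only [cross, Pi.add_apply] at hc ⊢
          linarith
        · simp only [cross, Pi.add_apply] at hc ⊢
          linarith
    | inv_mul_cancel A hA M hM ih =>
      obtain ⟨N, rfl⟩ : ∃ N, M = A * N := ⟨A⁻¹ * M, by simp⟩
      rw [inv_mul_cancel_left]
      rcases hA with rfl | rfl
      · rw [(slRow_S_mul N).1, (slRow_S_mul N).2, hGodd] at ih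
        exact ⟨ih.2, by linarith [ih.1]⟩
      · have hc := cross_slRow (ModularGroup.T * N)
        rw [(slRow_T_mul N).1, (slRow_T_mul N).2] at ih hc
        refine ⟨hstep _ _ _ hc ih.1 ih.2 (Or.inl ?_) (Or.inl ?_), ih.2⟩
        · simp only [cross, Pi.add_apply] at hc ⊢
          linarith
        · simp only [cross, Pi.add_apply] at hc ⊢
          linarith
  refine ⟨l, fun v hv => ?_⟩
  obtain ⟨v', hv'⟩ : ∃ v', cross v v' = 1 := by
    obtain ⟨v', h⟩ := hv
    rcases Int.isUnit_iff.1 h with h | h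
    · exact ⟨v', h⟩
    · refine ⟨-v', ?_⟩
      have e3 : cross v (-v') = -cross v v' := by simp [cross]; ring
      rw [e3, h, neg_neg]
  have hdet : Matrix.det (Matrix.of ![v, v']) = 1 := by
    rw [Matrix.det_fin_two]
    exact hv'
  have h2 : G v = 0 := (hSL ⟨Matrix.of ![v, v'], hdet⟩).1
  simp only [hG] at h2
  linarith

end ExpVal

namespace ExpVal

open MeasureTheory

/-! ### The function `φ(t) = (e^t - 1)/t` -/

theorem phi_mul_self (t : ℝ) : phi t * t = Real.exp t - 1 := by
  rw [phi]
  split_ifs with h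
  · simp [h]
  · field_simp

theorem phi_pos (t : ℝ) : 0 < phi t := by
  rcases lt_trichotomy t 0 with h | h | h
  · have h1 := phi_mul_self t
    have h2 : Real.exp t < 1 := by simpa using Real.exp_lt_exp.2 h
    by_contra! h3
    nlinarith
  · simp [phi, h]
  · have h1 := phi_mul_self t
    have h2 : 1 < Real.exp t := Real.one_lt_exp_iff.2 h
    by_contra! h3
    nlinarith

theorem phi_neg (t : ℝ) : phi (-t) = Real.exp (-t) * phi t := by
  by_cases h : t = 0
  · simp [h]
  · have h1 := phi_mul_self t
    have h2 := phi_mul_self (-t)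
    have h3 : Real.exp (-t) * Real.exp t = 1 := by
      rw [← Real.exp_add]
      simp
    apply mul_right_cancel₀ h
    linear_combination -h2 - Real.exp (-t) * h1 - h3

theorem measurable_phi : Measurable phi := by
  unfold phi
  exact Measurable.ite (measurableSet_singleton 0) measurable_const (by fun_prop)

/-! ### The valuation of a symbol -/

/-- The contribution of an edge: the integral of `e^⟨x, ·⟩` over the edge times its weight. -/
noncomputable def edgeCoeff (x : Plane) (w : (Fin 2 → ℤ) → ℝ) (e : (Fin 2 → ℤ) × (Fin 2 → ℤ)) : ℝ :=
  Real.exp (toPlane e.1 ⬝ᵥ x) * phi (toPlane e.2 ⬝ᵥ x) * w e.2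

/-- The integral over a segment does not depend on its direction, which is the content of `phi_neg`;
only the odd weight changes sign. -/
theorem edgeCoeff_reverse {x : Plane} {w : (Fin 2 → ℤ) → ℝ} (hw : ∀ v, w (-v) = -w v)
    (e : (Fin 2 → ℤ) × (Fin 2 → ℤ)) : edgeCoeff x w (reverseEdge e) = -edgeCoeff x w e := by
  simp only [edgeCoeff, reverseEdge, Equiv.coe_fn_mk, hw, toPlane_add, toPlane_neg, add_dotProduct,
    neg_dotProduct, phi_neg, Real.exp_add]
  have h3 : Real.exp (toPlane e.2 ⬝ᵥ x) * Real.exp (-(toPlane e.2 ⬝ᵥ x)) = 1 := by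
    rw [← Real.exp_add]
    simp
  linear_combination (-Real.exp (toPlane e.1 ⬝ᵥ x) * phi (toPlane e.2 ⬝ᵥ x) * w e.2) * h3

theorem edgeCoeff_translate (x : Plane) (w : (Fin 2 → ℤ) → ℝ) (z : Fin 2 → ℤ)
    (e : (Fin 2 → ℤ) × (Fin 2 → ℤ)) :
    edgeCoeff x w (e.1 + z, e.2) = Real.exp (toPlane z ⬝ᵥ x) * edgeCoeff x w e := by
  simp only [edgeCoeff, toPlane_add, add_dotProduct, Real.exp_add]
  ring

theorem toPlane_latticeEquiv_dotProduct (Φ : Matrix.GeneralLinearGroup (Fin 2) ℤ)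
    (z : Fin 2 → ℤ) (x : Plane) :
    toPlane (latticeEquiv Φ z) ⬝ᵥ x = toPlane z ⬝ᵥ glMapTranspose Φ x := by
  rw [toPlane_latticeEquiv, dotProduct_plane, dotProduct_plane, glMap_apply_zero, glMap_apply_one,
    glMapTranspose_apply_zero, glMapTranspose_apply_one]
  ring

theorem edgeSum_edgeCoeff_image {x : Plane} {w : (Fin 2 → ℤ) → ℝ} (hw : ∀ v, w (-v) = -w v)
    (P : LatticePolytope) (Φ : Matrix.GeneralLinearGroup (Fin 2) ℤ) :
    edgeSum (edgeCoeff x w) (P.image Φ) =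
      edgeSum (edgeCoeff (glMapTranspose Φ x) fun v => detZ Φ * w (latticeEquiv Φ v)) P := by
  rw [edgeSum_image (edgeCoeff_reverse hw)]
  congr 1
  funext e
  simp only [edgeCoeff, toPlane_latticeEquiv_dotProduct]
  ring

theorem edgeSum_edgeCoeff_translate (x : Plane) (w : (Fin 2 → ℤ) → ℝ) (P : LatticePolytope)
    (z : Fin 2 → ℤ) : edgeSum (edgeCoeff x w) (P.translate z) =
      Real.exp (toPlane z ⬝ᵥ x) * edgeSum (edgeCoeff x w) P := by
  rw [edgeSum_translate, ← edgeSum_mul]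
  simp only [edgeCoeff_translate]

theorem edgeSum_edgeCoeff_stdTriangle {x : Plane} {w : (Fin 2 → ℤ) → ℝ}
    (hw : ∀ v, w (-v) = -w v) :
    edgeSum (edgeCoeff x w) stdTriangle = phi (x 0) * w ![1, 0] +
      Real.exp (x 0) * phi (x 1 - x 0) * w ![-1, 1] - phi (x 1) * w ![0, 1] := by
  have e1 : (![0, -1] : Fin 2 → ℤ) = -![0, 1] := by
    ext i; fin_cases i <;> simp
  have h3 : Real.exp (x 1) * Real.exp (-(x 1)) = 1 := by
    rw [← Real.exp_add]
    simp
  rw [edgeSum_stdTriangle]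
  simp only [edgeCoeff, e1, hw]
  simp only [dotProduct_plane, toPlane, Matrix.cons_val_zero, Matrix.cons_val_one, Pi.neg_apply]
  simp only [Int.cast_zero, zero_mul, add_zero, Real.exp_zero, Int.cast_one, one_mul, zero_add,
    Int.cast_neg, neg_mul, neg_zero, phi_neg]
  rw [show -x 0 + x 1 = x 1 - x 0 by ring]
  linear_combination (-phi (x 1) * w ![0, 1]) * h3

/-- The weights `⟨v, x⟩` do not contribute. -/
theorem edgeSum_edgeCoeff_linear (x : Plane) (l : ℝ) (P : LatticePolytope) :
    edgeSum (edgeCoeff x fun v => l * (toPlane v ⬝ᵥ x)) P = 0 := by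
  have hodd : ∀ (x y : Plane) (v : Fin 2 → ℤ), l * (toPlane (-v) ⬝ᵥ x) = -(l * (toPlane v ⬝ᵥ x)) := by
    intro x _ v
    rw [toPlane_neg, neg_dotProduct]
    ring
  -- Each edge contributes `l` times the difference of `e^⟨x, ·⟩` at its endpoints, and this
  -- telescopes around the boundary. Formally it is enough to check `T`, by `valuation_mem` with the
  -- trivial group.
  have key := valuation_mem
    (Z := fun P x => edgeSum (edgeCoeff x fun v => l * (toPlane v ⬝ᵥ x)) P) ⊥
    (fun P Q U I hc hU hI => funext fun x => edgeSum_valuation _ P Q U I hc hU hI)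
    (fun P hP => funext fun x => edgeSum_simple (edgeCoeff_reverse (hodd x x)) hP)
    (by
      intro Φ z
      rw [AddSubgroup.mem_bot]
      funext x
      rw [edgeSum_edgeCoeff_translate, edgeSum_edgeCoeff_image (hodd x x)]
      have e : (fun v => (detZ Φ : ℝ) * (l * (toPlane (latticeEquiv Φ v) ⬝ᵥ x))) =
          fun v => detZ Φ * (l * (toPlane v ⬝ᵥ glMapTranspose Φ x)) := by
        simp only [toPlane_latticeEquiv_dotProduct]
      rw [e, edgeSum_edgeCoeff_stdTriangle (fun v => by rw [hodd _ x]; ring)]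
      set y := glMapTranspose Φ x
      generalize Real.exp (toPlane z ⬝ᵥ x) = E
      simp only [dotProduct_plane, toPlane, Matrix.cons_val_zero, Matrix.cons_val_one]
      have h1 := phi_mul_self (y 0)
      have h2 := phi_mul_self (y 1)
      have h3 := phi_mul_self (y 1 - y 0)
      have h4 : Real.exp (y 0) * Real.exp (y 1 - y 0) = Real.exp (y 1) := by
        rw [← Real.exp_add]
        congr 1
        ring
      simp only [Int.cast_zero, Int.cast_one, Int.cast_neg, Pi.zero_apply]
      have : phi (y 0) * y 0 + Real.exp (y 0) * phi (y 1 - y 0) * (y 1 - y 0) - phi (y 1) * y 1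
          = 0 := by
        linear_combination h1 - h2 + Real.exp (y 0) * h3 + h4
      linear_combination E * detZ Φ * l * this)
    P
  rw [AddSubgroup.mem_bot] at key
  exact congrFun key x

theorem edgeSum_congr {c c' : (Fin 2 → ℤ) × (Fin 2 → ℤ) → ℝ} (P : LatticePolytope)
    (h : ∀ e, IsPrimitive e.2 → c e = c' e) : edgeSum c P = edgeSum c' P :=
  finsum_mem_congr rfl fun e he => h e he.1

/-- Makes the arbitrary choice of a weight in `weightOf` harmless: two weights differ by a linear
form, which contributes nothing. -/
theorem edgeSum_edgeCoeff_eq {F : ℝ → ℝ → ℝ} {x : Plane} (hx : x ≠ 0) {w w' : (Fin 2 → ℤ) → ℝ}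
    (hw : IsWeight F x w) (hw' : IsWeight F x w') (P : LatticePolytope) :
    edgeSum (edgeCoeff x w) P = edgeSum (edgeCoeff x w') P := by
  obtain ⟨l, hl⟩ := hw.exists_eq_add hx hw'
  have : edgeSum (edgeCoeff x w) P =
      edgeSum (fun e => edgeCoeff x w' e + edgeCoeff x (fun v => l * (toPlane v ⬝ᵥ x)) e) P := by
    apply edgeSum_congr
    intro e he
    simp only [edgeCoeff, hl e.2 he]
    ring
  rw [this, edgeSum_add, edgeSum_edgeCoeff_linear, add_zero]

theorem isWeight_image {F : ℝ → ℝ → ℝ} {x : Plane} {w : (Fin 2 → ℤ) → ℝ} (hw : IsWeight F x w)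
    (Φ : Matrix.GeneralLinearGroup (Fin 2) ℤ) :
    IsWeight F (glMapTranspose Φ x) fun v => detZ Φ * w (latticeEquiv Φ v) where
  odd v := by
    rw [latticeEquiv_neg, hw.odd]
    ring
  basis v v' h := by
    have hd : (detZ Φ : ℝ) * detZ Φ = 1 := by
      rcases detZ_eq Φ with h | h <;> simp [h]
    have := hw.basis (latticeEquiv Φ v) (latticeEquiv Φ v') (by
      rw [cross_latticeEquiv]
      exact (Int.isUnit_iff.2 (detZ_eq Φ)).mul h)
    rw [cross_latticeEquiv] at this
    simp only [toPlane_latticeEquiv_dotProduct] at this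
    push_cast at this
    linear_combination (detZ Φ : ℝ) * this +
      (cross v v') * F (toPlane v ⬝ᵥ glMapTranspose Φ x) (toPlane v' ⬝ᵥ glMapTranspose Φ x) * hd

/-! ### Area, and the valuation built from a symbol -/

theorem measureReal_image_glMap (Φ : Matrix.GeneralLinearGroup (Fin 2) ℤ) (s : Set Plane) :
    volume.real (glMap Φ '' s) = volume.real s := by
  have hdet : |LinearMap.det (glMap Φ)| = 1 := by
    have : LinearMap.det (glMap Φ) = detZ Φ := by
      rw [glMap, ← Matrix.toLin'_apply', LinearMap.det_toLin', Matrix.det_fin_two]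
      simp [detZ]
    rw [this]
    rcases detZ_eq Φ with h | h <;> simp [h]
  rw [measureReal_def, Measure.addHaar_image_linearMap, hdet]
  simp [measureReal_def]

theorem measureReal_eq_zero_of_finrank_le_one {s : Set Plane}
    (h : Module.finrank ℝ (vectorSpan ℝ s) ≤ 1) : volume.real s = 0 := by
  have hne : affineSpan ℝ s ≠ ⊤ := by
    intro htop
    have h1 : vectorSpan ℝ s = ⊤ := by
      rw [← direction_affineSpan, htop, AffineSubspace.direction_top]
    rw [h1, finrank_top, Module.finrank_fin_fun] at h
    omega
  rw [measureReal_def, measure_mono_null (subset_affineSpan ℝ s)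
    (Measure.addHaar_affineSubspace volume _ hne)]
  rfl

theorem measureReal_stdTriangle_pos : 0 < volume.real stdTriangle.1 := by
  have hfin : volume stdTriangle.1 ≠ ⊤ := (isCompact_latticePolytope _).measure_lt_top.ne
  rw [measureReal_def, ENNReal.toReal_pos_iff]
  refine ⟨?_, lt_top_iff_ne_top.2 hfin⟩
  have hopen : IsOpen {p : Plane | 0 < p 0 ∧ 0 < p 1 ∧ p 0 + p 1 < 1} := by
    have c0 : Continuous fun p : Plane => p 0 := continuous_apply 0
    have c1 : Continuous fun p : Plane => p 1 := continuous_apply 1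
    exact (isOpen_lt continuous_const c0).inter
      ((isOpen_lt continuous_const c1).inter (isOpen_lt (c0.add c1) continuous_const))
  have hne : {p : Plane | 0 < p 0 ∧ 0 < p 1 ∧ p 0 + p 1 < 1}.Nonempty := by
    refine ⟨![1 / 4, 1 / 4], ?_, ?_, ?_⟩ <;> norm_num
  refine (hopen.measure_pos volume hne).trans_le (measure_mono ?_)
  rintro p ⟨h1, h2, h3⟩
  exact mem_stdTriangle.2 ⟨h1.le, h2.le, h3.le⟩

/-- A weight for `-F` at `x`. -/
noncomputable def weightOf (F : ℝ → ℝ → ℝ) (x : Plane) : (Fin 2 → ℤ) → ℝ := by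
  classical
  exact if h : ∃ w, IsWeight (fun p q => -F p q) x w then h.choose else 0

theorem isWeight_weightOf {F : ℝ → ℝ → ℝ} (hF : IsSymbol F) {x : Plane} (hx : x ≠ 0) :
    IsWeight (fun p q => -F p q) x (weightOf F x) := by
  have h := exists_isWeight hF.neg hx
  rw [weightOf, dif_pos h]
  exact h.choose_spec

open Classical in
/-- The valuation defined by a symbol `F`. At the origin it is a multiple of the area. -/
noncomputable def symbolValuation (F : ℝ → ℝ → ℝ) (P : LatticePolytope) (x : Plane) : ℝ :=
  -- At the origin every weight relation reads `0 = ± F 0 0`, so weights would require `F 0 0 = 0`.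
  -- The area, normalized to one on `T`, allows an arbitrary value there.
  if x = 0 then F 0 0 * (volume.real P.1 / volume.real stdTriangle.1)
  else edgeSum (edgeCoeff x (weightOf F x)) P

section

variable {F : ℝ → ℝ → ℝ}

theorem symbolValuation_isValuation : IsValuation (symbolValuation F) := by
  intro P Q U I hc hU hI
  funext x
  simp only [Pi.add_apply, symbolValuation]
  split_ifs with hx
  · have h := measureReal_union_add_inter (μ := volume) (s := P.1)
      (isCompact_latticePolytope Q).isClosed.measurableSet
      (isCompact_latticePolytope P).measure_lt_top.ne (isCompact_latticePolytope Q).measure_lt_top.ne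
    rw [hU, hI, ← mul_add, ← mul_add, ← add_div, ← add_div, h]
  · exact edgeSum_valuation _ P Q U I hc hU hI

theorem symbolValuation_isSimple (hF : IsSymbol F) : IsSimple (symbolValuation F) := by
  intro P hP
  funext x
  simp only [symbolValuation]
  split_ifs with hx
  · rw [measureReal_eq_zero_of_finrank_le_one hP]
    simp
  · exact edgeSum_simple (edgeCoeff_reverse (isWeight_weightOf hF hx).odd) hP

theorem symbolValuation_isTranslativelyExponential :
    IsTranslativelyExponential (symbolValuation F) := by
  intro P z x
  simp only [symbolValuation]
  split_ifs with hx
  · have : volume.real (P.translate z).1 = volume.real P.1 := by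
      rw [measureReal_def, measureReal_def, LatticePolytope.translate]
      simp
    rw [this, hx]
    simp
  · exact edgeSum_edgeCoeff_translate _ _ _ _

theorem glMapTranspose_eq_zero_iff (Φ : Matrix.GeneralLinearGroup (Fin 2) ℤ) (x : Plane) :
    glMapTranspose Φ x = 0 ↔ x = 0 := by
  refine ⟨fun h => ?_, fun h => by rw [h, map_zero]⟩
  have hd : (detZ Φ : ℝ) * detZ Φ = 1 := by
    rcases detZ_eq Φ with h | h <;> simp [h]
  have h0 := congrFun h 0
  have h1 := congrFun h 1
  rw [glMapTranspose_apply_zero, Pi.zero_apply] at h0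
  rw [glMapTranspose_apply_one, Pi.zero_apply] at h1
  have hd' : (detZ Φ : ℝ) = Φ 0 0 * Φ 1 1 - Φ 0 1 * Φ 1 0 := by simp [detZ]
  have e0 : (detZ Φ : ℝ) * x 0 = 0 := by
    rw [hd']
    linear_combination (Φ 1 1 : ℝ) * h0 - (Φ 1 0 : ℝ) * h1
  have e1 : (detZ Φ : ℝ) * x 1 = 0 := by
    rw [hd']
    linear_combination -(Φ 0 1 : ℝ) * h0 + (Φ 0 0 : ℝ) * h1
  ext i
  fin_cases i
  · simp only [Fin.zero_eta, Pi.zero_apply]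
    linear_combination (-x 0) * hd + detZ Φ * e0
  · simp only [Fin.mk_one, Pi.zero_apply]
    linear_combination (-x 1) * hd + detZ Φ * e1

/-- The weight chosen at `x`, transported by `Φ`, and the weight chosen at `Φᵀ x` belong to the same
symbol at the same point, so their edge sums agree. -/
theorem symbolValuation_isGLCovariant (hF : IsSymbol F) : IsGLCovariant (symbolValuation F) := by
  intro Φ P x
  simp only [symbolValuation, glMapTranspose_eq_zero_iff]
  split_ifs with hx
  · have : volume.real (P.image Φ).1 = volume.real P.1 := measureReal_image_glMap Φ P.1
    rw [this]
  · have hx' : glMapTranspose Φ x ≠ 0 := fun h => hx ((glMapTranspose_eq_zero_iff Φ x).1 h)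
    have hw := isWeight_weightOf hF hx
    rw [edgeSum_edgeCoeff_image hw.odd]
    exact edgeSum_edgeCoeff_eq hx' (isWeight_image hw Φ) (isWeight_weightOf hF hx') P

theorem symbolValuation_stdTriangle_zero : symbolValuation F stdTriangle 0 = F 0 0 := by
  rw [symbolValuation, if_pos rfl, div_self measureReal_stdTriangle_pos.ne', mul_one]

/-- The basis relations with `e₂` eliminate the weights of `e₁` and `(-1, 1)`; the remaining
coefficient of the weight of `e₂` telescopes to zero. The weights belong to `-F` so that the signs
come out as in (2). -/
theorem symbolValuation_stdTriangle (hF : IsSymbol F) {x : Plane} (hx : x ≠ 0) :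
    x 1 * symbolValuation F stdTriangle x =
      Real.exp (x 0) * phi (x 1 - x 0) * F (x 1 - x 0) (x 1) - phi (x 0) * F (x 0) (x 1) := by
  have hw := isWeight_weightOf hF hx
  rw [symbolValuation, if_neg hx, edgeSum_edgeCoeff_stdTriangle hw.odd]
  have b1 := hw.basis ![1, 0] ![0, 1] (by simp [cross])
  have b2 := hw.basis ![-1, 1] ![0, 1] (by simp [cross])
  simp only [dotProduct_plane, toPlane, cross, Matrix.cons_val_zero, Matrix.cons_val_one,
    Int.cast_zero, Int.cast_one, Int.cast_neg, zero_mul, one_mul, neg_mul, zero_add, add_zero,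
    mul_zero, sub_zero, mul_one] at b1 b2
  rw [show -x 0 + x 1 = x 1 - x 0 by ring] at b2
  have h1 := phi_mul_self (x 0)
  have h2 := phi_mul_self (x 1)
  have h3 := phi_mul_self (x 1 - x 0)
  have h4 : Real.exp (x 0) * Real.exp (x 1 - x 0) = Real.exp (x 1) := by
    rw [← Real.exp_add]
    congr 1
    ring
  linear_combination phi (x 0) * b1 + Real.exp (x 0) * phi (x 1 - x 0) * b2 +
    weightOf F x ![0, 1] * (h1 - h2 + Real.exp (x 0) * h3 + h4)

end

end ExpVal

namespace ExpVal

open MeasureTheory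

/-! ### Functions on the quadrant and symbols -/

open Classical in
/-- Extension of a function on `Ω` by zero. -/
noncomputable def extendZero {Ω : Set Plane} (f : Ω → ℝ) (p : Plane) : ℝ :=
  if h : p ∈ Ω then f ⟨p, h⟩ else 0

theorem extendZero_apply {Ω : Set Plane} (f : Ω → ℝ) (p : Ω) : extendZero f p = f p := by
  rw [extendZero, dif_pos p.2]

theorem extendZero_of_mem {Ω : Set Plane} (f : Ω → ℝ) {p : Plane} (h : p ∈ Ω) :
    extendZero f p = f ⟨p, h⟩ := dif_pos h

theorem isLebesgueMeasurable_iff {Ω : Set Plane} (hΩ : MeasurableSet Ω) (f : Ω → ℝ) :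
    IsLebesgueMeasurable f ↔ AEMeasurable (extendZero f) (volume : Measure Plane) := by
  have key : ∀ B, Subtype.val '' (f ⁻¹' B) = extendZero f ⁻¹' B ∩ Ω := by
    intro B
    ext p
    constructor
    · rintro ⟨q, hq, rfl⟩
      refine ⟨?_, q.2⟩
      rw [Set.mem_preimage, extendZero_apply]
      exact hq
    · rintro ⟨h1, h2⟩
      rw [Set.mem_preimage, extendZero_of_mem f h2] at h1
      exact ⟨⟨p, h2⟩, h1, rfl⟩
  constructor
  · intro h
    apply NullMeasurable.aemeasurable
    intro B hB
    have h1 := h B hB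
    rw [key] at h1
    have e : extendZero f ⁻¹' B = (extendZero f ⁻¹' B ∩ Ω) ∪ (extendZero f ⁻¹' B ∩ Ωᶜ) := by
      rw [← Set.inter_union_distrib_left, Set.union_compl_self, Set.inter_univ]
    rw [e]
    refine h1.union ?_
    by_cases h0 : (0 : ℝ) ∈ B
    · have : extendZero f ⁻¹' B ∩ Ωᶜ = Ωᶜ := by
        apply Set.inter_eq_right.2
        intro p hp
        rw [Set.mem_preimage, extendZero, dif_neg hp]
        exact h0
      rw [this]
      exact hΩ.compl.nullMeasurableSet
    · have : extendZero f ⁻¹' B ∩ Ωᶜ = ∅ := by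
        ext p
        simp only [Set.mem_inter_iff, Set.mem_preimage, Set.mem_compl_iff, Set.mem_empty_iff_false,
          iff_false, not_and]
        intro hp hpΩ
        rw [extendZero, dif_neg hpΩ] at hp
        exact h0 hp
      rw [this]
      exact nullMeasurableSet_empty
  · intro h B hB
    rw [key]
    exact (h.nullMeasurable hB).inter hΩ.nullMeasurableSet

theorem measurableSet_quadrant : MeasurableSet quadrant :=
  (measurableSet_le measurable_const (measurable_pi_apply 0)).inter
    (measurableSet_le measurable_const (measurable_pi_apply 1))

/-- The values of `ρ`, extended by zero. -/
noncomputable def quadrantValue (ρ : quadrant → ℝ) (x y : ℝ) : ℝ := extendZero ρ ![x, y]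

theorem quadrantValue_eq (ρ : quadrant → ℝ) {x y : ℝ} (hx : 0 ≤ x) (hy : 0 ≤ y) :
    ρ (quadrantMk x y hx hy) = quadrantValue ρ x y :=
  (extendZero_apply ρ (quadrantMk x y hx hy)).symm

theorem quadrant_ext {ρ ρ' : quadrant → ℝ}
    (h : ∀ x y, 0 ≤ x → 0 ≤ y → quadrantValue ρ x y = quadrantValue ρ' x y) : ρ = ρ' := by
  funext p
  obtain ⟨p, hp⟩ := p
  have e : p = ![p 0, p 1] := by
    ext i
    fin_cases i <;> rfl
  have h1 := h _ _ hp.1 hp.2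
  rw [quadrantValue, quadrantValue, ← e, extendZero_of_mem ρ hp, extendZero_of_mem ρ' hp] at h1
  exact h1

theorem rhoEquation_iff (ρ : quadrant → ℝ) : RhoEquation ρ ↔ ∀ x y, 0 ≤ x → 0 ≤ y →
    (2 * x + y) * quadrantValue ρ x y =
      (x + y) * quadrantValue ρ x (x + y) + x * quadrantValue ρ (x + y) x := by
  simp only [RhoEquation, quadrantValue_eq]

theorem triangleFormula_iff (f : Plane → ℝ) (ρ : quadrant → ℝ) :
    TriangleFormula f ρ ↔ ∀ x y, 0 ≤ x → x ≤ y → 0 < y → y * f ![x, y] =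
      Real.exp x * phi (y - x) * quadrantValue ρ (y - x) x -
        phi x * quadrantValue ρ x (y - x) := by
  simp only [TriangleFormula, quadrantValue_eq]
  refine forall_congr' fun x => forall_congr' fun y => forall_congr' fun _ => forall_congr' fun _ =>
    forall_congr' fun hy => ?_
  rw [← mul_right_inj' hy.ne']
  have : y * (Real.exp x / y * phi (y - x) * quadrantValue ρ (y - x) x -
      1 / y * phi x * quadrantValue ρ x (y - x)) =
      Real.exp x * phi (y - x) * quadrantValue ρ (y - x) x -
        phi x * quadrantValue ρ x (y - x) := by
    field_simp
  rw [this]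

/-- The symbol of `ρ`. -/
noncomputable def symbolOf (ρ : quadrant → ℝ) (p q : ℝ) : ℝ :=
  -- Sorting the absolute values builds in symmetry and evenness; for `0 ≤ p ≤ q` this inverts `ϱ(x,
  -- y) = F(x, x + y)`.
  quadrantValue ρ (min |p| |q|) (max |p| |q| - min |p| |q|)

theorem symbolOf_of_le (ρ : quadrant → ℝ) {p q : ℝ} (hp : 0 ≤ p) (hpq : p ≤ q) :
    symbolOf ρ p q = quadrantValue ρ p (q - p) := by
  rw [symbolOf, abs_of_nonneg hp, abs_of_nonneg (hp.trans hpq), min_eq_left hpq, max_eq_right hpq]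

/-- For `0 ≤ p ≤ q` the three-term relation is (1) at `(p, q - p)`. Its defect `E` satisfies `E(p,
q) = E(q, p)`, `E(-p, -q) = -E(p, q)` and `E(p, q) = -E(p + q, -q)`, which reduce every other case
to this one. -/
theorem isSymbol_symbolOf {ρ : quadrant → ℝ} (h : RhoEquation ρ) : IsSymbol (symbolOf ρ) := by
  rw [rhoEquation_iff] at h
  have hs : ∀ p q, symbolOf ρ p q = symbolOf ρ q p := by
    intro p q
    rw [symbolOf, symbolOf, min_comm, max_comm]
  have he : ∀ p q, symbolOf ρ (-p) q = symbolOf ρ p q := by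
    intro p q
    rw [symbolOf, symbolOf, abs_neg]
  have he' : ∀ p q, symbolOf ρ p (-q) = symbolOf ρ p q := by
    intro p q
    rw [hs, he, hs]
  set E : ℝ → ℝ → ℝ := fun p q => (p + q) * symbolOf ρ p q - (p * symbolOf ρ q (p + q) +
    q * symbolOf ρ p (p + q)) with hE
  have E1 : ∀ p q, 0 ≤ p → p ≤ q → E p q = 0 := by
    intro p q hp hpq
    have := h p (q - p) hp (by linarith)
    simp only [hE]
    rw [symbolOf_of_le ρ hp hpq, symbolOf_of_le ρ (hp.trans hpq) (by linarith),
      symbolOf_of_le ρ hp (by linarith), add_sub_cancel_right, add_sub_cancel_left]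
    rw [show p + (q - p) = q by ring] at this
    linarith
  have Es : ∀ p q, E p q = E q p := by
    intro p q
    simp only [hE]
    rw [hs p q, add_comm p q]
    ring
  have E2 : ∀ p q, 0 ≤ p → 0 ≤ q → E p q = 0 := by
    intro p q hp hq
    rcases le_total p q with h | h
    · exact E1 p q hp h
    · rw [Es, E1 q p hq h]
  have En : ∀ p q, E (-p) (-q) = -E p q := by
    intro p q
    simp only [hE]
    rw [show -p + -q = -(p + q) by ring]
    simp only [he, he']
    ring
  have Er : ∀ p q, E p q = -E (p + q) (-q) := by
    intro p q
    simp only [hE]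
    rw [show p + q + -q = p by ring]
    simp only [he, he']
    rw [hs q p, hs (p + q) q, hs (p + q) p]
    ring
  have E3 : ∀ p q, 0 ≤ p → E p q = 0 := by
    intro p q hp
    rcases le_total 0 q with hq | hq
    · exact E2 p q hp hq
    rcases le_total 0 (p + q) with hpq | hpq
    · rw [Er, E2 _ _ hpq (by linarith), neg_zero]
    · have : E p q = -E (-q) (-p) := by
        rw [En, Es, neg_neg]
      rw [this, Er, neg_neg, E2 _ _ (by linarith) (by linarith)]
  refine ⟨hs, he, fun p q => ?_⟩
  have : E p q = 0 := by
    rcases le_total 0 p with hp | hp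
    · exact E3 p q hp
    · have := En (-p) (-q)
      rw [neg_neg, neg_neg] at this
      rw [this, E3 _ _ (by linarith), neg_zero]
  simp only [hE] at this
  linarith

/-! ### Measurability -/

theorem quasiMeasurePreserving_of_matrix (A : Matrix (Fin 2) (Fin 2) ℝ) (hA : A.det ≠ 0) :
    Measure.QuasiMeasurePreserving (fun p : Plane => A.mulVec p) volume volume := by
  have := Measure.LinearMap.quasiMeasurePreserving (volume : Measure Plane) (Matrix.toLin' A)
    (by rwa [LinearMap.det_toLin'])
  exact this

/-- The map agrees piecewise with one of eight invertible linear maps, each of which pulls null sets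
back to null sets. -/
theorem quasiMeasurePreserving_abs_sort :
    Measure.QuasiMeasurePreserving
      (fun p : Plane => (![min |p 0| |p 1|, max |p 0| |p 1| - min |p 0| |p 1|] : Plane))
      volume volume := by
  have m0 : Measurable fun p : Plane => |p 0| := (measurable_pi_apply 0).abs
  have m1 : Measurable fun p : Plane => |p 1| := (measurable_pi_apply 1).abs
  refine ⟨?_, Measure.AbsolutelyContinuous.mk fun s hs h0 => ?_⟩
  · refine measurable_pi_lambda _ fun i => ?_
    fin_cases i
    · exact m0.min m1
    · exact (m0.max m1).sub (m0.min m1)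
  rw [Measure.map_apply ?_ hs]
  · have hsub : (fun p : Plane => (![min |p 0| |p 1|, max |p 0| |p 1| - min |p 0| |p 1|] : Plane)) ⁻¹' s
        ⊆ ⋃ a : ℤˣ, ⋃ b : ℤˣ,
          ((fun p : Plane => (!![((a : ℤ) : ℝ), 0; -((a : ℤ) : ℝ), ((b : ℤ) : ℝ)]).mulVec p) ⁻¹' s ∪
          (fun p : Plane => (!![0, ((b : ℤ) : ℝ); ((a : ℤ) : ℝ), -((b : ℤ) : ℝ)]).mulVec p) ⁻¹' s) := by
      intro p hp
      have habs : ∀ t : ℝ, ∃ a : ℤˣ, |t| = ((a : ℤ) : ℝ) * t := by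
        intro t
        rcases abs_cases t with ⟨h, -⟩ | ⟨h, -⟩
        · exact ⟨1, by simp [h]⟩
        · exact ⟨-1, by simp [h]⟩
      obtain ⟨a, ha⟩ := habs (p 0)
      obtain ⟨b, hb⟩ := habs (p 1)
      refine Set.mem_iUnion.2 ⟨a, Set.mem_iUnion.2 ⟨b, ?_⟩⟩
      rw [Set.mem_preimage] at hp
      rcases le_total |p 0| |p 1| with h | h
      · left
        rw [min_eq_left h, max_eq_right h, ha, hb] at hp
        have e : (!![((a : ℤ) : ℝ), 0; -((a : ℤ) : ℝ), ((b : ℤ) : ℝ)]).mulVec p =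
            ![((a : ℤ) : ℝ) * p 0, ((b : ℤ) : ℝ) * p 1 - ((a : ℤ) : ℝ) * p 0] := by
          simp [dotProduct, Fin.sum_univ_two]
          ring
        rw [Set.mem_preimage, e]
        exact hp
      · right
        rw [min_eq_right h, max_eq_left h, ha, hb] at hp
        have e : (!![0, ((b : ℤ) : ℝ); ((a : ℤ) : ℝ), -((b : ℤ) : ℝ)]).mulVec p =
            ![((b : ℤ) : ℝ) * p 1, ((a : ℤ) : ℝ) * p 0 - ((b : ℤ) : ℝ) * p 1] := by
          simp [dotProduct, Fin.sum_univ_two]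
          ring
        rw [Set.mem_preimage, e]
        exact hp
    refine measure_mono_null hsub (measure_iUnion_null fun a => measure_iUnion_null fun b =>
      measure_union_null ?_ ?_)
    · refine (quasiMeasurePreserving_of_matrix _ ?_).preimage_null h0
      rw [Matrix.det_fin_two_of]
      rcases Int.units_eq_one_or a with rfl | rfl <;> rcases Int.units_eq_one_or b with rfl | rfl <;>
        norm_num
    · refine (quasiMeasurePreserving_of_matrix _ ?_).preimage_null h0
      rw [Matrix.det_fin_two_of]
      rcases Int.units_eq_one_or a with rfl | rfl <;> rcases Int.units_eq_one_or b with rfl | rfl <;>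
        norm_num
  · refine measurable_pi_lambda _ fun i => ?_
    fin_cases i
    · exact m0.min m1
    · exact (m0.max m1).sub (m0.min m1)

theorem aemeasurable_symbolOf {ρ : quadrant → ℝ} (h : IsLebesgueMeasurable ρ) :
    AEMeasurable (fun p : Plane => symbolOf ρ (p 0) (p 1)) volume := by
  rw [isLebesgueMeasurable_iff measurableSet_quadrant] at h
  exact h.comp_quasiMeasurePreserving quasiMeasurePreserving_abs_sort

theorem ae_apply_one_ne_zero : ∀ᵐ p : Plane, p 1 ≠ 0 := by
  have h := Measure.addHaar_submodule (volume : Measure Plane)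
    (LinearMap.ker (LinearMap.proj 1 : Plane →ₗ[ℝ] ℝ)) (by
      intro htop
      have : (![0, 1] : Plane) ∈ LinearMap.ker (LinearMap.proj 1 : Plane →ₗ[ℝ] ℝ) := by
        rw [htop]
        trivial
      simp at this)
  rw [ae_iff]
  convert h using 2
  ext p
  simp

/-- The weights are chosen pointwise and need not depend measurably on `x`, but on `T` they drop
out: off the null line `x 1 = 0` the value is an explicit expression in `F`. -/
theorem aemeasurable_symbolValuation_stdTriangle {F : ℝ → ℝ → ℝ} (hF : IsSymbol F)
    (hm : AEMeasurable (fun p : Plane => F (p 0) (p 1)) volume) :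
    AEMeasurable (symbolValuation F stdTriangle) volume := by
  have hm' : AEMeasurable (fun p : Plane => F (p 1 - p 0) (p 1)) volume := by
    have := hm.comp_quasiMeasurePreserving
      (quasiMeasurePreserving_of_matrix !![-1, 1; 0, 1] (by simp [Matrix.det_fin_two_of]))
    convert this using 1
    funext p
    simp only [Function.comp]
    congr 1
    · simp [Matrix.vecHead, Matrix.vecTail]
      ring
    · simp [Matrix.vecHead, Matrix.vecTail]
  have m0 : Measurable fun p : Plane => p 0 := measurable_pi_apply 0
  have m1 : Measurable fun p : Plane => p 1 := measurable_pi_apply 1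
  have hG : AEMeasurable (fun p : Plane => (Real.exp (p 0) * phi (p 1 - p 0) * F (p 1 - p 0) (p 1)
      - phi (p 0) * F (p 0) (p 1)) / p 1) volume := by
    refine AEMeasurable.div (AEMeasurable.sub ?_ ?_) m1.aemeasurable
    · exact ((Real.measurable_exp.comp m0).mul (measurable_phi.comp (m1.sub m0))).aemeasurable.mul hm'
    · exact (measurable_phi.comp m0).aemeasurable.mul hm
  refine hG.congr ?_
  filter_upwards [ae_apply_one_ne_zero] with p hp
  have hp0 : p ≠ 0 := by
    rintro rfl
    exact hp rfl
  rw [← symbolValuation_stdTriangle hF hp0]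
  field_simp

theorem isSimpleExpValuation_symbolValuation {F : ℝ → ℝ → ℝ} (hF : IsSymbol F)
    (hm : AEMeasurable (fun p : Plane => F (p 0) (p 1)) volume) :
    IsSimpleExpValuation (symbolValuation F) where
  measurable P := by
    -- Measurable functions form a group, so `valuation_mem` leaves only images and translates of
    -- `T` to be checked.
    let M : AddSubgroup (Plane → ℝ) :=
      { carrier := {f | AEMeasurable f volume}
        add_mem' := fun ha hb => AEMeasurable.add ha hb
        zero_mem' := (measurable_const (a := (0 : ℝ))).aemeasurable
        neg_mem' := fun ha => AEMeasurable.neg ha }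
    have hP : symbolValuation F P ∈ M := by
      refine valuation_mem M symbolValuation_isValuation (symbolValuation_isSimple hF) ?_ P
      intro Φ z
      change AEMeasurable _ volume
      have e : symbolValuation F ((stdTriangle.image Φ).translate z) = fun x =>
          Real.exp (toPlane z ⬝ᵥ x) * symbolValuation F stdTriangle (glMapTranspose Φ x) := by
        funext x
        rw [symbolValuation_isTranslativelyExponential, symbolValuation_isGLCovariant hF]
      rw [e]
      refine AEMeasurable.mul ?_ ?_
      · have : Continuous fun x : Plane => toPlane z ⬝ᵥ x := by
          simp only [dotProduct_plane]
          exact (continuous_const.mul (continuous_apply 0)).add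
            (continuous_const.mul (continuous_apply 1))
        exact (Real.continuous_exp.comp this).aemeasurable
      · refine (aemeasurable_symbolValuation_stdTriangle hF hm).comp_quasiMeasurePreserving ?_
        apply quasiMeasurePreserving_of_matrix
        rw [Matrix.det_transpose, Matrix.det_fin_two]
        have : (detZ Φ : ℝ) ≠ 0 := by
          rcases detZ_eq Φ with h | h <;> simp [h]
        simpa [detZ] using this
    exact AEMeasurable.nullMeasurable hP
  valuation := symbolValuation_isValuation
  simple := symbolValuation_isSimple hF
  translativelyExponential := symbolValuation_isTranslativelyExponential
  glCovariant := symbolValuation_isGLCovariant hF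

end ExpVal

namespace ExpVal

open MeasureTheory Filter Real

/-! ### The subtractive Euclidean algorithm -/

/-- The subtractive Euclidean algorithm `(x, y) ↦ (y, x - y)` leaves `{0 < y < x}` after at most
`n` steps. -/
def EuclidExits : ℕ → ℝ → ℝ → Prop
  | 0, x, y => ¬(0 < y ∧ y < x)
  | n + 1, x, y => 0 < y ∧ y < x → EuclidExits n y (x - y)

/-- The form `x - τ y` is an eigenvector of the Euclidean step with eigenvalue `-τ`, so it grows
geometrically, while the first coordinate decreases and dominates it on `{0 < y < x}`. Hence only
the golden ray is never left. -/
theorem golden_mul_le_of_not_euclidExits : ∀ (n : ℕ) (x y : ℝ), ¬EuclidExits n x y →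
    goldenRatio ^ n * |x - goldenRatio * y| ≤ 2 * x := by
  intro n
  induction n with
  | zero =>
    intro x y h
    obtain ⟨h1, h2⟩ := not_not.1 h
    have := goldenRatio_lt_two
    have h3 := goldenRatio_pos
    rw [pow_zero, one_mul, abs_le]
    constructor <;> nlinarith
  | succ n ih =>
    intro x y h
    rw [EuclidExits, Classical.not_imp] at h
    obtain ⟨⟨h1, h2⟩, h3⟩ := h
    have := ih _ _ h3
    have e : y - goldenRatio * (x - y) = -goldenRatio * (x - goldenRatio * y) := by
      linear_combination (-y) * goldenRatio_sq
    rw [e, abs_mul, abs_neg, abs_of_pos goldenRatio_pos, ← mul_assoc, ← pow_succ] at this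
    linarith

theorem exists_euclidExits {x y : ℝ} (h : x ≠ goldenRatio * y) : ∃ n, EuclidExits n x y := by
  by_contra! hn
  have hd : 0 < |x - goldenRatio * y| := abs_pos.2 (sub_ne_zero.2 h)
  obtain ⟨n, hlt⟩ := pow_unbounded_of_one_lt (2 * x / |x - goldenRatio * y|) one_lt_goldenRatio
  rw [div_lt_iff₀ hd] at hlt
  exact absurd (golden_mul_le_of_not_euclidExits n x y (hn n)) (not_le.2 hlt)

theorem EuclidExits.succ : ∀ {n : ℕ} {x y : ℝ}, EuclidExits n x y → EuclidExits (n + 1) x y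
  | 0, _, _, h => fun h' => absurd h' h
  | _ + 1, _, _, h => fun h' => (h h').succ

theorem EuclidExits.mono {n m : ℕ} (hnm : n ≤ m) {x y : ℝ} (h : EuclidExits n x y) :
    EuclidExits m x y := by
  induction hnm with
  | refl => exact h
  | step _ ih => exact ih.succ

/-! ### Solutions of the functional equation -/

/-- Applying (1) at `(y, x - y)` isolates the value at `(x, y)` and makes (1) a recursion along the
Euclidean step. The boundary `y = 0` forces `ϱ(x, 0) = ϱ(x, x)`, and `x = 0` gives no condition. -/
theorem rhoEquation_iff_euclid (ρ : quadrant → ℝ) : RhoEquation ρ ↔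
    (∀ x, 0 < x → quadrantValue ρ x 0 = quadrantValue ρ x x) ∧
    (∀ x y, 0 < y → y < x → y * quadrantValue ρ x y =
      (x + y) * quadrantValue ρ y (x - y) - x * quadrantValue ρ y x) := by
  rw [rhoEquation_iff]
  constructor
  · intro h
    refine ⟨fun x hx => ?_, fun x y hy hxy => ?_⟩
    · have := h x 0 hx.le le_rfl
      rw [add_zero, add_zero] at this
      have h2 : 2 * x * quadrantValue ρ x 0 = 2 * x * quadrantValue ρ x x := by linarith
      exact mul_left_cancel₀ (by positivity) h2
    · have := h y (x - y) hy.le (by linarith)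
      rw [show y + (x - y) = x by ring] at this
      linear_combination -this
  · rintro ⟨h1, h2⟩ x y hx hy
    rcases hx.eq_or_lt with rfl | hx
    · simp
    rcases hy.eq_or_lt with rfl | hy
    · rw [h1 x hx, add_zero, add_zero]
      ring
    · have := h2 (x + y) x hx (by linarith)
      rw [add_sub_cancel_left] at this
      linear_combination -this

/-- The interval `[1, τ)` is a fundamental domain for multiplication by `τ` on the positive reals.
-/
theorem eq_zero_of_golden_scaling {k : ℝ → ℝ}
    (h : ∀ s, 0 < s → k (goldenRatio * s) = goldenRatio ^ 2 * k s)
    (h0 : ∀ s, 1 ≤ s → s < goldenRatio → k s = 0) {s : ℝ} (hs : 0 < s) : k s = 0 := by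
  have hτ := goldenRatio_pos
  have key : ∀ n : ℤ, ∀ s ∈ Set.Ico (goldenRatio ^ n) (goldenRatio ^ (n + 1)), k s = 0 := by
    intro n
    induction n using Int.induction_on with
    | zero =>
      intro s hs
      rw [zpow_zero, zero_add, zpow_one] at hs
      exact h0 s hs.1 hs.2
    | succ n ih =>
      intro s hs
      have hpos : 0 < s := (zpow_pos hτ _).trans_le hs.1
      rw [zpow_add_one₀ hτ.ne', zpow_add_one₀ hτ.ne' ((n : ℤ) + 1)] at hs
      have := ih (s / goldenRatio) ⟨(le_div_iff₀ hτ).2 hs.1, (div_lt_iff₀ hτ).2 hs.2⟩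
      rw [show s = goldenRatio * (s / goldenRatio) by field_simp, h _ (div_pos hpos hτ), this,
        mul_zero]
    | pred n ih =>
      intro s hs
      have hpos : 0 < s := (zpow_pos hτ _).trans_le hs.1
      have h1 := ih (goldenRatio * s) ⟨?_, ?_⟩
      · rw [h s hpos] at h1
        exact (mul_eq_zero.1 h1).resolve_left (by positivity)
      · have := mul_le_mul_of_nonneg_left hs.1 hτ.le
        rwa [← zpow_one_add₀ hτ.ne', add_sub_cancel] at this
      · have := mul_lt_mul_of_pos_left hs.2 hτ
        rwa [sub_add_cancel, ← zpow_one_add₀ hτ.ne', add_comm] at this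
  obtain ⟨n, hn⟩ := exists_mem_Ico_zpow hs one_lt_goldenRatio
  exact key n s hn

/-- The difference `k` vanishes on `{x ≤ y}`, so along the Euclidean step it only changes by a
factor. Off the golden ray the orbit ends where `k = 0`; on the ray the factor is `τ²` and the
values on `[1, τ)` decide. -/
theorem rhoEquation_unique {ρ ρ' : quadrant → ℝ} (h : RhoEquation ρ) (h' : RhoEquation ρ')
    (he : ∀ p : omega2, ρ (Set.inclusion omega2_subset_quadrant p) =
      ρ' (Set.inclusion omega2_subset_quadrant p)) : ρ = ρ' := by
  rw [rhoEquation_iff_euclid] at h h'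
  set k : ℝ → ℝ → ℝ := fun x y => quadrantValue ρ x y - quadrantValue ρ' x y with hk
  have k0 : ∀ x y, ![x, y] ∈ omega2 → k x y = 0 := by
    intro x y hxy
    have := he ⟨_, hxy⟩
    have hq := omega2_subset_quadrant hxy
    simp only [hk, quadrantValue, extendZero_of_mem ρ hq, extendZero_of_mem ρ' hq]
    exact sub_eq_zero.2 this
  have kle : ∀ x y, 0 ≤ x → x ≤ y → k x y = 0 := fun x y hx hxy => k0 x y (Or.inr ⟨hx, hxy⟩)
  have k1 : ∀ x, 0 < x → k x 0 = 0 := by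
    intro x hx
    have := kle x x hx.le le_rfl
    simp only [hk] at this ⊢
    rw [h.1 x hx, h'.1 x hx, this]
  have k2 : ∀ x y, 0 < y → y < x → y * k x y = (x + y) * k y (x - y) := by
    intro x y hy hxy
    have := kle y x hy.le hxy.le
    have e1 := h.2 x y hy hxy
    have e2 := h'.2 x y hy hxy
    simp only [hk] at this ⊢
    linear_combination e1 - e2 - x * this
  have kout : ∀ x y, 0 ≤ x → 0 ≤ y → ¬(0 < y ∧ y < x) → k x y = 0 := by
    intro x y hx hy hxy
    rcases le_or_gt x y with hle | hlt
    · exact kle x y hx hle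
    · rcases hy.eq_or_lt with rfl | hy
      · exact k1 x hlt
      · exact absurd ⟨hy, hlt⟩ hxy
  have kexit : ∀ n x y, 0 ≤ x → 0 ≤ y → EuclidExits n x y → k x y = 0 := by
    intro n
    induction n with
    | zero => exact fun x y hx hy h => kout x y hx hy h
    | succ n ih =>
      intro x y hx hy hn
      by_cases hxy : 0 < y ∧ y < x
      · have := k2 x y hxy.1 hxy.2
        rw [ih y (x - y) hy (by linarith) (hn hxy), mul_zero] at this
        exact (mul_eq_zero.1 this).resolve_left hxy.1.ne'
      · exact kout x y hx hy hxy
  refine quadrant_ext fun x y hx hy => sub_eq_zero.1 ?_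
  change k x y = 0
  by_cases hray : x = goldenRatio * y
  · rcases hy.eq_or_lt with rfl | hy
    · rw [mul_zero] at hray
      exact kle _ _ hx hray.le
    rw [hray]
    refine eq_zero_of_golden_scaling (k := fun s => k (goldenRatio * s) s) ?_ ?_ hy
    · intro s hs
      have hts : 0 < goldenRatio * s := mul_pos goldenRatio_pos hs
      have := k2 (goldenRatio * (goldenRatio * s)) (goldenRatio * s) hts
        (lt_mul_of_one_lt_left hts one_lt_goldenRatio)
      have e : goldenRatio * (goldenRatio * s) - goldenRatio * s = s := by
        linear_combination s * goldenRatio_sq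
      rw [e] at this
      refine mul_left_cancel₀ hts.ne' (this.trans ?_)
      linear_combination
        (-(goldenRatio * s * k (goldenRatio * s) s)) * goldenRatio_sq
    · intro s h1 h2
      exact k0 _ _ (Or.inl ⟨s, h1, h2, rfl⟩)
  · obtain ⟨n, hn⟩ := exists_euclidExits hray
    exact kexit n x y hx hy hn

theorem exists_int_seq (c : ℤ → ℝ) : ∃ a : ℤ → ℝ, a 0 = 0 ∧ ∀ n, a (n + 1) = a n + c n := by
  refine ⟨fun n => Int.rec (fun k => ∑ i ∈ Finset.range k, c i)
    (fun k => -∑ i ∈ Finset.range (k + 1), c (-((i : ℤ) + 1))) n, Finset.sum_range_zero _, ?_⟩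
  rintro (k | k)
  · change ∑ i ∈ Finset.range (k + 1), c i = ∑ i ∈ Finset.range k, c i + c k
    rw [Finset.sum_range_succ]
  · rcases k with _ | k
    · change ∑ i ∈ Finset.range 0, c i = -∑ i ∈ Finset.range (0 + 1), c (-((i : ℤ) + 1)) + c (-1)
      simp
    · change -∑ i ∈ Finset.range (k + 1), c (-((i : ℤ) + 1)) =
        -∑ i ∈ Finset.range (k + 1 + 1), c (-((i : ℤ) + 1)) + c (Int.negSucc (k + 1))
      rw [Finset.sum_range_succ _ (k + 1), Int.negSucc_eq]
      ring

/-- Each `s` is `τ ^ N` times a point of `[1, τ)`, with `N = ⌊log s / log τ⌋`. The solution is `e₀`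
at that point plus the two-sided sum of `c` along the orbit. -/
theorem exists_golden_extension (c e₀ : ℝ → ℝ) : ∃ e : ℝ → ℝ,
    (∀ s, 0 < s → e (goldenRatio * s) = e s + c s) ∧
    ∀ s, 1 ≤ s → s < goldenRatio → e s = e₀ s := by
  have hτ := goldenRatio_pos
  have hlog : 0 < log goldenRatio := log_pos one_lt_goldenRatio
  choose a ha0 ha using fun t : ℝ => exists_int_seq fun n => c (goldenRatio ^ n * t)
  set N : ℝ → ℤ := fun s => ⌊log s / log goldenRatio⌋ with hN
  refine ⟨fun s => e₀ (s / goldenRatio ^ N s) + a (s / goldenRatio ^ N s) (N s), ?_, ?_⟩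
  · intro s hs
    have e1 : N (goldenRatio * s) = N s + 1 := by
      simp only [hN]
      rw [log_mul hτ.ne' hs.ne', add_div, div_self hlog.ne', add_comm, Int.floor_add_one]
    have e2 : goldenRatio * s / goldenRatio ^ (N s + 1) = s / goldenRatio ^ N s := by
      rw [zpow_add_one₀ hτ.ne']
      field_simp
    simp only [e1, e2, ha]
    rw [mul_div_cancel₀ s (zpow_pos hτ _).ne', add_assoc]
  · intro s h1 h2
    have e1 : N s = 0 := by
      simp only [hN]
      rw [Int.floor_eq_zero_iff]
      exact ⟨div_nonneg (log_nonneg h1) hlog.le, (div_lt_one hlog).2 (log_lt_log (by linarith) h2)⟩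
    simp only [e1, zpow_zero, div_one, ha0, add_zero]

end ExpVal

namespace ExpVal

open MeasureTheory Filter Real

/-! ### Existence of the extension -/

open Classical in
/-- The values of a solution `ϱ` of the functional equation outside `{0 < y < x}`, in terms of its
restriction `r` to `{x ≤ y}`. -/
noncomputable def euclidBase (r : ℝ → ℝ → ℝ) (x y : ℝ) : ℝ :=
  if x ≤ y then r x y else if y = 0 then r x x else 0

open Classical in
/-- The values of a solution `ϱ` of the functional equation at the points that leave `{0 < y < x}`
after at most `n` steps of the subtractive Euclidean algorithm. -/
noncomputable def euclidIterate (r : ℝ → ℝ → ℝ) : ℕ → ℝ → ℝ → ℝ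
  | 0, x, y => euclidBase r x y
  | n + 1, x, y =>
    if 0 < y ∧ y < x then ((x + y) * euclidIterate r n y (x - y) - x * r y x) / y
    else euclidBase r x y

theorem euclidIterate_of_not (r : ℝ → ℝ → ℝ) (n : ℕ) {x y : ℝ} (h : ¬(0 < y ∧ y < x)) :
    euclidIterate r n x y = euclidBase r x y := by
  cases n with
  | zero => rfl
  | succ n => rw [euclidIterate, if_neg h]

theorem euclidIterate_eq_of_exits (r : ℝ → ℝ → ℝ) : ∀ {n m : ℕ} {x y : ℝ}, EuclidExits n x y →
    n ≤ m → euclidIterate r m x y = euclidIterate r n x y := by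
  intro n
  induction n with
  | zero =>
    intro m x y h _
    rw [euclidIterate_of_not r m h, euclidIterate_of_not r 0 h]
  | succ n ih =>
    intro m x y h hnm
    obtain ⟨m, rfl⟩ : ∃ m', m = m' + 1 := ⟨m - 1, by omega⟩
    by_cases hxy : 0 < y ∧ y < x
    · rw [euclidIterate, euclidIterate, if_pos hxy, if_pos hxy, ih (h hxy) (by omega)]
    · rw [euclidIterate_of_not r _ hxy, euclidIterate_of_not r _ hxy]

open Classical in
/-- The solution of the functional equation with values `r` on `{x ≤ y}` and `h s` at the points
`(τ s, s)`. -/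
noncomputable def euclidSolution (r : ℝ → ℝ → ℝ) (h : ℝ → ℝ) (x y : ℝ) : ℝ :=
  -- The golden ray is treated separately, since the descent never ends there.
  if x = goldenRatio * y ∧ 0 < y then h y
  else if hn : ∃ n, EuclidExits n x y then euclidIterate r (Nat.find hn) x y else 0

theorem euclidSolution_ray (r : ℝ → ℝ → ℝ) (h : ℝ → ℝ) {s : ℝ} (hs : 0 < s) :
    euclidSolution r h (goldenRatio * s) s = h s := if_pos ⟨rfl, hs⟩

theorem euclidSolution_of_exits (r : ℝ → ℝ → ℝ) (h : ℝ → ℝ) {x y : ℝ}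
    (hray : ¬(x = goldenRatio * y ∧ 0 < y)) {n : ℕ} (hn : EuclidExits n x y) :
    euclidSolution r h x y = euclidIterate r n x y := by
  classical
  have hex : ∃ n, EuclidExits n x y := ⟨n, hn⟩
  rw [euclidSolution, if_neg hray, dif_pos hex]
  exact (euclidIterate_eq_of_exits r (Nat.find_spec hex) (Nat.find_min' hex hn)).symm

theorem euclidSolution_of_not (r : ℝ → ℝ → ℝ) (h : ℝ → ℝ) {x y : ℝ} (hxy : ¬(0 < y ∧ y < x)) :
    euclidSolution r h x y = euclidBase r x y := by
  refine euclidSolution_of_exits r h ?_ (n := 0) hxy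
  rintro ⟨rfl, hy⟩
  exact hxy ⟨hy, lt_mul_of_one_lt_left hy one_lt_goldenRatio⟩

theorem euclidSolution_of_le (r : ℝ → ℝ → ℝ) (h : ℝ → ℝ) {x y : ℝ} (hxy : x ≤ y) :
    euclidSolution r h x y = r x y := by
  rw [euclidSolution_of_not r h fun h' => absurd h'.2 (not_lt.2 hxy), euclidBase, if_pos hxy]

/-- The hypothesis `hh` is (1) along the golden ray. Off the ray, `(y, x - y)` is off it as well and
exits one step earlier, so the equation is the recursion of `euclidIterate`. -/
theorem euclidSolution_equation (r : ℝ → ℝ → ℝ) (h : ℝ → ℝ)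
    (hh : ∀ s, 0 < s → h (goldenRatio * s) = goldenRatio ^ 2 * h s -
      goldenRatio * r (goldenRatio * s) (goldenRatio * (goldenRatio * s)))
    {x y : ℝ} (hy : 0 < y) (hxy : y < x) :
    y * euclidSolution r h x y =
      (x + y) * euclidSolution r h y (x - y) - x * euclidSolution r h y x := by
  rw [euclidSolution_of_le r h hxy.le]
  have hτ := goldenRatio_pos
  by_cases hray : x = goldenRatio * y
  · obtain ⟨s, rfl⟩ : ∃ s, y = goldenRatio * s := ⟨y / goldenRatio, by field_simp⟩
    have hs : 0 < s := pos_of_mul_pos_right hy hτ.le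
    subst hray
    have e : goldenRatio * (goldenRatio * s) - goldenRatio * s = s := by
      linear_combination s * goldenRatio_sq
    rw [e, euclidSolution_ray r h hy, euclidSolution_ray r h hs, hh s hs]
    linear_combination (goldenRatio * s * h s) * goldenRatio_sq
  · obtain ⟨n, hn⟩ := exists_euclidExits hray
    have hray' : ¬(y = goldenRatio * (x - y) ∧ 0 < x - y) := by
      rintro ⟨h1, -⟩
      apply hray
      refine mul_left_cancel₀ hτ.ne' ?_
      linear_combination (-1) * h1 - y * goldenRatio_sq
    rw [euclidSolution_of_exits r h (fun h => hray h.1) hn.succ,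
      euclidSolution_of_exits r h hray' (hn.succ ⟨hy, hxy⟩), euclidIterate, if_pos ⟨hy, hxy⟩]
    field_simp

/-! ### Measurability of the extension -/

theorem measurableSet_omega2 : MeasurableSet omega2 := by
  have m0 : Measurable fun p : Plane => p 0 := measurable_pi_apply 0
  have m1 : Measurable fun p : Plane => p 1 := measurable_pi_apply 1
  have e : omega2 = ({p | 1 ≤ p 1} ∩ {p | p 1 < goldenRatio} ∩ {p | p 0 = goldenRatio * p 1}) ∪
      ({p | 0 ≤ p 0} ∩ {p | p 0 ≤ p 1}) := by
    refine congrArg₂ _ ?_ rfl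
    ext p
    constructor
    · rintro ⟨s, h1, h2, rfl⟩
      exact ⟨⟨h1, h2⟩, rfl⟩
    · rintro ⟨⟨h1, h2⟩, h3⟩
      refine ⟨p 1, h1, h2, ?_⟩
      ext i
      fin_cases i
      · exact h3
      · rfl
  rw [e]
  exact (((measurableSet_le measurable_const m1).inter (measurableSet_lt m1 measurable_const)).inter
    (measurableSet_eq_fun m0 (m1.const_mul _))).union
    ((measurableSet_le measurable_const m0).inter (measurableSet_le m0 m1))

theorem ae_apply_zero_ne_golden : ∀ᵐ p : Plane, p 0 ≠ goldenRatio * p 1 := by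
  have h := (quasiMeasurePreserving_of_matrix !![0, 1; 1, -goldenRatio]
    (by simp [Matrix.det_fin_two_of])).ae ae_apply_one_ne_zero
  filter_upwards [h] with p hp hp'
  apply hp
  simp [dotProduct, hp']

theorem aemeasurable_of_cases {D : Set Plane} (hD : MeasurableSet D) {f g k : Plane → ℝ}
    (hf : AEMeasurable f volume) (hg : AEMeasurable g volume) (h1 : ∀ p ∈ D, k p = f p)
    (h2 : ∀ᵐ p : Plane, p ∉ D → k p = g p) : AEMeasurable k volume := by
  refine ((hf.indicator hD).add (hg.indicator hD.compl)).congr ?_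
  filter_upwards [h2] with p hp
  by_cases h : p ∈ D
  · simp [h, h1 p h]
  · simp [h, hp h]

theorem aemeasurable_euclidIterate {r : ℝ → ℝ → ℝ}
    (hr : AEMeasurable (fun p : Plane => r (p 0) (p 1)) volume) (n : ℕ) :
    AEMeasurable (fun p : Plane => euclidIterate r n (p 0) (p 1)) volume := by
  have m0 : Measurable fun p : Plane => p 0 := measurable_pi_apply 0
  have m1 : Measurable fun p : Plane => p 1 := measurable_pi_apply 1
  have hbase : AEMeasurable (fun p : Plane => euclidBase r (p 0) (p 1)) volume := by
    refine aemeasurable_of_cases (measurableSet_le m0 m1) hr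
      (g := 0) (measurable_const (a := (0 : ℝ))).aemeasurable ?_ ?_
    · intro p hp
      exact if_pos hp
    · filter_upwards [ae_apply_one_ne_zero] with p hp hp'
      rw [euclidBase, if_neg hp', if_neg hp]
      rfl
  induction n with
  | zero => exact hbase
  | succ n ih =>
    have h1 : AEMeasurable (fun p : Plane => euclidIterate r n (p 1) (p 0 - p 1)) volume := by
      have := ih.comp_quasiMeasurePreserving
        (quasiMeasurePreserving_of_matrix !![0, 1; 1, -1] (by simp [Matrix.det_fin_two_of]))
      convert this using 1
      funext p
      simp [dotProduct, sub_eq_add_neg]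
    have h2 : AEMeasurable (fun p : Plane => r (p 1) (p 0)) volume := by
      have := hr.comp_quasiMeasurePreserving
        (quasiMeasurePreserving_of_matrix !![0, 1; 1, 0] (by simp [Matrix.det_fin_two_of]))
      convert this using 1
      funext p
      simp [dotProduct]
    refine aemeasurable_of_cases
      (((measurableSet_lt (measurable_const (a := (0 : ℝ))) m1).inter (measurableSet_lt m1 m0)))
      (f := fun p => ((p 0 + p 1) * euclidIterate r n (p 1) (p 0 - p 1) - p 0 * r (p 1) (p 0)) / p 1)
      ?_ hbase ?_ ?_
    · exact (((m0.add m1).aemeasurable.mul h1).sub (m0.aemeasurable.mul h2)).div m1.aemeasurable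
    · intro p hp
      exact if_pos hp
    · exact Eventually.of_forall fun p hp => if_neg hp

/-- Off the golden ray, a null line, the iterates are eventually constant with the solution as their
value. Any `h` is therefore allowed. -/
theorem aemeasurable_euclidSolution {r : ℝ → ℝ → ℝ}
    (hr : AEMeasurable (fun p : Plane => r (p 0) (p 1)) volume) (h : ℝ → ℝ) :
    AEMeasurable (fun p : Plane => euclidSolution r h (p 0) (p 1)) volume := by
  refine aemeasurable_of_tendsto_metrizable_ae' (aemeasurable_euclidIterate hr) ?_
  filter_upwards [ae_apply_zero_ne_golden] with p hp
  obtain ⟨n, hn⟩ := exists_euclidExits hp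
  refine tendsto_const_nhds.congr' ?_
  filter_upwards [eventually_ge_atTop n] with m hm
  exact euclidSolution_of_exits r h (fun h => hp h.1) (hn.mono hm)

theorem existsUnique_isRhoExtension {ρt : omega2 → ℝ} (hρt : IsLebesgueMeasurable ρt) :
    ∃! ρ : quadrant → ℝ, IsRhoExtension ρt ρ := by
  set r : ℝ → ℝ → ℝ := fun x y => extendZero ρt ![x, y] with hr
  have vec : ∀ p : Plane, ![p 0, p 1] = p := by
    intro p
    ext i
    fin_cases i <;> rfl
  -- The substitution `h(s) = s² e(s)` absorbs the factor `τ²` and makes the recursion along the ray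
  -- purely additive.
  obtain ⟨e, he, he0⟩ := exists_golden_extension
    (fun s => -(goldenRatio * r (goldenRatio * s) (goldenRatio * (goldenRatio * s))) /
      (goldenRatio * s) ^ 2) (fun s => r (goldenRatio * s) s / s ^ 2)
  set h : ℝ → ℝ := fun s => s ^ 2 * e s with hh
  have hscale : ∀ s, 0 < s → h (goldenRatio * s) = goldenRatio ^ 2 * h s -
      goldenRatio * r (goldenRatio * s) (goldenRatio * (goldenRatio * s)) := by
    intro s hs
    have hts : goldenRatio * s ≠ 0 := (mul_pos goldenRatio_pos hs).ne'
    simp only [hh]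
    rw [he s hs, mul_add, mul_div_cancel₀ _ (pow_ne_zero 2 hts)]
    ring
  have hm : AEMeasurable (fun p : Plane => r (p 0) (p 1)) volume := by
    simp only [hr, vec]
    exact (isLebesgueMeasurable_iff measurableSet_omega2 ρt).1 hρt
  have hval : ∀ x y, 0 ≤ x → 0 ≤ y →
      quadrantValue (fun p => euclidSolution r h (p.1 0) (p.1 1)) x y = euclidSolution r h x y :=
    fun x y hx hy => (quadrantValue_eq _ hx hy).symm
  refine existsUnique_of_exists_of_unique
    ⟨fun p => euclidSolution r h (p.1 0) (p.1 1), ?_, ?_, ?_⟩ fun ρ₁ ρ₂ h₁ h₂ =>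
      rhoEquation_unique h₁.equation h₂.equation fun p => (h₁.restrict p).trans (h₂.restrict p).symm
  · rw [isLebesgueMeasurable_iff measurableSet_quadrant]
    refine aemeasurable_of_cases measurableSet_quadrant (aemeasurable_euclidSolution hm h)
      (g := 0) (measurable_const (a := (0 : ℝ))).aemeasurable ?_ ?_
    · intro p hp
      rw [extendZero_of_mem _ hp]
    · exact Eventually.of_forall fun p hp => dif_neg hp
  · rintro ⟨p, hp⟩
    rw [← extendZero_apply ρt]
    rcases hp with ⟨s, h1, h2, rfl⟩ | ⟨h0, h1⟩
    · change euclidSolution r h (goldenRatio * s) s = r (goldenRatio * s) s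
      have hs : 0 < s := by linarith
      rw [euclidSolution_ray r h hs]
      simp only [hh]
      rw [he0 s h1 h2]
      field_simp
    · change euclidSolution r h (p 0) (p 1) = extendZero ρt p
      rw [euclidSolution_of_le r h h1]
      simp only [hr, vec]
  · rw [rhoEquation_iff_euclid]
    refine ⟨fun x hx => ?_, fun x y hy hxy => ?_⟩
    · rw [hval x 0 hx.le le_rfl, hval x x hx.le hx.le, euclidSolution_of_le r h le_rfl,
        euclidSolution_of_not r h fun h' => lt_irrefl _ h'.1, euclidBase, if_neg (not_le.2 hx),
        if_pos rfl]
    · have hx : 0 ≤ x := by linarith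
      rw [hval x y hx hy.le, hval y x hy.le hx, hval y (x - y) hy.le (by linarith)]
      exact euclidSolution_equation r h hscale hy hxy

end ExpVal

namespace ExpVal

open MeasureTheory

/-! ### The symbol of a valuation -/

theorem plane_eta (p : Plane) : ![p 0, p 1] = p := by
  ext i
  fin_cases i <;> rfl

theorem valuation_hull_affine {Z : LatticePolytope → Plane → ℝ}
    (ht : IsTranslativelyExponential Z) (hg : IsGLCovariant Z) (A : Matrix (Fin 2) (Fin 2) ℤ)
    (hA : IsUnit A.det) (z : Fin 2 → ℤ) {S : Finset (Fin 2 → ℤ)} (hS : S.Nonempty) (x y : ℝ) :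
    Z (hull (S.image fun w => A.mulVec w + z)) ![x, y] = Real.exp (z 0 * x + z 1 * y) *
      Z (hull S) ![A 0 0 * x + A 1 0 * y, A 0 1 * x + A 1 1 * y] := by
  have h := ht ((hull S).image (Matrix.GeneralLinearGroup.mk'' A hA)) z ![x, y]
  rw [hg, hull_image _ hS, hull_translate (hS.image _), Finset.image_image, dotProduct_plane,
    ← plane_eta (glMapTranspose _ _), glMapTranspose_apply_zero, glMapTranspose_apply_one] at h
  exact h

/-- The unit square. -/
noncomputable def unitSquare : LatticePolytope :=
  hull {![0, 0], ![1, 1], ![1, 0], ![0, 1]}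

section Triangle

variable {Z : LatticePolytope → Plane → ℝ}

theorem valuation_stdTriangle_swap (ht : IsTranslativelyExponential Z) (hg : IsGLCovariant Z)
    (x y : ℝ) : Z stdTriangle ![x, y] = Z stdTriangle ![y, x] := by
  have h := valuation_hull_affine ht hg !![0, 1; 1, 0] (by simp [Matrix.det_fin_two_of]) 0
    (S := {![1, 0], ![0, 1], ![0, 0]}) (by simp) x y
  have e : (({![1, 0], ![0, 1], ![0, 0]} : Finset (Fin 2 → ℤ)).image fun w =>
      (!![0, 1; 1, 0] : Matrix (Fin 2) (Fin 2) ℤ).mulVec w + 0) = {![1, 0], ![0, 1], ![0, 0]} := by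
    decide
  rw [e] at h
  rw [stdTriangle_eq, tri, h]
  simp

/-- The affine map used permutes the vertices of `T` cyclically. -/
theorem valuation_stdTriangle_rotate (ht : IsTranslativelyExponential Z) (hg : IsGLCovariant Z)
    (x y : ℝ) : Z stdTriangle ![x, y] = Real.exp x * Z stdTriangle ![y - x, -x] := by
  have h := valuation_hull_affine ht hg !![-1, -1; 1, 0] (by simp [Matrix.det_fin_two_of]) ![1, 0]
    (S := {![1, 0], ![0, 1], ![0, 0]}) (by simp) x y
  have e : (({![1, 0], ![0, 1], ![0, 0]} : Finset (Fin 2 → ℤ)).image fun w =>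
      (!![-1, -1; 1, 0] : Matrix (Fin 2) (Fin 2) ℤ).mulVec w + ![1, 0]) =
      {![1, 0], ![0, 1], ![0, 0]} := by
    decide
  rw [e] at h
  rw [stdTriangle_eq, tri, h]
  simp [sub_eq_neg_add]

/-- The square is cut along the diagonal from `e₁` to `e₂`; the upper half is the image of `T` under
an affine unimodular map. -/
theorem valuation_unitSquare (hv : IsValuation Z) (hs : IsSimple Z)
    (ht : IsTranslativelyExponential Z) (hg : IsGLCovariant Z) (x y : ℝ) :
    Z unitSquare ![x, y] =
      Z stdTriangle ![x, y] + Real.exp x * Z stdTriangle ![y - x, y] := by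
  have h := valuation_hull_affine ht hg !![-1, 0; 1, 1] (by simp [Matrix.det_fin_two_of]) ![1, 0]
    (S := {![1, 0], ![0, 1], ![0, 0]}) (by simp) x y
  have e : (({![1, 0], ![0, 1], ![0, 0]} : Finset (Fin 2 → ℤ)).image fun w =>
      (!![-1, 0; 1, 1] : Matrix (Fin 2) (Fin 2) ℤ).mulVec w + ![1, 0]) =
      {![1, 1], ![1, 0], ![0, 1]} := by
    decide
  have hq := valuation_quad_of_mul_neg hv hs (a := ![0, 0]) (b := ![1, 0]) (c := ![0, 1])
    (d := ![1, 1]) ⟨![1 / 2, 1 / 2], ?_, ?_⟩ (by simp [cross])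
  · rw [unitSquare, hq, Pi.add_apply, stdTriangle_eq, tri_rotate ![0, 0]]
    congr 1
    rw [e] at h
    rw [tri, h, tri]
    simp [sub_eq_neg_add]
  · refine ⟨1 / 2, 1 / 2, by norm_num, by norm_num, by norm_num, ?_⟩
    ext i
    fin_cases i <;> simp [toPlane]
  · refine ⟨1 / 2, 1 / 2, by norm_num, by norm_num, by norm_num, ?_⟩
    ext i
    fin_cases i <;> simp [toPlane]

theorem valuation_unitSquare_swap (ht : IsTranslativelyExponential Z) (hg : IsGLCovariant Z)
    (x y : ℝ) : Z unitSquare ![x, y] = Z unitSquare ![y, x] := by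
  have h := valuation_hull_affine ht hg !![0, 1; 1, 0] (by simp [Matrix.det_fin_two_of]) 0
    (S := {![0, 0], ![1, 1], ![1, 0], ![0, 1]}) (by simp) x y
  have e : (({![0, 0], ![1, 1], ![1, 0], ![0, 1]} : Finset (Fin 2 → ℤ)).image fun w =>
      (!![0, 1; 1, 0] : Matrix (Fin 2) (Fin 2) ℤ).mulVec w + 0) =
      {![0, 0], ![1, 1], ![1, 0], ![0, 1]} := by
    decide
  rw [e] at h
  rw [unitSquare, h]
  simp

theorem valuation_unitSquare_neg (ht : IsTranslativelyExponential Z) (hg : IsGLCovariant Z)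
    (x y : ℝ) : Z unitSquare ![x, y] = Real.exp x * Z unitSquare ![-x, y] := by
  have h := valuation_hull_affine ht hg !![-1, 0; 0, 1] (by simp [Matrix.det_fin_two_of]) ![1, 0]
    (S := {![0, 0], ![1, 1], ![1, 0], ![0, 1]}) (by simp) x y
  have e : (({![0, 0], ![1, 1], ![1, 0], ![0, 1]} : Finset (Fin 2 → ℤ)).image fun w =>
      (!![-1, 0; 0, 1] : Matrix (Fin 2) (Fin 2) ℤ).mulVec w + ![1, 0]) =
      {![0, 0], ![1, 1], ![1, 0], ![0, 1]} := by
    decide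
  rw [e] at h
  rw [unitSquare, h]
  simp

/-- The symbol `Z([0, 1]²)(p, q) / (φ(p) φ(q))` of the valuation `Z`. -/
noncomputable def symbolOfValuation (Z : LatticePolytope → Plane → ℝ) (p q : ℝ) : ℝ :=
  Z unitSquare ![p, q] / (phi p * phi q)

theorem symbolOfValuation_mul (p q : ℝ) :
    phi p * phi q * symbolOfValuation Z p q = Z unitSquare ![p, q] :=
  mul_div_cancel₀ _ (mul_pos (phi_pos p) (phi_pos q)).ne'

/-- The square at `(x, y)` and at `(y - x, y)` involves the same two values of `Z(T)`. Eliminating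
the one at `(y - x, y)` leaves `(e^y - 1) Z(T)(x, y)`, and `e^y - 1 = y φ(y)`. -/
theorem valuation_stdTriangle_eq_symbol (hv : IsValuation Z) (hs : IsSimple Z)
    (ht : IsTranslativelyExponential Z) (hg : IsGLCovariant Z) (x y : ℝ) :
    y * Z stdTriangle ![x, y] = Real.exp x * phi (y - x) * symbolOfValuation Z (y - x) y -
      phi x * symbolOfValuation Z x y := by
  have h1 := symbolOfValuation_mul (Z := Z) (y - x) y
  have h2 := symbolOfValuation_mul (Z := Z) x y
  rw [valuation_unitSquare hv hs ht hg, sub_sub_cancel] at h1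
  rw [valuation_unitSquare hv hs ht hg] at h2
  have h3 := phi_mul_self y
  have h4 : Real.exp x * Real.exp (y - x) = Real.exp y := by rw [← Real.exp_add]; ring_nf
  refine mul_left_cancel₀ (phi_pos y).ne' ?_
  linear_combination Z stdTriangle ![x, y] * h3 - Real.exp x * h1 + h2 -
    Z stdTriangle ![x, y] * h4

theorem symbolOfValuation_symm (ht : IsTranslativelyExponential Z) (hg : IsGLCovariant Z)
    (p q : ℝ) : symbolOfValuation Z p q = symbolOfValuation Z q p := by
  rw [symbolOfValuation, symbolOfValuation, valuation_unitSquare_swap ht hg, mul_comm (phi p)]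

theorem symbolOfValuation_neg (ht : IsTranslativelyExponential Z) (hg : IsGLCovariant Z)
    (p q : ℝ) : symbolOfValuation Z (-p) q = symbolOfValuation Z p q := by
  rw [symbolOfValuation, symbolOfValuation, valuation_unitSquare_neg ht hg (-p), neg_neg,
    phi_neg, mul_assoc, mul_div_mul_left _ _ (Real.exp_pos _).ne']

/-- Only the three-term relation needs work: it compares the formula for `Z(T)` at `(p, p + q)` and
at `(p + q, p)`, where the values agree by symmetry of `T`. -/
theorem isSymbol_symbolOfValuation (hv : IsValuation Z) (hs : IsSimple Z)
    (ht : IsTranslativelyExponential Z) (hg : IsGLCovariant Z) :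
    IsSymbol (symbolOfValuation Z) where
  symm := symbolOfValuation_symm ht hg
  even := symbolOfValuation_neg ht hg
  add p q := by
    have h1 := valuation_stdTriangle_eq_symbol hv hs ht hg p (p + q)
    have h2 := valuation_stdTriangle_eq_symbol hv hs ht hg (p + q) p
    rw [valuation_stdTriangle_swap ht hg (p + q) p, show p - (p + q) = -q by ring,
      symbolOfValuation_neg ht hg, phi_neg, symbolOfValuation_symm ht hg q p,
      symbolOfValuation_symm ht hg (p + q) p] at h2
    rw [add_sub_cancel_left] at h1
    have h3 := phi_mul_self p
    have h4 := phi_mul_self q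
    have h5 := phi_mul_self (p + q)
    have h6 : Real.exp (p + q) * Real.exp (-q) = Real.exp p := by rw [← Real.exp_add]; ring_nf
    have h7 : Real.exp (p + q) = Real.exp p * Real.exp q := Real.exp_add p q
    refine mul_left_cancel₀ (mul_pos (Real.exp_pos p) (phi_pos q)).ne' ?_
    linear_combination p * h1 - (p + q) * h2 - (p + q) * phi q * symbolOfValuation Z p q * h6 +
      symbolOfValuation Z p (p + q) * (h5 - h3 - Real.exp p * h4 + h7)

open Classical in
/-- The function `ϱ` of the valuation `Z`. -/
noncomputable def rhoOfValuation (Z : LatticePolytope → Plane → ℝ) (p : quadrant) : ℝ :=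
  -- The origin is separate: there the symbol is `Z` of the square, twice the required `Z(T)(0, 0)`.
  -- Equation (1) imposes nothing at this point.
  if p.1 = 0 then Z stdTriangle ![0, 0] else symbolOfValuation Z (p.1 0) (p.1 0 + p.1 1)

theorem quadrantValue_rhoOfValuation {x y : ℝ} (hx : 0 ≤ x) (hy : 0 ≤ y) (h : 0 < x + y) :
    quadrantValue (rhoOfValuation Z) x y = symbolOfValuation Z x (x + y) := by
  rw [← quadrantValue_eq _ hx hy]
  refine if_neg fun h0 => h.ne' ?_
  have e0 : x = 0 := congrFun h0 0
  have e1 : y = 0 := congrFun h0 1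
  rw [e0, e1, add_zero]

theorem rhoOfValuation_zero :
    rhoOfValuation Z (quadrantMk 0 0 le_rfl le_rfl) = Z stdTriangle ![0, 0] := by
  refine if_pos ?_
  ext i
  fin_cases i <;> rfl

theorem rhoEquation_rhoOfValuation (hZ : IsSimpleExpValuation Z) :
    RhoEquation (rhoOfValuation Z) := by
  have hS := isSymbol_symbolOfValuation hZ.valuation hZ.simple hZ.translativelyExponential
    hZ.glCovariant
  rw [rhoEquation_iff]
  intro x y hx hy
  rcases hx.eq_or_lt with rfl | hx
  · simp
  · have hxy : 0 ≤ x + y := by linarith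
    rw [quadrantValue_rhoOfValuation hx.le hy (by linarith),
      quadrantValue_rhoOfValuation hx.le hxy (by linarith),
      quadrantValue_rhoOfValuation hxy hx.le (by linarith)]
    have := hS.add x (x + y)
    rw [add_comm (x + y) x]
    linear_combination this

theorem triangleFormula_rhoOfValuation (hZ : IsSimpleExpValuation Z) :
    TriangleFormula (Z stdTriangle) (rhoOfValuation Z) := by
  rw [triangleFormula_iff]
  intro x y hx hxy hy
  rw [quadrantValue_rhoOfValuation (sub_nonneg.2 hxy) hx (by linarith),
    quadrantValue_rhoOfValuation hx (sub_nonneg.2 hxy) (by linarith),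
    valuation_stdTriangle_eq_symbol hZ.valuation hZ.simple hZ.translativelyExponential
      hZ.glCovariant, sub_add_cancel, add_sub_cancel]

theorem isLebesgueMeasurable_rhoOfValuation (hZ : IsSimpleExpValuation Z) :
    IsLebesgueMeasurable (rhoOfValuation Z) := by
  rw [isLebesgueMeasurable_iff measurableSet_quadrant]
  have m0 : Measurable fun p : Plane => p 0 := measurable_pi_apply 0
  have m1 : Measurable fun p : Plane => p 1 := measurable_pi_apply 1
  have h1 : AEMeasurable (fun p : Plane => Z unitSquare ![p 0, p 0 + p 1]) volume := by
    have h : AEMeasurable (Z unitSquare) volume := (hZ.measurable unitSquare).aemeasurable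
    have := h.comp_quasiMeasurePreserving
      (quasiMeasurePreserving_of_matrix !![1, 0; 1, 1] (by simp [Matrix.det_fin_two_of]))
    convert this using 1
    funext p
    simp [dotProduct]
  refine aemeasurable_of_cases (D := quadrant \ {0})
    (measurableSet_quadrant.diff (measurableSet_singleton 0))
    (f := fun p => symbolOfValuation Z (p 0) (p 0 + p 1)) ?_
    (g := 0) (measurable_const (a := (0 : ℝ))).aemeasurable ?_ ?_
  · exact h1.div ((measurable_phi.comp m0).mul (measurable_phi.comp (m0.add m1))).aemeasurable
  · rintro p ⟨hp, hp0⟩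
    rw [extendZero_of_mem _ hp]
    exact if_neg hp0
  · filter_upwards [ae_apply_one_ne_zero] with p hp hpD
    refine dif_neg fun hq => hpD ⟨hq, ?_⟩
    rintro rfl
    exact hp rfl

end Triangle

/-! ### Uniqueness -/

/-- Formula (2) at `(x, x + y)` plus `e^x` times (2) at `(y, x + y)` eliminates `ϱ(y, x)` and leaves
`(e^(x+y) - 1) φ(x) ϱ(x, y)`, whose factor is nonzero away from the origin. -/
theorem quadrant_eq_of_triangleFormula {f : Plane → ℝ} {ρ ρ' : quadrant → ℝ}
    (h : TriangleFormula f ρ) (h' : TriangleFormula f ρ')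
    (h0 : ρ (quadrantMk 0 0 le_rfl le_rfl) = ρ' (quadrantMk 0 0 le_rfl le_rfl)) : ρ = ρ' := by
  rw [triangleFormula_iff] at h h'
  refine quadrant_ext fun x y hx hy => ?_
  rcases (add_nonneg hx hy).eq_or_lt with hxy | hxy
  · obtain rfl : x = 0 := by linarith
    obtain rfl : y = 0 := by linarith
    rwa [quadrantValue_eq ρ, quadrantValue_eq ρ'] at h0
  · have a1 := h x (x + y) hx (by linarith) hxy
    have a2 := h y (x + y) hy (by linarith) hxy
    have b1 := h' x (x + y) hx (by linarith) hxy
    have b2 := h' y (x + y) hy (by linarith) hxy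
    rw [add_sub_cancel_left] at a1 b1
    rw [add_sub_cancel_right] at a2 b2
    have e : (Real.exp (x + y) - 1) * phi x * (quadrantValue ρ x y - quadrantValue ρ' x y) = 0 := by
      rw [Real.exp_add]
      linear_combination b1 - a1 + Real.exp x * (b2 - a2)
    have hexp : 0 < Real.exp (x + y) - 1 := sub_pos.2 (Real.one_lt_exp_iff.2 hxy)
    exact sub_eq_zero.1 ((mul_eq_zero.1 e).resolve_left (mul_pos hexp (phi_pos x)).ne')

/-- Formula (2) and the value at the origin fix `Z(T)` on `{0 ≤ x ≤ y}`. The coordinate swap extends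
this to the quadrant, and the rotation of `T` takes any `(x, y)` with `x ≤ 0` and `x ≤ y` into the
quadrant. -/
theorem valuation_eq_of_triangleFormula {Z Z' : LatticePolytope → Plane → ℝ}
    (hZ : IsSimpleExpValuation Z) (hZ' : IsSimpleExpValuation Z') {ρ : quadrant → ℝ}
    (h : TriangleFormula (Z stdTriangle) ρ) (h' : TriangleFormula (Z' stdTriangle) ρ)
    (h0 : Z stdTriangle ![0, 0] = Z' stdTriangle ![0, 0]) : Z = Z' := by
  refine valuation_eq_of_stdTriangle_eq hZ.valuation hZ.simple hZ.translativelyExponential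
    hZ.glCovariant hZ'.valuation hZ'.simple hZ'.translativelyExponential hZ'.glCovariant ?_
  have swap : ∀ x y, Z stdTriangle ![x, y] = Z' stdTriangle ![x, y] →
      Z stdTriangle ![y, x] = Z' stdTriangle ![y, x] := by
    intro x y hxy
    rw [valuation_stdTriangle_swap hZ.translativelyExponential hZ.glCovariant, hxy,
      valuation_stdTriangle_swap hZ'.translativelyExponential hZ'.glCovariant]
  have hle : ∀ x y, 0 ≤ x → x ≤ y → Z stdTriangle ![x, y] = Z' stdTriangle ![x, y] := by
    intro x y hx hxy
    rcases (hx.trans hxy).eq_or_lt with rfl | hy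
    · obtain rfl := le_antisymm hxy hx
      exact h0
    · exact (h x y hx hxy hy).trans (h' x y hx hxy hy).symm
  have hnonneg : ∀ x y, 0 ≤ x → 0 ≤ y → Z stdTriangle ![x, y] = Z' stdTriangle ![x, y] := by
    intro x y hx hy
    rcases le_total x y with hxy | hxy
    · exact hle x y hx hxy
    · exact swap y x (hle y x hy hxy)
  have hmin : ∀ x y, x ≤ y → Z stdTriangle ![x, y] = Z' stdTriangle ![x, y] := by
    intro x y hxy
    rcases le_total 0 x with hx | hx
    · exact hle x y hx hxy
    · rw [valuation_stdTriangle_rotate hZ.translativelyExponential hZ.glCovariant,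
        valuation_stdTriangle_rotate hZ'.translativelyExponential hZ'.glCovariant,
        hnonneg _ _ (sub_nonneg.2 hxy) (neg_nonneg.2 hx)]
  funext p
  rw [← plane_eta p]
  rcases le_total (p 0) (p 1) with hp | hp
  · exact hmin _ _ hp
  · exact swap _ _ (hmin _ _ hp)

/-! ### The parametrization -/

theorem isSimpleExpValuation_of_isRhoExtension {ρt : omega2 → ℝ} {ρ : quadrant → ℝ}
    (h : IsRhoExtension ρt ρ) : IsSimpleExpValuation (symbolValuation (symbolOf ρ)) :=
  isSimpleExpValuation_symbolValuation (isSymbol_symbolOf h.equation)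
    (aemeasurable_symbolOf h.measurable)

theorem triangleFormula_symbolValuation {ρ : quadrant → ℝ} (h : RhoEquation ρ) :
    TriangleFormula (symbolValuation (symbolOf ρ) stdTriangle) ρ := by
  rw [triangleFormula_iff]
  intro x y hx hxy hy
  have hne : (![x, y] : Plane) ≠ 0 := fun h0 => hy.ne' (congrFun h0 1)
  have hS := symbolValuation_stdTriangle (isSymbol_symbolOf h) hne
  have e1 := symbolOf_of_le ρ (p := y - x) (q := y) (sub_nonneg.2 hxy) (by linarith)
  rw [sub_sub_cancel] at e1
  rw [← e1, ← symbolOf_of_le ρ hx hxy]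
  exact hS

theorem symbolValuation_symbolOf_zero {ρt : omega2 → ℝ} {ρ : quadrant → ℝ}
    (h : IsRhoExtension ρt ρ) :
    symbolValuation (symbolOf ρ) stdTriangle ![0, 0] = ρt omega2Zero := by
  have e : (![0, 0] : Plane) = 0 := plane_eta 0
  rw [e, symbolValuation_stdTriangle_zero, symbolOf_of_le ρ le_rfl le_rfl, ← h.restrict, sub_zero,
    ← quadrantValue_eq ρ le_rfl le_rfl]
  rfl

theorem isLebesgueMeasurable_restrict_omega2 {ρ : quadrant → ℝ} (h : IsLebesgueMeasurable ρ) :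
    IsLebesgueMeasurable fun p : omega2 => ρ (Set.inclusion omega2_subset_quadrant p) := by
  rw [isLebesgueMeasurable_iff measurableSet_quadrant] at h
  rw [isLebesgueMeasurable_iff measurableSet_omega2]
  refine aemeasurable_of_cases measurableSet_omega2 h
    (g := 0) (measurable_const (a := (0 : ℝ))).aemeasurable ?_ ?_
  · intro p hp
    rw [extendZero_of_mem _ hp, extendZero_of_mem ρ (omega2_subset_quadrant hp)]
  · exact Filter.Eventually.of_forall fun p hp => dif_neg hp

end ExpVal

/-! ### The bijection -/

open ExpVal

theorem mainTheorem2 :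
    ∃ F : ExpVal.MeasurableFun ExpVal.omega2 → ExpVal.SimpleExpValuation,
      -- the parametrization is one-to-one and onto
      Function.Bijective F ∧
      -- (i)
      (∀ ρt : ExpVal.MeasurableFun ExpVal.omega2,
        (∃! ρ : ExpVal.quadrant → ℝ, ExpVal.IsRhoExtension ρt.1 ρ) ∧
        ∀ ρ : ExpVal.quadrant → ℝ, ExpVal.IsRhoExtension ρt.1 ρ →
          ((F ρt).1 ExpVal.stdTriangle ![0, 0] = ρt.1 ExpVal.omega2Zero ∧
            ExpVal.TriangleFormula ((F ρt).1 ExpVal.stdTriangle) ρ) ∧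
          ∀ Z : ExpVal.SimpleExpValuation,
            Z.1 ExpVal.stdTriangle ![0, 0] = ρt.1 ExpVal.omega2Zero →
            ExpVal.TriangleFormula (Z.1 ExpVal.stdTriangle) ρ → Z = F ρt) ∧
      -- (ii)
      (∀ Z : ExpVal.SimpleExpValuation,
        ∃! ρ : ExpVal.quadrant → ℝ,
          ExpVal.IsLebesgueMeasurable ρ ∧ ExpVal.RhoEquation ρ ∧
          Z.1 ExpVal.stdTriangle ![0, 0] = ρ (ExpVal.quadrantMk 0 0 le_rfl le_rfl) ∧
          ExpVal.TriangleFormula (Z.1 ExpVal.stdTriangle) ρ) := by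
  choose ρ hρ hρu using fun ρt : MeasurableFun omega2 => existsUnique_isRhoExtension ρt.2
  have hzero : ∀ ρt : MeasurableFun omega2,
      ρ ρt (quadrantMk 0 0 le_rfl le_rfl) = ρt.1 omega2Zero := fun ρt => (hρ ρt).restrict omega2Zero
  refine ⟨fun ρt => ⟨_, isSimpleExpValuation_of_isRhoExtension (hρ ρt)⟩, ⟨?_, ?_⟩, ?_, ?_⟩
  · intro ρt ρt' hF
    have hF' := congrArg Subtype.val hF
    dsimp only at hF'
    have e : ρ ρt = ρ ρt' := by
      refine quadrant_eq_of_triangleFormula (triangleFormula_symbolValuation (hρ ρt).equation)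
        (hF' ▸ triangleFormula_symbolValuation (hρ ρt').equation) ?_
      rw [hzero, hzero, ← symbolValuation_symbolOf_zero (hρ ρt), hF',
        symbolValuation_symbolOf_zero (hρ ρt')]
    apply Subtype.ext
    funext p
    rw [← (hρ ρt).restrict, e, (hρ ρt').restrict]
  · rintro ⟨Z, hZ⟩
    have hm := isLebesgueMeasurable_rhoOfValuation hZ
    -- The preimage of `Z` is the restriction of its own `ϱ`, which by uniqueness is the extension
    -- constructed from that restriction.
    have hext : rhoOfValuation Z = ρ ⟨_, isLebesgueMeasurable_restrict_omega2 hm⟩ :=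
      hρu _ _ ⟨hm, fun _ => rfl, rhoEquation_rhoOfValuation hZ⟩
    refine ⟨⟨_, isLebesgueMeasurable_restrict_omega2 hm⟩, Subtype.ext ?_⟩
    refine valuation_eq_of_triangleFormula (isSimpleExpValuation_of_isRhoExtension (hρ _)) hZ
      (triangleFormula_symbolValuation (hρ _).equation) ?_ ?_
    · rw [← hext]
      exact triangleFormula_rhoOfValuation hZ
    · exact (symbolValuation_symbolOf_zero (hρ _)).trans rhoOfValuation_zero
  · intro ρt
    refine ⟨⟨ρ ρt, hρ ρt, hρu ρt⟩, fun ρ' hρ' => ?_⟩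
    obtain rfl := hρu ρt ρ' hρ'
    refine ⟨⟨symbolValuation_symbolOf_zero (hρ ρt),
      triangleFormula_symbolValuation (hρ ρt).equation⟩, fun Z h0 hZ => Subtype.ext ?_⟩
    exact valuation_eq_of_triangleFormula Z.2 (isSimpleExpValuation_of_isRhoExtension (hρ ρt)) hZ
      (triangleFormula_symbolValuation (hρ ρt).equation)
      (h0.trans (symbolValuation_symbolOf_zero (hρ ρt)).symm)
  · rintro ⟨Z, hZ⟩
    refine ⟨rhoOfValuation Z, ⟨isLebesgueMeasurable_rhoOfValuation hZ,
      rhoEquation_rhoOfValuation hZ, rhoOfValuation_zero.symm, triangleFormula_rhoOfValuation hZ⟩, ?_⟩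
    rintro ρ' ⟨-, -, h0, h1⟩
    exact quadrant_eq_of_triangleFormula h1 (triangleFormula_rhoOfValuation hZ)
      (h0.symm.trans rhoOfValuation_zero.symm)
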